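/- Setting. Fix integers $r_1,r_2,r_3\ge 1$. Consider a family of one-layer KANs of size $(n,m,n_d)$, in the regime $n\to\infty$, $n_d\to\infty$ ($m$ may vary arbitrarily). For each member of the family there are given basis functions $b_1,\dots,b_{n_d}:\mathbb R\to\mathbb R$, a fixed pre-trained tensor $\mathcal A_{\mathrm{pt}}\in\mathbb R^{n\times m\times n_d}$ and one training pair $(\boldsymbol x,\boldsymbol y)\in\mathbb R^n\times\mathbb R^m$. The KAN with parameter tensor $\mathcal A=(a_{p,q,k})$ has outputs $\Psi(\boldsymbol x;\mathcal A)_q=\sum_{p=1}^n\sum_{k=1}^{n_d}a_{p,q,k}b_k(x_p)$. LoTRA uses $\mathcal A_{\mathrm{ft}}=\mathcal A_{\mathrm{pt}}+\mathcal G\times_1\boldsymbol U^{(1)}\times_2\boldsymbol U^{(2)}\times_3\boldsymbol U^{(3)}$ with trainable $\mathcal G=(g^{p,q,k})\in\mathbb R^{r_1\times r_2\times r_3}$, $\boldsymbol U^{(1)}\in\mathbb R^{n\times r_1}$, $\boldsymbol U^{(2)}\in\mathbb R^{m\times r_2}$, $\boldsymbol U^{(3)}\in\mathbb R^{n_d\times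 r_3}$; $\boldsymbol u^{(i),j}$ denotes the $j$-th column of $\boldsymbol U^{(i)}$. These are trained by plain gradient descent on $\mathcal L=\frac12\|\Psi(\boldsymbol x;\mathcal A_{\mathrm{ft}})-\boldsymbol y\|_2^2$, all updated simultaneously, with positive learning rates $\eta_0,\eta_1,\eta_2,\eta_3$ for $\mathcal G,\boldsymbol U^{(1)},\boldsymbol U^{(2)},\boldsymbol U^{(3)}$ that may depend on the member of the family. A subscript $t$ denotes values after $t$ steps. Let $\boldsymbol v_t=\Psi(\boldsymbol x;\mathcal A_{\mathrm{ft},t})-\boldsymbol y$ and let $\boldsymbol X\in\mathbb R^{n\times n_d}$ have entries $X_{p,k}=b_k(x_p)$. Initialization. $\mathcal G_0=0$; the columns $\boldsymbol u_0^{(1),p}\sim\mathcal N(\boldsymbol 0,\frac1n\boldsymbol I)$ and $\boldsymbol u_0^{(3),k}\sim\mathcal N(\boldsymbol 0,\frac1{n_d}\boldsymbol I)$ are all independent; $\boldsymbol U_0^{(2)}$ is deterministic with $\|\boldsymbol u_0^{(2),q}\|_2=\Theta(1)$ and $|\boldsymbol u_0^{(2),q\top}\boldsymbol v_0|=\Theta(1)$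 for each $q$. Assume moreover $\|\boldsymbol v_0\|_2=O(1)$ and $\|\boldsymbol X\|_F^2=\Theta(n\,n_d)$. First-order terms. The linearization in the learning rates of the change of $\Psi(\boldsymbol x;\mathcal A_{\mathrm{ft}})$ in step $t$ is $\sum_{p,q,k}\delta_{t,0}^{p,q,k}+\sum_p\delta_{t,1}^p+\sum_q\delta_{t,2}^q+\sum_k\delta_{t,3}^k$ where, with all quantities on the right taken at step $t-1$, \begin{align*} \delta_{t,0}^{p,q,k}&=-\eta_0\,(\boldsymbol v^\top\boldsymbol u^{(2),q})\,(\boldsymbol u^{(1),p\top}\boldsymbol X\boldsymbol u^{(3),k})^2\,\boldsymbol u^{(2),q},\\ \delta_{t,1}^{p}&=-\eta_1\sum_{q,k}g^{p,q,k}\Big(\sum_{q',k'}g^{p,q',k'}(\boldsymbol v^\top\boldsymbol u^{(2),q'})(\boldsymbol u^{(3),k'\top}\boldsymbol X^\top\boldsymbol X\boldsymbol u^{(3),k})\Big)\boldsymbol u^{(2),q},\\ \delta_{t,2}^{q}&=-\eta_2\sum_{p,k}g^{p,q,k}\Big(\sum_{p',k'}g^{p',q,k'}\,\boldsymbol u^{(1),p'\top}\boldsymbol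 X\boldsymbol u^{(3),k'}\Big)(\boldsymbol u^{(1),p\top}\boldsymbol X\boldsymbol u^{(3),k})\,\boldsymbol v,\\ \delta_{t,3}^{k}&=-\eta_3\sum_{p,q}g^{p,q,k}\Big(\sum_{p',q'}g^{p',q',k}(\boldsymbol v^\top\boldsymbol u^{(2),q'})(\boldsymbol u^{(1),p\top}\boldsymbol X\boldsymbol X^\top\boldsymbol u^{(1),p'})\Big)\boldsymbol u^{(2),q}. \end{align*} Training is called efficient if for every fixed $t\ge2$ the Euclidean norms of all these terms are $\Theta(1)$ with high probability in the model size: for every $\varepsilon>0$ there are constants $0<c\le C$, not depending on the model size, such that for all sufficiently large models, with probability at least $1-\varepsilon$ over the initialization, the norms of all $\delta_{t,0}^{p,q,k},\delta_{t,1}^p,\delta_{t,2}^q,\delta_{t,3}^k$ lie in $[c,C]$. Theorem. (i) If $\eta_0,\eta_1,\eta_2,\eta_3$ all have the same order of magnitude in the model size (each is $\Theta$ of each other one), then training is not efficient; indeed there is a step $t\ge2$ such that, for all constants $0<c\le C$, the probability that all the norms at step $t$ lie in $[c,C]$ tends to $0$. (ii) If $\eta_0=\Theta(1)$, $\eta_1=\Theta(n^{-1})$,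 $\eta_2=\Theta(1)$, $\eta_3=\Theta(n_d^{-1})$, then training is efficient. -/

import Mathlib

open Filter Topology MeasureTheory ProbabilityTheory Asymptotics
open scoped InnerProductSpace Matrix

noncomputable section

namespace LoTRA

/-- The fine-tuning task for a one-layer KAN with input dimension `n`, output dimension `m` and
`nd` basis functions: the basis functions, the (frozen) pre-trained parameter tensor, and the
single training pair `(x, y)` of the new task. -/
structure Task (n m nd : ℕ) where
  basis : Fin nd → ℝ → ℝ
  pretrained : Fin n → Fin m → Fin nd → ℝ
  x : EuclideanSpace ℝ (Fin n)
  y : EuclideanSpace ℝ (Fin m)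

/-- The trainable parameters of LoTRA with core size `(r₁, r₂, r₃)`: the core tensor and the three
transformation matrices, each matrix given by its list of columns. -/
structure Params (r₁ r₂ r₃ n m nd : ℕ) where
  G : Fin r₁ × Fin r₂ × Fin r₃ → ℝ
  U₁ : Fin r₁ → EuclideanSpace ℝ (Fin n)
  U₂ : Fin r₂ → EuclideanSpace ℝ (Fin m)
  U₃ : Fin r₃ → EuclideanSpace ℝ (Fin nd)

/-- The output of a one-layer KAN: `z_q = ∑_p ∑_k a_{p,q,k} b_k(x_p)`. -/
def kan {n m nd : ℕ} (b : Fin nd → ℝ → ℝ) (A : Fin n → Fin m → Fin nd → ℝ)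
    (x : EuclideanSpace ℝ (Fin n)) : EuclideanSpace ℝ (Fin m) :=
  WithLp.toLp 2 fun q => ∑ p, ∑ k, A p q k * b k (x p)

section

variable {r₁ r₂ r₃ n m nd : ℕ}

/-- The Tucker product `G ×₁ U₁ ×₂ U₂ ×₃ U₃`. -/
def tucker (θ : Params r₁ r₂ r₃ n m nd) : Fin n → Fin m → Fin nd → ℝ :=
  fun a b c => ∑ p, ∑ q, ∑ k, θ.G (p, q, k) * θ.U₁ p a * θ.U₂ q b * θ.U₃ k c

/-- The output of the pre-trained model at the training input. -/
def Task.pretrainedOutput (T : Task n m nd) : EuclideanSpace ℝ (Fin m) :=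
  kan T.basis T.pretrained T.x

/-- The output of the fine-tuned model at the training input. -/
def Task.output (T : Task n m nd) (θ : Params r₁ r₂ r₃ n m nd) : EuclideanSpace ℝ (Fin m) :=
  kan T.basis (T.pretrained + tucker θ) T.x

/-- The loss `½ ‖Ψ(x) - y‖²`. -/
def Task.loss (T : Task n m nd) (θ : Params r₁ r₂ r₃ n m nd) : ℝ :=
  1 / 2 * ‖T.output θ - T.y‖ ^ 2

/-- The matrix `X` with entries `X_{p,k} = b_k(x_p)`. -/
def Task.X (T : Task n m nd) : Matrix (Fin n) (Fin nd) ℝ :=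
  Matrix.of fun p k => T.basis k (T.x p)

/-- The squared Frobenius norm of `X`. -/
def Task.frobSq (T : Task n m nd) : ℝ := ∑ p, ∑ k, T.X p k ^ 2

/-- The initial residual `v₀ = Ψ_pt(x) - y`. -/
def Task.initialResidual (T : Task n m nd) : EuclideanSpace ℝ (Fin m) :=
  T.pretrainedOutput - T.y

/-- The residual `v = Ψ(x) - y`, the derivative of the loss with respect to the output. -/
def Task.residual (T : Task n m nd) (θ : Params r₁ r₂ r₃ n m nd) : EuclideanSpace ℝ (Fin m) :=
  T.output θ - T.y

/-- One simultaneous step of plain gradient descent on the loss, with learning rates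
`η 0, η 1, η 2, η 3` for the core and for the three transformation matrices. -/
def Task.gdStep (T : Task n m nd) (η : Fin 4 → ℝ) (θ : Params r₁ r₂ r₃ n m nd) :
    Params r₁ r₂ r₃ n m nd where
  G := fun j => θ.G j - η 0 * deriv (fun s => T.loss { θ with G := Function.update θ.G j s }) (θ.G j)
  U₁ := fun p => θ.U₁ p -
    η 1 • gradient (fun u => T.loss { θ with U₁ := Function.update θ.U₁ p u }) (θ.U₁ p)
  U₂ := fun q => θ.U₂ q -
    η 2 • gradient (fun u => T.loss { θ with U₂ := Function.update θ.U₂ q u }) (θ.U₂ q)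
  U₃ := fun k => θ.U₃ k -
    η 3 • gradient (fun u => T.loss { θ with U₃ := Function.update θ.U₃ k u }) (θ.U₃ k)

/-- The parameters after `t` steps of gradient descent started at `θ₀`. -/
def Task.gd (T : Task n m nd) (η : Fin 4 → ℝ) (θ₀ : Params r₁ r₂ r₃ n m nd) (t : ℕ) :
    Params r₁ r₂ r₃ n m nd :=
  (T.gdStep η)^[t] θ₀

/-- The bilinear expression `u₁ᵀ X u₃`. -/
def Task.bil (T : Task n m nd) (u : EuclideanSpace ℝ (Fin n)) (w : EuclideanSpace ℝ (Fin nd)) : ℝ :=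
  u.ofLp ⬝ᵥ (T.X *ᵥ w.ofLp)

/-- The first-order term `δ₀^{p,q,k}` of the change of the output in the step that starts at `θ`. -/
def Task.delta₀ (T : Task n m nd) (η : Fin 4 → ℝ) (θ : Params r₁ r₂ r₃ n m nd)
    (p : Fin r₁) (q : Fin r₂) (k : Fin r₃) : EuclideanSpace ℝ (Fin m) :=
  (-(η 0 * ⟪T.residual θ, θ.U₂ q⟫_ℝ * T.bil (θ.U₁ p) (θ.U₃ k) ^ 2)) • θ.U₂ q

/-- The first-order term `δ₁^p`. -/
def Task.delta₁ (T : Task n m nd) (η : Fin 4 → ℝ) (θ : Params r₁ r₂ r₃ n m nd)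
    (p : Fin r₁) : EuclideanSpace ℝ (Fin m) :=
  (-η 1) • ∑ q, ∑ k, (θ.G (p, q, k) * ∑ q', ∑ k', θ.G (p, q', k') *
    ⟪T.residual θ, θ.U₂ q'⟫_ℝ *
    ((θ.U₃ k').ofLp ⬝ᵥ ((T.Xᵀ * T.X) *ᵥ (θ.U₃ k).ofLp))) • θ.U₂ q

/-- The first-order term `δ₂^q`. -/
def Task.delta₂ (T : Task n m nd) (η : Fin 4 → ℝ) (θ : Params r₁ r₂ r₃ n m nd)
    (q : Fin r₂) : EuclideanSpace ℝ (Fin m) :=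
  (-(η 2 * ∑ p, ∑ k, θ.G (p, q, k) *
    (∑ p', ∑ k', θ.G (p', q, k') * T.bil (θ.U₁ p') (θ.U₃ k')) *
    T.bil (θ.U₁ p) (θ.U₃ k))) • T.residual θ

/-- The first-order term `δ₃^k`. -/
def Task.delta₃ (T : Task n m nd) (η : Fin 4 → ℝ) (θ : Params r₁ r₂ r₃ n m nd)
    (k : Fin r₃) : EuclideanSpace ℝ (Fin m) :=
  (-η 3) • ∑ p, ∑ q, (θ.G (p, q, k) * ∑ p', ∑ q', θ.G (p', q', k) *
    ⟪T.residual θ, θ.U₂ q'⟫_ℝ *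
    ((θ.U₁ p).ofLp ⬝ᵥ ((T.X * T.Xᵀ) *ᵥ (θ.U₁ p').ofLp))) • θ.U₂ q

/-- All first-order terms of the step that starts at `θ` have norm in `[c, C]`. -/
def Task.TermsWithin (T : Task n m nd) (η : Fin 4 → ℝ) (θ : Params r₁ r₂ r₃ n m nd)
    (c C : ℝ) : Prop :=
  (∀ p q k, ‖T.delta₀ η θ p q k‖ ∈ Set.Icc c C) ∧
  (∀ p, ‖T.delta₁ η θ p‖ ∈ Set.Icc c C) ∧
  (∀ q, ‖T.delta₂ η θ q‖ ∈ Set.Icc c C) ∧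
  (∀ k, ‖T.delta₃ η θ k‖ ∈ Set.Icc c C)

end

/-- The law of the random initial columns of `U₁` and `U₃`: all columns are independent, the columns
of `U₁` have law `N(0, I/n)` and those of `U₃` have law `N(0, I/nd)`. -/
def initLaw (r₁ r₃ n nd : ℕ) :
    Measure ((Fin r₁ → EuclideanSpace ℝ (Fin n)) × (Fin r₃ → EuclideanSpace ℝ (Fin nd))) :=
  (Measure.pi fun _ => multivariateGaussian 0 ((n : ℝ)⁻¹ • (1 : Matrix (Fin n) (Fin n) ℝ))).prod
    (Measure.pi fun _ => multivariateGaussian 0 ((nd : ℝ)⁻¹ • (1 : Matrix (Fin nd) (Fin nd) ℝ)))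

/-- The initial parameters: zero core, the given `U₂`, and the sampled `U₁` and `U₃`. -/
def initParams {r₁ r₂ r₃ n m nd : ℕ} (U₂ : Fin r₂ → EuclideanSpace ℝ (Fin m))
    (ω : (Fin r₁ → EuclideanSpace ℝ (Fin n)) × (Fin r₃ → EuclideanSpace ℝ (Fin nd))) :
    Params r₁ r₂ r₃ n m nd where
  G := 0
  U₁ := ω.1
  U₂ := U₂
  U₃ := ω.2

/-- The probability, over the random initialization, that all first-order terms of the `t`-th step
of gradient descent (`t ≥ 1`; this step starts at the parameters after `t - 1` steps) have norm in
`[c, C]`. -/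
def probWithin (r₁ r₃ : ℕ) {r₂ n m nd : ℕ} (T : Task n m nd) (η : Fin 4 → ℝ)
    (U₂ : Fin r₂ → EuclideanSpace ℝ (Fin m)) (t : ℕ) (c C : ℝ) : ℝ :=
  (initLaw r₁ r₃ n nd).real {ω | T.TermsWithin η (T.gd η (initParams U₂ ω) (t - 1)) c C}

/-- Training is efficient along a family of models: for every `t ≥ 2`, all first-order terms are
`Θ(1)` in the model size, with high probability over the initialization. That is, for every `ε > 0`
there are constants `0 < c ≤ C` not depending on the model size such that, for all sufficiently large
models, with probability at least `1 - ε` all the norms lie in `[c, C]`. -/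
def IsEfficient (r₁ r₃ : ℕ) {r₂ : ℕ} {ι : Type*} (l : Filter ι) {n m nd : ι → ℕ}
    (T : ∀ i, Task (n i) (m i) (nd i)) (η : ι → Fin 4 → ℝ)
    (U₂ : ∀ i, Fin r₂ → EuclideanSpace ℝ (Fin (m i))) : Prop :=
  ∀ t : ℕ, 2 ≤ t → ∀ ε : ℝ, 0 < ε → ∃ c C : ℝ, 0 < c ∧ c ≤ C ∧
    ∀ᶠ i in l, 1 - ε ≤ probWithin r₁ r₃ (T i) (η i) (U₂ i) t c C

end LoTRA

end

/-! Three facts carry the proof. Write B for the matrix of pairings `u₁ᵀ X u₃`.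

Anti-concentration. Each component of a first-order term along the initial residual `v₀` is a
polynomial in the Gaussian initial values, of a degree depending on the step only and not on the
model size. For such polynomials there is a dimension-free small-ball bound (`exists_smallBall`): if
|f| ≥ a with probability at least p, then |f| < c has probability at most ε for some c = c(a, p, ε,
degree). A lower bound with high probability therefore follows from a lower bound on any event whose
probability stays away from zero.

Efficiency (`Admissible.isEfficient`). Multiplying `U₁` by √n and `U₃` by √nd, and dividing X by √(n
nd), preserves the dynamics and all terms and turns the tuned rates into rates of order one. Upper
bounds then follow by induction on the step, on the event that the initial pairings and the images
of the columns under X and its transpose are bounded. For lower bounds an event is constructed on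
which one pairing is of a small order τ and all others are at most τ² (`exists_nearlySingle_right`,
`exists_nearlySingle_left`); its probability is bounded below for each fixed τ. Up to O(τ²),
training then follows the linear recursion `model` for B and the negated contracted core Γ, namely B
↦ B + η₁ Γ Q + η₃ P Γ and Γ ↦ Γ + e B, with P and Q the initial Gram matrices of the images of the
columns and e ≥ 0. Since P and Q are positive semidefinite and B starts with a single nonnegative
entry, the relevant quantities never cancel. The components along `v₀` are of order at least τ², or
τ⁴ for the terms of `U₂`; fixing τ small makes them bounded below.

Inefficiency (`Admissible.tendsto_probWithin_two`). As the core starts at zero, the first step moves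
only the core, so the terms of the second step have closed forms. They involve the energy E = ∑ B²,
the direction w = ∑ ⟨v₀, u₂⟩ u₂, and for each column of `U₁` the mixture of the columns of `U₃`
weighted by their pairings with it. With all rates comparable, a `U₂` term bounded below forces η₀
to be bounded below. The `U₁` term has norm η₁ η₀² |⟨v₀, w⟩ - η₀ E ‖w‖²| ‖X mixture‖² ‖w‖, and the
last squared norm involving X is of order at least n. This exceeds any constant unless E is close to
one deterministic value or the image of the mixture is atypically small, and both are excluded by
anti-concentration. -/

noncomputable section

namespace LoTRA

/-! ### Dimension-free anti-concentration of Gaussian polynomials -/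

open Polynomial in
/-- Polynomials of bounded degree that are small at `d + 1` nodes of a fixed finite set are small at
`0` and `1`, with a uniform constant. -/
lemma exists_extrapolation_bound (S : Finset ℝ) (d : ℕ) :
    ∃ Λ : ℝ, 1 ≤ Λ ∧ ∀ (P : ℝ[X]) (s : Finset ℝ) (b : ℝ), P.natDegree ≤ d → s ⊆ S → d < s.card →
      0 ≤ b → (∀ x ∈ s, |P.eval x| ≤ b) → |P.eval 0| ≤ Λ * b ∧ |P.eval 1| ≤ Λ * b := by
  classical
  let w : Finset ℝ → ℝ → ℝ := fun s z => ∑ i ∈ s, |(Lagrange.basis s id i).eval z|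
  have hw : ∀ s z, 0 ≤ w s z := fun s z => Finset.sum_nonneg fun _ _ => abs_nonneg _
  -- `w s z` is the Lebesgue function of the nodes `s`. Summing over all subsets of `S` makes the
  -- constant independent of which nodes are used.
  refine ⟨1 + ∑ s ∈ S.powerset, (w s 0 + w s 1), ?_, ?_⟩
  · have : 0 ≤ ∑ s ∈ S.powerset, (w s 0 + w s 1) :=
      Finset.sum_nonneg fun s _ => add_nonneg (hw s 0) (hw s 1)
    linarith
  intro P s b hP hs hcard hb hsmall
  have hle : w s 0 + w s 1 ≤ ∑ s ∈ S.powerset, (w s 0 + w s 1) :=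
    Finset.single_le_sum (f := fun s => w s 0 + w s 1)
      (fun s _ => add_nonneg (hw s 0) (hw s 1)) (Finset.mem_powerset.2 hs)
  have key : ∀ z, |P.eval z| ≤ w s z * b := by
    intro z
    have hdeg : P.degree < s.card :=
      lt_of_le_of_lt (Polynomial.degree_le_natDegree) (by exact_mod_cast lt_of_le_of_lt hP hcard)
    have h := Lagrange.eq_interpolate (f := P) (s := s) (v := id) (Set.injOn_id _) hdeg
    conv_lhs => rw [h]
    rw [Lagrange.interpolate_apply, Polynomial.eval_finsetSum, Finset.sum_mul]
    refine (Finset.abs_sum_le_sum_abs _ _).trans (Finset.sum_le_sum fun i hi => ?_)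
    rw [Polynomial.eval_mul, Polynomial.eval_C, abs_mul, mul_comm]
    exact mul_le_mul_of_nonneg_left (hsmall i hi) (abs_nonneg _)
  constructor
  · refine (key 0).trans (mul_le_mul_of_nonneg_right ?_ hb)
    linarith [hw s 1]
  · refine (key 1).trans (mul_le_mul_of_nonneg_right ?_ hb)
    linarith [hw s 0]

section PolyDegLE

variable {V : Type*} [AddCommGroup V] [Module ℝ V]

/-- `f` is polynomial of degree at most `d` on every ellipse `a • x + b • y`, `a² + b² = 1`
(in the rational parametrization of the circle). -/
def PolyDegLE (d : ℕ) (f : V → ℝ) : Prop :=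
  ∀ x y : V, ∃ P : Polynomial ℝ, P.natDegree ≤ 2 * d ∧ ∀ s : ℝ,
    P.eval s = (1 + s ^ 2) ^ d *
      f (((1 - s ^ 2) / (1 + s ^ 2)) • x + (2 * s / (1 + s ^ 2)) • y)

namespace PolyDegLE

variable {d d' : ℕ} {f g : V → ℝ}

open Polynomial in
lemma mono (hf : PolyDegLE d f) (h : d ≤ d') : PolyDegLE d' f := by
  intro x y
  obtain ⟨P, hP, hPs⟩ := hf x y
  refine ⟨(1 + X ^ 2) ^ (d' - d) * P, ?_, fun s => ?_⟩
  · have h2 : (1 + X ^ 2 : ℝ[X]).natDegree ≤ 2 := by compute_degree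
    have := Polynomial.natDegree_pow_le_of_le (d' - d) h2
    refine Polynomial.natDegree_mul_le.trans ?_
    omega
  · have : (1 + s ^ 2) ^ d' = (1 + s ^ 2) ^ (d' - d) * (1 + s ^ 2) ^ d := by
      rw [← pow_add]; congr 1; omega
    simp [hPs, this, mul_assoc]

lemma const (c : ℝ) : PolyDegLE d (fun _ : V => c) := by
  refine mono (d := 0) (fun x y => ⟨Polynomial.C c, by simp, fun s => by simp⟩) (Nat.zero_le _)

lemma add (hf : PolyDegLE d f) (hg : PolyDegLE d g) : PolyDegLE d (fun x => f x + g x) := by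
  intro x y
  obtain ⟨P, hP, hPs⟩ := hf x y
  obtain ⟨Q, hQ, hQs⟩ := hg x y
  exact ⟨P + Q, Polynomial.natDegree_add_le_of_degree_le hP hQ,
    fun s => by simp [hPs, hQs, mul_add]⟩

lemma mul (hf : PolyDegLE d f) (hg : PolyDegLE d' g) : PolyDegLE (d + d') (fun x => f x * g x) := by
  intro x y
  obtain ⟨P, hP, hPs⟩ := hf x y
  obtain ⟨Q, hQ, hQs⟩ := hg x y
  refine ⟨P * Q, ?_, fun s => ?_⟩
  · have := Polynomial.natDegree_mul_le (p := P) (q := Q)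
    omega
  · simp only [Polynomial.eval_mul, hPs, hQs, pow_add]; ring

lemma const_mul (c : ℝ) (hf : PolyDegLE d f) : PolyDegLE d (fun x => c * f x) := by
  simpa using (const (d := 0) c).mul hf

lemma neg (hf : PolyDegLE d f) : PolyDegLE d (fun x => -f x) := by
  simpa using hf.const_mul (-1)

lemma sub (hf : PolyDegLE d f) (hg : PolyDegLE d g) : PolyDegLE d (fun x => f x - g x) := by
  simpa [sub_eq_add_neg] using hf.add hg.neg

lemma sum {ι : Type*} (s : Finset ι) {F : ι → V → ℝ} (h : ∀ i ∈ s, PolyDegLE d (F i)) :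
    PolyDegLE d (fun x => ∑ i ∈ s, F i x) := by
  classical
  induction s using Finset.induction_on with
  | empty => simpa using const (V := V) (d := d) 0
  | insert a s ha ih =>
    simp only [Finset.sum_insert ha]
    exact (h a (Finset.mem_insert_self _ _)).add
      (ih fun i hi => h i (Finset.mem_insert_of_mem hi))

lemma pow (hf : PolyDegLE d f) (k : ℕ) : PolyDegLE (k * d) (fun x => f x ^ k) := by
  induction k with
  | zero => simpa using const (V := V) (d := 0) 1
  | succ k ih => simpa [pow_succ, Nat.succ_mul] using ih.mul hf

open Polynomial in
lemma linear (φ : V →ₗ[ℝ] ℝ) : PolyDegLE 1 (fun x => φ x) := by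
  intro x y
  refine ⟨(1 - X ^ 2) * C (φ x) + 2 * X * C (φ y), ?_, fun s => ?_⟩
  · compute_degree
  · have : (1 + s ^ 2) ≠ 0 := by positivity
    simp only [map_add, map_smul, smul_eq_mul]
    field_simp
    simp
    ring_nf
    simp

end PolyDegLE

end PolyDegLE

section SmallBall

variable {V : Type*} [NormedAddCommGroup V] [NormedSpace ℝ V] [MeasurableSpace V] [BorelSpace V]
  [SecondCountableTopology V] [CompleteSpace V]

/-- A centered Gaussian measure is stable under `(x, y) ↦ a x + b y` for `a² + b² = 1`. -/
lemma measurePreserving_rotate (μ : Measure V) [IsGaussian μ]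
    (hμ : ∀ L : StrongDual ℝ V, ∫ x, L x ∂μ = 0) {a b : ℝ} (hab : a ^ 2 + b ^ 2 = 1) :
    MeasurePreserving (fun z : V × V => a • z.1 + b • z.2) (μ.prod μ) μ := by
  obtain ⟨θ, rfl, rfl⟩ : ∃ θ : ℝ, Real.cos θ = a ∧ Real.sin θ = b := by
    have h : ‖(⟨a, b⟩ : ℂ)‖ = 1 := by
      rw [Complex.norm_def, Complex.normSq_mk, ← sq, ← sq, hab, Real.sqrt_one]
    refine ⟨Complex.arg ⟨a, b⟩, ?_, ?_⟩
    · have h0 : (⟨a, b⟩ : ℂ) ≠ 0 := by intro h0; simp [h0] at h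
      rw [Complex.cos_arg h0, h]; simp
    · rw [Complex.sin_arg, h]; simp
  have h := IsGaussian.map_rotation_eq_self_of_forall_strongDual_eq_zero (μ := μ) hμ θ
  have h1 : MeasurePreserving (ContinuousLinearMap.rotation θ : V × V →L[ℝ] V × V)
      (μ.prod μ) (μ.prod μ) :=
    ⟨(ContinuousLinearMap.rotation θ : V × V →L[ℝ] V × V).measurable, h⟩
  have h2 := (measurePreserving_fst (μ := μ) (ν := μ)).comp h1
  convert h2 using 1
  ext z
  simp [ContinuousLinearMap.rotation_apply]

/-- For independent x, y of law μ, every point of the circle arc from x to y again has law μ. Along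
N fixed points of that arc, f is up to a bounded factor a polynomial of degree at most 2D. Either at
most 2D of these values are small, a fraction below η, or extrapolation makes f small at both
endpoints. The endpoints are independent, which produces the square. Neither N nor K involves the
space V. -/
lemma smallBall_step (D : ℕ) {η : ℝ} (hη : 0 < η) :
    ∃ K : ℝ, 0 < K ∧ ∀ {V : Type} [NormedAddCommGroup V] [NormedSpace ℝ V] [MeasurableSpace V]
      [BorelSpace V] [SecondCountableTopology V] [CompleteSpace V] (μ : Measure V) [IsGaussian μ]
      (_ : ∀ L : StrongDual ℝ V, ∫ x, L x ∂μ = 0) (f : V → ℝ) (_ : PolyDegLE D f)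
      (_ : Measurable f) (c : ℝ) (_ : 0 < c),
      μ.real {x | |f x| < c} ≤ η + μ.real {x | |f x| < K * c} ^ 2 := by
  classical
  obtain ⟨N, hN⟩ := exists_nat_gt (2 * D / η)
  have hN0 : 0 < (N : ℝ) := lt_of_le_of_lt (by positivity) hN
  let S : Finset ℝ := (Finset.range N).image fun j : ℕ => (j : ℝ) / N
  have hinj : Function.Injective fun j : ℕ => (j : ℝ) / N := by
    intro i j hij
    have := (div_left_inj' hN0.ne').1 hij
    exact_mod_cast this
  have hScard : S.card = N := by
    rw [Finset.card_image_of_injective _ hinj, Finset.card_range]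
  obtain ⟨Λ, hΛ1, hΛ⟩ := exists_extrapolation_bound S (2 * D)
  -- The factor `2 ^ D` bounds `(1 + s ^ 2) ^ D` on the nodes, which lie in [0, 1); the summand 1
  -- makes the final inequality strict.
  refine ⟨Λ * 2 ^ D + 1, by positivity, ?_⟩
  intro V _ _ _ _ _ _ μ _ hμ f hf hfm c hc
  set A : Set V := {x | |f x| < c} with hA
  set A' : Set V := {x | |f x| < (Λ * 2 ^ D + 1) * c} with hA'
  have hAm : MeasurableSet A := measurableSet_lt (by fun_prop) measurable_const
  have hA'm : MeasurableSet A' := measurableSet_lt (by fun_prop) measurable_const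
  let R : ℝ → V × V → V := fun s z =>
    ((1 - s ^ 2) / (1 + s ^ 2)) • z.1 + (2 * s / (1 + s ^ 2)) • z.2
  have hR : ∀ s, MeasurePreserving (R s) (μ.prod μ) μ := by
    intro s
    refine measurePreserving_rotate μ hμ ?_
    have : (1 + s ^ 2) ≠ 0 := by positivity
    field_simp
    ring
  have hpoint : ∀ z : V × V, ∑ s ∈ S, (R s ⁻¹' A).indicator (1 : V × V → ℝ) z ≤
      2 * D + N * (A' ×ˢ A').indicator (1 : V × V → ℝ) z := by
    intro z
    set s₀ := S.filter fun s => R s z ∈ A with hs₀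
    have hsum : ∑ s ∈ S, (R s ⁻¹' A).indicator (1 : V × V → ℝ) z = s₀.card := by
      rw [hs₀, Finset.card_filter]
      push_cast
      refine Finset.sum_congr rfl fun s _ => ?_
      simp [Set.indicator_apply]
    rw [hsum]
    by_cases hcard : 2 * D < s₀.card
    · obtain ⟨P, hPd, hP⟩ := hf z.1 z.2
      have hs1 : ∀ s ∈ s₀, |P.eval s| ≤ 2 ^ D * c := by
        intro s hs
        have hsS := (Finset.mem_filter.1 hs).1
        have hsA : |f (R s z)| < c := (Finset.mem_filter.1 hs).2
        obtain ⟨j, hj, rfl⟩ := Finset.mem_image.1 hsS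
        have hj1 : ((j : ℝ) / N) ^ 2 ≤ 1 := by
          have h1 : (j : ℝ) / N ≤ 1 := by
            rw [div_le_one hN0]; exact_mod_cast (Finset.mem_range.1 hj).le
          have h0 : 0 ≤ (j : ℝ) / N := by positivity
          nlinarith
        rw [hP, abs_mul, abs_of_nonneg (by positivity)]
        gcongr
        · linarith
      obtain ⟨h0, h1⟩ := hΛ P s₀ (2 ^ D * c) hPd (Finset.filter_subset _ _) hcard
        (by positivity) hs1
      have hz : z ∈ A' ×ˢ A' := by
        -- The parameters 0 and 1 of the rational parametrization correspond to the two endpoints of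
        -- the quarter circle.
        have e0 : P.eval 0 = f z.1 := by rw [hP]; simp
        have e1 : P.eval 1 = 2 ^ D * f z.2 := by rw [hP]; norm_num
        rw [e0] at h0
        rw [e1, abs_mul, abs_of_nonneg (by positivity)] at h1
        have h2 : (1 : ℝ) ≤ 2 ^ D := one_le_pow₀ (by norm_num)
        have h3 : |f z.2| ≤ 2 ^ D * |f z.2| := le_mul_of_one_le_left (abs_nonneg _) h2
        constructor
        · show |f z.1| < _
          nlinarith
        · show |f z.2| < _
          nlinarith
      rw [Set.indicator_of_mem hz]
      have : (s₀.card : ℝ) ≤ N := by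
        rw [← hScard]; exact_mod_cast Finset.card_filter_le _ _
      have hD : (0 : ℝ) ≤ D := by positivity
      simp only [Pi.one_apply]
      linarith
    · have h1 : (s₀.card : ℝ) ≤ 2 * D := by exact_mod_cast not_lt.1 hcard
      have h2 : 0 ≤ (A' ×ˢ A').indicator (1 : V × V → ℝ) z :=
        Set.indicator_nonneg (fun _ _ => by simp) _
      nlinarith
  have hint : N * μ.real A ≤ 2 * D + N * μ.real A' ^ 2 := by
    have h1 : ∀ s, ∫ z, (R s ⁻¹' A).indicator (1 : V × V → ℝ) z ∂(μ.prod μ) = μ.real A := by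
      intro s
      rw [integral_indicator_one ((hR s).measurable hAm), (hR s).measureReal_preimage
        hAm.nullMeasurableSet]
    have h2 : ∫ z, (A' ×ˢ A').indicator (1 : V × V → ℝ) z ∂(μ.prod μ) = μ.real A' ^ 2 := by
      rw [integral_indicator_one (hA'm.prod hA'm), measureReal_prod_prod, sq]
    have hi : ∀ B : Set (V × V), MeasurableSet B →
        Integrable (B.indicator (1 : V × V → ℝ)) (μ.prod μ) := fun B hB =>
      (integrable_const (1 : ℝ)).indicator hB
    have h3 := integral_mono (μ := μ.prod μ)
      (integrable_finsetSum S fun s _ => hi _ ((hR s).measurable hAm))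
      ((integrable_const (2 * D : ℝ)).add ((hi _ (hA'm.prod hA'm)).const_mul (N : ℝ))) hpoint
    rw [integral_finsetSum _ fun s _ => hi _ ((hR s).measurable hAm)] at h3
    simp only [h1] at h3
    rw [integral_add' (integrable_const _) ((hi _ (hA'm.prod hA'm)).const_mul (N : ℝ)),
      integral_const_mul (N : ℝ), h2] at h3
    simpa [hScard] using h3
  have h4 : 2 * (D : ℝ) ≤ N * η := by
    rw [div_lt_iff₀ hη] at hN; linarith
  have h5 : N * μ.real A ≤ N * (η + μ.real A' ^ 2) := by linarith
  exact le_of_mul_le_mul_left h5 hN0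

/-- Anti-concentration of polynomials under centered Gaussian measures, with a bound that does not
depend on the dimension. -/
theorem exists_smallBall (D : ℕ) {a p ε : ℝ} (ha : 0 < a) (hp : 0 < p) (hε : 0 < ε) :
    ∃ c : ℝ, 0 < c ∧ ∀ {V : Type} [NormedAddCommGroup V] [NormedSpace ℝ V] [MeasurableSpace V]
      [BorelSpace V] [SecondCountableTopology V] [CompleteSpace V] (μ : Measure V) [IsGaussian μ]
      (_ : ∀ L : StrongDual ℝ V, ∫ x, L x ∂μ = 0) (f : V → ℝ) (_ : PolyDegLE D f)
      (_ : Measurable f) (_ : p ≤ μ.real {x | a ≤ |f x|}),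
      μ.real {x | |f x| < c} ≤ ε := by
  let S : ℝ → Prop := fun ρ => ∃ c : ℝ, 0 < c ∧ ∀ {V : Type} [NormedAddCommGroup V]
      [NormedSpace ℝ V] [MeasurableSpace V]
      [BorelSpace V] [SecondCountableTopology V] [CompleteSpace V] (μ : Measure V) [IsGaussian μ]
      (_ : ∀ L : StrongDual ℝ V, ∫ x, L x ∂μ = 0) (f : V → ℝ) (_ : PolyDegLE D f)
      (_ : Measurable f) (_ : p ≤ μ.real {x | a ≤ |f x|}),
      μ.real {x | |f x| < c} ≤ ρ
  have hbase : S (1 - p) := by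
    refine ⟨a, ha, ?_⟩
    intro V _ _ _ _ _ _ μ _ hμ f hf hfm hpa
    have hm : MeasurableSet {x | a ≤ |f x|} := measurableSet_le measurable_const (by fun_prop)
    have : {x | |f x| < a} = {x | a ≤ |f x|}ᶜ := by ext; simp
    rw [this, probReal_compl_eq_one_sub hm]
    linarith
  have hmono : ∀ {ρ ρ'}, ρ ≤ ρ' → S ρ → S ρ' := by
    rintro ρ ρ' h ⟨c, hc, H⟩
    exact ⟨c, hc, fun μ _ hμ f hf hfm hpa => (H μ hμ f hf hfm hpa).trans h⟩
  have hstep : ∀ {ρ ρ'}, 0 ≤ ρ → ρ ^ 2 < ρ' → S ρ → S ρ' := by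
    rintro ρ ρ' hρ h ⟨c, hc, H⟩
    obtain ⟨K, hK, HK⟩ := smallBall_step D (sub_pos.2 h)
    refine ⟨c / K, by positivity, ?_⟩
    intro V _ _ _ _ _ _ μ _ hμ f hf hfm hpa
    have h1 := HK μ hμ f hf hfm (c / K) (by positivity)
    rw [mul_div_cancel₀ _ hK.ne'] at h1
    have h2 := H μ hμ f hf hfm hpa
    have h3 : μ.real {x | |f x| < c} ^ 2 ≤ ρ ^ 2 := by gcongr
    linarith
  -- The squaring step is iterated from the bound `1 - p`. Since r < s < 1, the square of `r * s ^
  -- k` lies strictly below `r * s ^ (k + 1)`; the gap is the room for the additive error of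
  -- `smallBall_step`.
  set s : ℝ := max (1 - p / 2) (1 / 2) with hs
  have hs1 : s < 1 := max_lt (by linarith) (by norm_num)
  have hs0 : 0 < s := lt_of_lt_of_le (by norm_num) (le_max_right _ _)
  set r : ℝ := max (1 - p) (1 / 4) with hr
  have hr0 : 0 < r := lt_of_lt_of_le (by norm_num) (le_max_right _ _)
  have hrs : r < s := max_lt_iff.2 ⟨lt_max_of_lt_left (by linarith), lt_max_of_lt_right (by norm_num)⟩
  have hall : ∀ k : ℕ, S (r * s ^ k) := by
    intro k
    induction k with
    | zero => simpa using hmono (le_max_left _ _) hbase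
    | succ k ih =>
      refine hstep (by positivity) ?_ ih
      have h1 : r * s ^ k < s :=
        lt_of_le_of_lt (mul_le_of_le_one_right hr0.le (pow_le_one₀ hs0.le hs1.le)) hrs
      have h2 : 0 < r * s ^ k := by positivity
      calc (r * s ^ k) ^ 2 = (r * s ^ k) * (r * s ^ k) := sq _
        _ < s * (r * s ^ k) := mul_lt_mul_of_pos_right h1 h2
        _ = r * s ^ (k + 1) := by ring
  obtain ⟨k, hk⟩ := exists_pow_lt_of_lt_one (div_pos hε hr0) hs1
  refine hmono ?_ (hall k)
  rw [lt_div_iff₀ hr0] at hk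
  linarith

end SmallBall

/-! ### Matrices as linear maps and the Frobenius bound -/

/-- The linear map between Euclidean spaces given by a matrix. -/
def lin {a b : ℕ} (M : Matrix (Fin a) (Fin b) ℝ) :
    EuclideanSpace ℝ (Fin b) →L[ℝ] EuclideanSpace ℝ (Fin a) :=
  LinearMap.toContinuousLinearMap (Matrix.toLpLin 2 2 M)

section

variable {a b : ℕ} (M : Matrix (Fin a) (Fin b) ℝ)

lemma lin_apply (w : EuclideanSpace ℝ (Fin b)) : lin M w = WithLp.toLp 2 (M *ᵥ w.ofLp) := rfl

lemma inner_eq_dotProduct' {c : ℕ} (u w : EuclideanSpace ℝ (Fin c)) :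
    ⟪u, w⟫_ℝ = u.ofLp ⬝ᵥ w.ofLp := by
  simp [PiLp.inner_apply, dotProduct, mul_comm]

lemma inner_lin (u : EuclideanSpace ℝ (Fin a)) (w : EuclideanSpace ℝ (Fin b)) :
    ⟪u, lin M w⟫_ℝ = u.ofLp ⬝ᵥ (M *ᵥ w.ofLp) := by
  rw [inner_eq_dotProduct', lin_apply]

lemma inner_lin_transpose (u : EuclideanSpace ℝ (Fin a)) (w : EuclideanSpace ℝ (Fin b)) :
    ⟪lin Mᵀ u, w⟫_ℝ = ⟪u, lin M w⟫_ℝ := by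
  rw [inner_eq_dotProduct', inner_lin, lin_apply, Matrix.mulVec_transpose,
    Matrix.dotProduct_mulVec]

lemma inner_lin_lin (w w' : EuclideanSpace ℝ (Fin b)) :
    w.ofLp ⬝ᵥ ((Mᵀ * M) *ᵥ w'.ofLp) = ⟪lin M w, lin M w'⟫_ℝ := by
  rw [← Matrix.mulVec_mulVec, real_inner_comm, ← inner_lin_transpose, real_inner_comm, inner_lin]
  rfl

lemma inner_lin_transpose_lin_transpose (u u' : EuclideanSpace ℝ (Fin a)) :
    u.ofLp ⬝ᵥ ((M * Mᵀ) *ᵥ u'.ofLp) = ⟪lin Mᵀ u, lin Mᵀ u'⟫_ℝ := by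
  simpa using inner_lin_lin Mᵀ u u'

/-- The squared Frobenius norm. -/
def frob : ℝ := ∑ i, ∑ j, M i j ^ 2

lemma frob_transpose : frob Mᵀ = frob M := Finset.sum_comm

lemma norm_lin_sq_le (w : EuclideanSpace ℝ (Fin b)) : ‖lin M w‖ ^ 2 ≤ frob M * ‖w‖ ^ 2 := by
  rw [EuclideanSpace.real_norm_sq_eq, EuclideanSpace.real_norm_sq_eq, frob, Finset.sum_mul]
  refine Finset.sum_le_sum fun i _ => ?_
  simp only [lin_apply, Matrix.mulVec, dotProduct]
  exact Finset.sum_mul_sq_le_sq_mul_sq _ _ _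

end

/-! ### Gradients and the explicit gradient descent step -/

variable {r₁ r₂ r₃ n m nd : ℕ} (T : Task n m nd)

namespace Task

lemma frobSq_eq : T.frobSq = frob T.X := rfl

lemma bil_eq (u : EuclideanSpace ℝ (Fin n)) (w : EuclideanSpace ℝ (Fin nd)) :
    T.bil u w = ⟪u, lin T.X w⟫_ℝ := (inner_lin _ _ _).symm

/-- The contribution of the adapter to the output. -/
def adapter (θ : Params r₁ r₂ r₃ n m nd) : EuclideanSpace ℝ (Fin m) :=
  ∑ p, ∑ q, ∑ k, (θ.G (p, q, k) * T.bil (θ.U₁ p) (θ.U₃ k)) • θ.U₂ q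

/-- The output is linear in the parameter tensor, and contracting a Tucker product with X leaves
only the pairings of the columns. After this identity the pre-trained tensor and the target enter
only through the initial residual. -/
lemma residual_eq (θ : Params r₁ r₂ r₃ n m nd) :
    T.residual θ = T.initialResidual + T.adapter θ := by
  have h : T.output θ = T.pretrainedOutput + T.adapter θ := by
    ext j
    simp only [Task.output, Task.pretrainedOutput, kan, adapter, Pi.add_apply, add_mul,
      Finset.sum_add_distrib, PiLp.add_apply, PiLp.toLp_apply]
    congr 1
    simp only [tucker, Task.bil, dotProduct, Matrix.mulVec, Task.X, Matrix.of_apply,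
      WithLp.ofLp_sum, Finset.sum_apply, WithLp.ofLp_smul, Pi.smul_apply, smul_eq_mul,
      Finset.sum_mul, Finset.mul_sum]
    calc ∑ a, ∑ c, ∑ p, ∑ q, ∑ k,
          θ.G (p, q, k) * θ.U₁ p a * θ.U₂ q j * θ.U₃ k c * T.basis c (T.x a)
        = ∑ a, ∑ p, ∑ q, ∑ k, ∑ c,
          θ.G (p, q, k) * θ.U₁ p a * θ.U₂ q j * θ.U₃ k c * T.basis c (T.x a) := by
          refine Finset.sum_congr rfl fun a _ => ?_
          rw [Finset.sum_comm]
          refine Finset.sum_congr rfl fun p _ => ?_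
          rw [Finset.sum_comm]
          refine Finset.sum_congr rfl fun q _ => ?_
          rw [Finset.sum_comm]
      _ = ∑ p, ∑ q, ∑ k, ∑ a, ∑ c,
          θ.G (p, q, k) * θ.U₁ p a * θ.U₂ q j * θ.U₃ k c * T.basis c (T.x a) := by
          rw [Finset.sum_comm]
          refine Finset.sum_congr rfl fun p _ => ?_
          rw [Finset.sum_comm]
          refine Finset.sum_congr rfl fun q _ => ?_
          rw [Finset.sum_comm]
      _ = _ := by
          refine Finset.sum_congr rfl fun p _ => Finset.sum_congr rfl fun q _ =>
            Finset.sum_congr rfl fun k _ => Finset.sum_congr rfl fun a _ =>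
            Finset.sum_congr rfl fun c _ => ?_
          ring
  rw [Task.residual, h, Task.initialResidual]
  abel

lemma loss_eq (θ : Params r₁ r₂ r₃ n m nd) : T.loss θ = 1 / 2 * ‖T.residual θ‖ ^ 2 := rfl

/-- The contraction of the core with the pairings of the residual and the columns of `U₂`. -/
def contr (θ : Params r₁ r₂ r₃ n m nd) (p : Fin r₁) (k : Fin r₃) : ℝ :=
  ∑ q, θ.G (p, q, k) * ⟪T.residual θ, θ.U₂ q⟫_ℝ

end Task

/-- The residual is affine in each trainable block when the others are frozen. All four gradients
are instances of this formula, where `w` is the adjoint of `A` applied to the current residual. -/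
lemma hasGradientAt_half_norm_sq {E F : Type*} [NormedAddCommGroup E] [InnerProductSpace ℝ E]
    [CompleteSpace E] [NormedAddCommGroup F] [InnerProductSpace ℝ F]
    (r : F) (A : E →L[ℝ] F) (u₀ w : E) (h : ∀ z, ⟪w, z⟫_ℝ = ⟪r, A z⟫_ℝ) :
    HasGradientAt (fun u => 1 / 2 * ‖r + A (u - u₀)‖ ^ 2) w u₀ := by
  rw [hasGradientAt_iff_hasFDerivAt]
  have h1 : HasFDerivAt (fun u => r + A (u - u₀)) A u₀ := by
    have := (A.hasFDerivAt (x := u₀)).sub_const (A u₀)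
    simpa [map_sub] using this.const_add r
  have h2 := (h1.norm_sq).const_mul (1 / 2 : ℝ)
  refine h2.congr_fderiv ?_
  ext z
  simp [h, InnerProductSpace.toDual_apply_apply]

namespace Task

lemma deriv_loss_G (θ : Params r₁ r₂ r₃ n m nd) (p : Fin r₁) (q : Fin r₂) (k : Fin r₃) :
    deriv (fun s => T.loss { θ with G := Function.update θ.G (p, q, k) s }) (θ.G (p, q, k)) =
      ⟪T.residual θ, θ.U₂ q⟫_ℝ * T.bil (θ.U₁ p) (θ.U₃ k) := by
  let w : EuclideanSpace ℝ (Fin m) := T.bil (θ.U₁ p) (θ.U₃ k) • θ.U₂ q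
  have hres : ∀ s, T.residual { θ with G := Function.update θ.G (p, q, k) s } =
      T.residual θ + (ContinuousLinearMap.toSpanSingleton ℝ w) (s - θ.G (p, q, k)) := by
    intro s
    rw [residual_eq, residual_eq, add_assoc, add_right_inj, ← sub_eq_iff_eq_add', adapter, adapter]
    simp only [← Finset.sum_sub_distrib, ← sub_smul, ← sub_mul]
    rw [Finset.sum_eq_single p, Finset.sum_eq_single q, Finset.sum_eq_single k]
    · simp [w, smul_smul]
    · intro k' _ hk; simp [Function.update_of_ne, hk]
    · simp
    · intro q' _ hq; simp [Function.update_of_ne, hq]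
    · simp
    · intro p' _ hp; simp [Function.update_of_ne, hp]
    · simp
  have hg := hasGradientAt_half_norm_sq (T.residual θ) (ContinuousLinearMap.toSpanSingleton ℝ w)
    (θ.G (p, q, k)) (⟪T.residual θ, w⟫_ℝ) (fun z => by
      simp [inner_smul_right])
  have := hg.hasDerivAt'.deriv
  simp only [loss_eq, hres]
  rw [this]
  simp [w, inner_smul_right, mul_comm]

lemma gradient_loss_U₁ (θ : Params r₁ r₂ r₃ n m nd) (p : Fin r₁) :
    gradient (fun u => T.loss { θ with U₁ := Function.update θ.U₁ p u }) (θ.U₁ p) =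
      ∑ k, T.contr θ p k • lin T.X (θ.U₃ k) := by
  let A : EuclideanSpace ℝ (Fin n) →L[ℝ] EuclideanSpace ℝ (Fin m) :=
    ∑ q, ∑ k, (θ.G (p, q, k) • innerSL ℝ (lin T.X (θ.U₃ k))).smulRight (θ.U₂ q)
  have hA : ∀ z, A z = ∑ q, ∑ k, (θ.G (p, q, k) * T.bil z (θ.U₃ k)) • θ.U₂ q := by
    intro z
    simp [A, bil_eq, real_inner_comm]
  have hres : ∀ u, T.residual { θ with U₁ := Function.update θ.U₁ p u } =
      T.residual θ + A (u - θ.U₁ p) := by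
    intro u
    rw [residual_eq, residual_eq, add_assoc, add_right_inj, ← sub_eq_iff_eq_add', adapter, adapter,
      hA]
    simp only [← Finset.sum_sub_distrib, ← sub_smul, ← mul_sub]
    rw [Finset.sum_eq_single p]
    · simp [bil_eq, inner_sub_left]
    · intro p' _ hp; simp [Function.update_of_ne, hp]
    · simp
  have hg := hasGradientAt_half_norm_sq (T.residual θ) A (θ.U₁ p)
    (∑ k, T.contr θ p k • lin T.X (θ.U₃ k)) (fun z => by
      rw [hA]
      simp only [sum_inner, inner_sum, inner_smul_left, inner_smul_right, contr, Finset.sum_mul,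
        bil_eq, map_sum, conj_trivial]
      rw [Finset.sum_comm]
      refine Finset.sum_congr rfl fun q _ => Finset.sum_congr rfl fun k _ => ?_
      rw [real_inner_comm z]
      ring)
  simp only [loss_eq, hres]
  exact hg.gradient

lemma gradient_loss_U₃ (θ : Params r₁ r₂ r₃ n m nd) (k : Fin r₃) :
    gradient (fun u => T.loss { θ with U₃ := Function.update θ.U₃ k u }) (θ.U₃ k) =
      ∑ p, T.contr θ p k • lin T.Xᵀ (θ.U₁ p) := by
  let A : EuclideanSpace ℝ (Fin nd) →L[ℝ] EuclideanSpace ℝ (Fin m) :=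
    ∑ p, ∑ q, (θ.G (p, q, k) • innerSL ℝ (lin T.Xᵀ (θ.U₁ p))).smulRight (θ.U₂ q)
  have hA : ∀ z, A z = ∑ p, ∑ q, (θ.G (p, q, k) * T.bil (θ.U₁ p) z) • θ.U₂ q := by
    intro z
    simp [A, bil_eq, inner_lin_transpose]
  have hres : ∀ u, T.residual { θ with U₃ := Function.update θ.U₃ k u } =
      T.residual θ + A (u - θ.U₃ k) := by
    intro u
    rw [residual_eq, residual_eq, add_assoc, add_right_inj, ← sub_eq_iff_eq_add', adapter, adapter,
      hA]
    simp only [← Finset.sum_sub_distrib, ← sub_smul, ← mul_sub]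
    refine Finset.sum_congr rfl fun p _ => Finset.sum_congr rfl fun q _ => ?_
    rw [Finset.sum_eq_single k]
    · simp [bil_eq, inner_sub_right]
    · intro p' _ hp; simp [Function.update_of_ne, hp]
    · simp
  have hg := hasGradientAt_half_norm_sq (T.residual θ) A (θ.U₃ k)
    (∑ p, T.contr θ p k • lin T.Xᵀ (θ.U₁ p)) (fun z => by
      rw [hA]
      simp only [sum_inner, inner_sum, inner_smul_left, inner_smul_right, contr, Finset.sum_mul,
        bil_eq, map_sum, conj_trivial, inner_lin_transpose]
      refine Finset.sum_congr rfl fun q _ => Finset.sum_congr rfl fun k _ => ?_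
      ring)
  simp only [loss_eq, hres]
  exact hg.gradient

/-- The derivative of the output in the direction of the column `q` of `U₂`. -/
def coef (θ : Params r₁ r₂ r₃ n m nd) (q : Fin r₂) : ℝ :=
  ∑ p, ∑ k, θ.G (p, q, k) * T.bil (θ.U₁ p) (θ.U₃ k)

lemma adapter_eq_sum_coef (θ : Params r₁ r₂ r₃ n m nd) :
    T.adapter θ = ∑ q, T.coef θ q • θ.U₂ q := by
  rw [adapter, Finset.sum_comm]
  simp only [coef, Finset.sum_smul]

lemma gradient_loss_U₂ (θ : Params r₁ r₂ r₃ n m nd) (q : Fin r₂) :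
    gradient (fun u => T.loss { θ with U₂ := Function.update θ.U₂ q u }) (θ.U₂ q) =
      T.coef θ q • T.residual θ := by
  let A : EuclideanSpace ℝ (Fin m) →L[ℝ] EuclideanSpace ℝ (Fin m) :=
    T.coef θ q • ContinuousLinearMap.id ℝ _
  have hres : ∀ u, T.residual { θ with U₂ := Function.update θ.U₂ q u } =
      T.residual θ + A (u - θ.U₂ q) := by
    intro u
    rw [residual_eq, residual_eq, add_assoc, add_right_inj, ← sub_eq_iff_eq_add',
      adapter_eq_sum_coef, adapter_eq_sum_coef, ← Finset.sum_sub_distrib, Finset.sum_eq_single q]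
    · simp [coef, A, smul_sub]
    · intro p' _ hp; simp [Function.update_of_ne, hp, coef]
    · simp
  have hg := hasGradientAt_half_norm_sq (T.residual θ) A (θ.U₂ q)
    (T.coef θ q • T.residual θ) (fun z => by simp [A, inner_smul_left, inner_smul_right])
  simp only [loss_eq, hres]
  exact hg.gradient

variable (η : Fin 4 → ℝ)

lemma gdStep_G (θ : Params r₁ r₂ r₃ n m nd) (p : Fin r₁) (q : Fin r₂) (k : Fin r₃) :
    (T.gdStep η θ).G (p, q, k) = θ.G (p, q, k) -
      η 0 * (⟪T.residual θ, θ.U₂ q⟫_ℝ * T.bil (θ.U₁ p) (θ.U₃ k)) := by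
  rw [← deriv_loss_G]; rfl

lemma gdStep_U₁ (θ : Params r₁ r₂ r₃ n m nd) (p : Fin r₁) :
    (T.gdStep η θ).U₁ p = θ.U₁ p - η 1 • ∑ k, T.contr θ p k • lin T.X (θ.U₃ k) := by
  rw [← gradient_loss_U₁]; rfl

lemma gdStep_U₂ (θ : Params r₁ r₂ r₃ n m nd) (q : Fin r₂) :
    (T.gdStep η θ).U₂ q = θ.U₂ q - η 2 • T.coef θ q • T.residual θ := by
  rw [← gradient_loss_U₂]; rfl

lemma gdStep_U₃ (θ : Params r₁ r₂ r₃ n m nd) (k : Fin r₃) :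
    (T.gdStep η θ).U₃ k = θ.U₃ k - η 3 • ∑ p, T.contr θ p k • lin T.Xᵀ (θ.U₁ p) := by
  rw [← gradient_loss_U₃]; rfl

lemma gd_succ (θ : Params r₁ r₂ r₃ n m nd) (t : ℕ) :
    T.gd η θ (t + 1) = T.gdStep η (T.gd η θ t) := Function.iterate_succ_apply' _ _ _

lemma gd_zero (θ : Params r₁ r₂ r₃ n m nd) : T.gd η θ 0 = θ := rfl

/-- The quadruple sum is regrouped around the vector `∑ contr • X u₃`, which is also the gradient
for the column `p` of `U₁`. The lower bound for the term later reduces to a lower bound for its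
norm. -/
lemma delta₁_eq (θ : Params r₁ r₂ r₃ n m nd) (p : Fin r₁) :
    T.delta₁ η θ p = (-η 1) • ∑ q, (∑ k, θ.G (p, q, k) *
      ⟪∑ k', T.contr θ p k' • lin T.X (θ.U₃ k'), lin T.X (θ.U₃ k)⟫_ℝ) • θ.U₂ q := by
  rw [delta₁]
  congr 1
  refine Finset.sum_congr rfl fun q _ => ?_
  rw [← Finset.sum_smul]
  congr 1
  refine Finset.sum_congr rfl fun k _ => ?_
  congr 1
  simp only [inner_lin_lin, sum_inner, inner_smul_left, contr, Finset.sum_mul, conj_trivial]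
  rw [Finset.sum_comm]

lemma delta₂_eq (θ : Params r₁ r₂ r₃ n m nd) (q : Fin r₂) :
    T.delta₂ η θ q = (-(η 2 * T.coef θ q ^ 2)) • T.residual θ := by
  rw [delta₂]
  congr 3
  rw [sq]
  change _ = (∑ p, ∑ k, θ.G (p, q, k) * T.bil (θ.U₁ p) (θ.U₃ k)) * T.coef θ q
  simp only [Finset.sum_mul]
  refine Finset.sum_congr rfl fun p _ => Finset.sum_congr rfl fun k _ => ?_
  change _ * T.coef θ q * _ = _
  ring

lemma delta₃_eq (θ : Params r₁ r₂ r₃ n m nd) (k : Fin r₃) :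
    T.delta₃ η θ k = (-η 3) • ∑ q, (∑ p, θ.G (p, q, k) *
      ⟪∑ p', T.contr θ p' k • lin T.Xᵀ (θ.U₁ p'), lin T.Xᵀ (θ.U₁ p)⟫_ℝ) • θ.U₂ q := by
  rw [delta₃, Finset.sum_comm]
  congr 1
  refine Finset.sum_congr rfl fun q _ => ?_
  rw [← Finset.sum_smul]
  congr 1
  refine Finset.sum_congr rfl fun p _ => ?_
  congr 1
  simp only [inner_lin_transpose_lin_transpose, sum_inner, inner_smul_left, contr, Finset.sum_mul,
    conj_trivial]
  refine Finset.sum_congr rfl fun p' _ => Finset.sum_congr rfl fun q' _ => ?_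
  rw [real_inner_comm (lin T.Xᵀ (θ.U₁ p))]

end Task

/-! ### Polynomial dependence of training on the initialization -/

section IsPoly

variable {V : Type*} [AddCommGroup V] [Module ℝ V] [TopologicalSpace V]

/-- Continuous functions that are polynomial of degree at most `d` in the sense of `PolyDegLE`. -/
structure IsPoly (d : ℕ) (f : V → ℝ) : Prop where
  poly : PolyDegLE d f
  cont : Continuous f

namespace IsPoly

variable {d d' : ℕ} {f g : V → ℝ}

lemma mono (hf : IsPoly d f) (h : d ≤ d') : IsPoly d' f := ⟨hf.poly.mono h, hf.cont⟩

lemma const (c : ℝ) : IsPoly d (fun _ : V => c) := ⟨.const c, continuous_const⟩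

lemma add (hf : IsPoly d f) (hg : IsPoly d g) : IsPoly d (fun x => f x + g x) :=
  ⟨hf.poly.add hg.poly, hf.cont.add hg.cont⟩

lemma sub (hf : IsPoly d f) (hg : IsPoly d g) : IsPoly d (fun x => f x - g x) :=
  ⟨hf.poly.sub hg.poly, hf.cont.sub hg.cont⟩

lemma mul (hf : IsPoly d f) (hg : IsPoly d' g) : IsPoly (d + d') (fun x => f x * g x) :=
  ⟨hf.poly.mul hg.poly, hf.cont.mul hg.cont⟩

lemma const_mul (c : ℝ) (hf : IsPoly d f) : IsPoly d (fun x => c * f x) :=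
  ⟨hf.poly.const_mul c, hf.cont.const_mul c⟩

lemma neg (hf : IsPoly d f) : IsPoly d (fun x => -f x) := ⟨hf.poly.neg, hf.cont.neg⟩

lemma pow (hf : IsPoly d f) (k : ℕ) : IsPoly (k * d) (fun x => f x ^ k) :=
  ⟨hf.poly.pow k, hf.cont.pow k⟩

lemma sum {ι : Type*} (s : Finset ι) {F : ι → V → ℝ} (h : ∀ i ∈ s, IsPoly d (F i)) :
    IsPoly d (fun x => ∑ i ∈ s, F i x) :=
  ⟨.sum s fun i hi => (h i hi).poly, continuous_finsetSum s fun i hi => (h i hi).cont⟩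

lemma linear (φ : V →L[ℝ] ℝ) : IsPoly 1 (fun x => φ x) := ⟨.linear φ.toLinearMap, φ.continuous⟩

end IsPoly

/-- Vector-valued functions whose coordinates are polynomials of degree at most `d`. -/
def VecPoly {a : ℕ} (d : ℕ) (f : V → EuclideanSpace ℝ (Fin a)) : Prop :=
  ∀ i, IsPoly d (fun x => f x i)

namespace VecPoly

variable {a b d d' : ℕ} {f g : V → EuclideanSpace ℝ (Fin a)} {c : V → ℝ}

lemma mono (hf : VecPoly d f) (h : d ≤ d') : VecPoly d' f := fun i => (hf i).mono h

lemma const (v : EuclideanSpace ℝ (Fin a)) : VecPoly d (fun _ : V => v) := fun i => .const (v i)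

lemma add (hf : VecPoly d f) (hg : VecPoly d g) : VecPoly d (fun x => f x + g x) :=
  fun i => (hf i).add (hg i)

lemma sub (hf : VecPoly d f) (hg : VecPoly d g) : VecPoly d (fun x => f x - g x) :=
  fun i => (hf i).sub (hg i)

lemma smul (hc : IsPoly d c) (hf : VecPoly d' f) : VecPoly (d + d') (fun x => c x • f x) :=
  fun i => hc.mul (hf i)

lemma const_smul (r : ℝ) (hf : VecPoly d f) : VecPoly d (fun x => r • f x) :=
  fun i => (hf i).const_mul r

lemma sum {ι : Type*} (s : Finset ι) {F : ι → V → EuclideanSpace ℝ (Fin a)}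
    (h : ∀ i ∈ s, VecPoly d (F i)) : VecPoly d (fun x => ∑ i ∈ s, F i x) := by
  intro j
  simpa using IsPoly.sum s fun i hi => h i hi j

lemma inner (hf : VecPoly d f) (hg : VecPoly d' g) : IsPoly (d + d') (fun x => ⟪f x, g x⟫_ℝ) := by
  simp only [inner_eq_dotProduct', dotProduct]
  exact IsPoly.sum _ fun i _ => (hf i).mul (hg i)

lemma lin (M : Matrix (Fin b) (Fin a) ℝ) (hf : VecPoly d f) :
    VecPoly d (fun x => LoTRA.lin M (f x)) := by
  intro i
  simp only [lin_apply, Matrix.mulVec, dotProduct]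
  exact IsPoly.sum _ fun j _ => (hf j).const_mul _

end VecPoly

variable {r₁ r₂ r₃ n m nd : ℕ}

/-- Families of parameters that depend polynomially on a vector. -/
structure ParamsPoly (d : ℕ) (θ : V → Params r₁ r₂ r₃ n m nd) : Prop where
  G : ∀ j, IsPoly d (fun x => (θ x).G j)
  U₁ : ∀ p, VecPoly d (fun x => (θ x).U₁ p)
  U₂ : ∀ q, VecPoly d (fun x => (θ x).U₂ q)
  U₃ : ∀ k, VecPoly d (fun x => (θ x).U₃ k)

namespace ParamsPoly

variable {d : ℕ} {θ : V → Params r₁ r₂ r₃ n m nd} (hθ : ParamsPoly d θ)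
  (T : Task n m nd) (η : Fin 4 → ℝ)

include hθ

lemma bil (p : Fin r₁) (k : Fin r₃) :
    IsPoly (2 * d) (fun x => T.bil ((θ x).U₁ p) ((θ x).U₃ k)) := by
  simp only [Task.bil_eq, two_mul]
  exact (hθ.U₁ p).inner ((hθ.U₃ k).lin _)

lemma coef (q : Fin r₂) : IsPoly (3 * d) (fun x => T.coef (θ x) q) :=
  .sum _ fun p _ => .sum _ fun k _ => ((hθ.G _).mul (hθ.bil T p k)).mono (by omega)

lemma residual : VecPoly (4 * d) (fun x => T.residual (θ x)) := by
  simp only [Task.residual_eq, Task.adapter_eq_sum_coef]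
  exact (VecPoly.const _).add
    (.sum _ fun q _ => (VecPoly.smul (hθ.coef T q) (hθ.U₂ q)).mono (by omega))

lemma inner_residual (q : Fin r₂) :
    IsPoly (5 * d) (fun x => ⟪T.residual (θ x), (θ x).U₂ q⟫_ℝ) :=
  ((hθ.residual T).inner (hθ.U₂ q)).mono (by omega)

lemma contr (p : Fin r₁) (k : Fin r₃) : IsPoly (6 * d) (fun x => T.contr (θ x) p k) :=
  .sum _ fun q _ => ((hθ.G _).mul (hθ.inner_residual T q)).mono (by omega)

lemma sum_contr_lin_U₃ (p : Fin r₁) :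
    VecPoly (7 * d) (fun x => ∑ k, T.contr (θ x) p k • lin T.X ((θ x).U₃ k)) :=
  .sum _ fun k _ => (VecPoly.smul (hθ.contr T p k) ((hθ.U₃ k).lin _)).mono (by omega)

lemma sum_contr_lin_U₁ (k : Fin r₃) :
    VecPoly (7 * d) (fun x => ∑ p, T.contr (θ x) p k • lin T.Xᵀ ((θ x).U₁ p)) :=
  .sum _ fun p _ => (VecPoly.smul (hθ.contr T p k) ((hθ.U₁ p).lin _)).mono (by omega)

/-- The degree 7d is attained in every update: 5d + 2d for the core, 6d + d for `U₁` and `U₃`, 3d +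
4d for `U₂`. Only independence of the dimensions matters later. -/
lemma gdStep : ParamsPoly (7 * d) (fun x => T.gdStep η (θ x)) where
  G := by
    rintro ⟨p, q, k⟩
    simp only [Task.gdStep_G]
    exact ((hθ.G _).mono (by omega)).sub
      ((((hθ.inner_residual T q).mul (hθ.bil T p k)).const_mul _).mono (by omega))
  U₁ := by
    intro p
    simp only [Task.gdStep_U₁]
    exact ((hθ.U₁ p).mono (by omega)).sub ((hθ.sum_contr_lin_U₃ T p).const_smul _)
  U₂ := by
    intro q
    simp only [Task.gdStep_U₂]
    exact ((hθ.U₂ q).mono (by omega)).sub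
      (((VecPoly.smul (hθ.coef T q) (hθ.residual T)).const_smul _).mono (by omega))
  U₃ := by
    intro k
    simp only [Task.gdStep_U₃]
    exact ((hθ.U₃ k).mono (by omega)).sub ((hθ.sum_contr_lin_U₁ T k).const_smul _)

lemma gd (t : ℕ) : ParamsPoly (7 ^ t * d) (fun x => T.gd η (θ x) t) := by
  induction t with
  | zero => simpa [Task.gd_zero] using hθ
  | succ t ih =>
    simp only [Task.gd_succ]
    have := ih.gdStep T η
    rwa [← mul_assoc, ← pow_succ'] at this

lemma delta₀ (p : Fin r₁) (q : Fin r₂) (k : Fin r₃) :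
    VecPoly (10 * d) (fun x => T.delta₀ η (θ x) p q k) := by
  simp only [Task.delta₀]
  exact (VecPoly.smul ((((hθ.inner_residual T q).const_mul (η 0)).mul
    ((hθ.bil T p k).pow 2)).neg) (hθ.U₂ q)).mono (by omega)

lemma delta₁ (p : Fin r₁) : VecPoly (10 * d) (fun x => T.delta₁ η (θ x) p) := by
  simp only [Task.delta₁_eq]
  refine VecPoly.const_smul _ (.sum _ fun q _ => VecPoly.mono (d := 9 * d + d)
    (VecPoly.smul (.sum _ fun k _ => ?_) (hθ.U₂ q)) (by omega))
  exact ((hθ.G _).mul ((hθ.sum_contr_lin_U₃ T p).inner ((hθ.U₃ k).lin _))).mono (by omega)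

lemma delta₂ (q : Fin r₂) : VecPoly (10 * d) (fun x => T.delta₂ η (θ x) q) := by
  simp only [Task.delta₂_eq]
  exact (VecPoly.smul (((hθ.coef T q).pow 2).const_mul (η 2)).neg (hθ.residual T)).mono (by omega)

lemma delta₃ (k : Fin r₃) : VecPoly (10 * d) (fun x => T.delta₃ η (θ x) k) := by
  simp only [Task.delta₃_eq]
  refine VecPoly.const_smul _ (.sum _ fun q _ => VecPoly.mono (d := 9 * d + d)
    (VecPoly.smul (.sum _ fun p _ => ?_) (hθ.U₂ q)) (by omega))
  exact ((hθ.G _).mul ((hθ.sum_contr_lin_U₁ T k).inner ((hθ.U₁ p).lin _))).mono (by omega)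

end ParamsPoly

end IsPoly

variable {r₁ r₂ r₃ n m nd : ℕ}

lemma paramsPoly_initParams (U₂ : Fin r₂ → EuclideanSpace ℝ (Fin m)) :
    ParamsPoly 1 (fun ω : (Fin r₁ → EuclideanSpace ℝ (Fin n)) ×
      (Fin r₃ → EuclideanSpace ℝ (Fin nd)) => initParams U₂ ω) where
  G := fun _ => .const 0
  U₁ := fun p i => .linear ((EuclideanSpace.proj i).comp
    ((ContinuousLinearMap.proj (φ := fun _ : Fin r₁ => EuclideanSpace ℝ (Fin n)) p).comp
      (ContinuousLinearMap.fst ℝ _ (Fin r₃ → EuclideanSpace ℝ (Fin nd)))))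
  U₂ := fun _ => .const _
  U₃ := fun k i => .linear ((EuclideanSpace.proj i).comp
    ((ContinuousLinearMap.proj (φ := fun _ : Fin r₃ => EuclideanSpace ℝ (Fin nd)) k).comp
      (ContinuousLinearMap.snd ℝ (Fin r₁ → EuclideanSpace ℝ (Fin n)) _)))

/-! ### The initialization as a centered Gaussian measure -/

/-- The Gaussian law `N(0, I / n)`. -/
def gaussianCol (n : ℕ) : Measure (EuclideanSpace ℝ (Fin n)) :=
  multivariateGaussian 0 ((n : ℝ)⁻¹ • (1 : Matrix (Fin n) (Fin n) ℝ))

/-- The law of `r` independent columns with law `N(0, I / n)`. -/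
def gaussianCols (r n : ℕ) : Measure (Fin r → EuclideanSpace ℝ (Fin n)) :=
  Measure.pi fun _ => gaussianCol n

instance (n : ℕ) : IsGaussian (gaussianCol n) := by unfold gaussianCol; infer_instance

lemma isGaussian_pi {ι : Type*} [Fintype ι] {E : Type*} [NormedAddCommGroup E] [NormedSpace ℝ E]
    [MeasurableSpace E] [BorelSpace E] [SecondCountableTopology E] [CompleteSpace E]
    (μ : Measure E) [IsGaussian μ] : IsGaussian (Measure.pi fun _ : ι => μ) := by
  have h : iIndepFun (fun i (ω : ι → E) => ω i) (Measure.pi fun _ : ι => μ) := by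
    simpa using iIndepFun_pi (μ := fun _ : ι => μ) (X := fun _ => (id : E → E))
      (fun _ => aemeasurable_id)
  have h1 : ∀ i, HasGaussianLaw (fun ω : ι → E => ω i) (Measure.pi fun _ : ι => μ) := by
    intro i
    refine ⟨?_⟩
    rw [(measurePreserving_eval (fun _ : ι => μ) i).map_eq]
    infer_instance
  have := (iIndepFun.hasGaussianLaw h1 h).isGaussian_map
  simpa using this

instance (r n : ℕ) : IsGaussian (gaussianCols r n) := isGaussian_pi _

lemma initLaw_eq (r₁ r₃ n nd : ℕ) :
    initLaw r₁ r₃ n nd = (gaussianCols r₁ n).prod (gaussianCols r₃ nd) := rfl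

instance (r₁ r₃ n nd : ℕ) : IsGaussian (initLaw r₁ r₃ n nd) := by
  rw [initLaw_eq]; infer_instance

/-- Centeredness is obtained from invariance under negation, a property that passes directly to
finite powers and products of measures. -/
lemma integral_dual_eq_zero_of_neg {V : Type*} [NormedAddCommGroup V] [NormedSpace ℝ V]
    [MeasurableSpace V] [BorelSpace V] {μ : Measure V}
    (h : MeasurePreserving (fun x : V => -x) μ μ) (L : StrongDual ℝ V) : ∫ x, L x ∂μ = 0 := by
  have h1 := h.integral_comp (MeasurableEquiv.neg V).measurableEmbedding (fun x => L x)
  simp only [map_neg, integral_neg] at h1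
  linarith

lemma measurePreserving_neg_gaussianCol (n : ℕ) :
    MeasurePreserving (fun x : EuclideanSpace ℝ (Fin n) => -x) (gaussianCol n) (gaussianCol n) := by
  have h0 : ∀ L : StrongDual ℝ (EuclideanSpace ℝ (Fin n)), ∫ x, L x ∂(gaussianCol n) = 0 := by
    intro L
    have h1 := L.integral_comp_id_comm (μ := gaussianCol n) IsGaussian.integrable_id
    rw [h1]
    have h2 : ∫ x, x ∂(gaussianCol n) = 0 := integral_id_multivariateGaussian
    simp [h2]
  refine ⟨measurable_neg, ?_⟩
  have h : (fun x : EuclideanSpace ℝ (Fin n) => -x) =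
      (-(ContinuousLinearMap.id ℝ (EuclideanSpace ℝ (Fin n))) :
        EuclideanSpace ℝ (Fin n) →L[ℝ] EuclideanSpace ℝ (Fin n)) := by ext; simp
  rw [h]
  apply Measure.ext_of_charFunDual
  ext L
  rw [charFunDual_map, IsGaussian.charFunDual_eq_of_forall_strongDual_eq_zero h0,
    IsGaussian.charFunDual_eq_of_forall_strongDual_eq_zero h0]
  have h3 : ((L.comp (-(ContinuousLinearMap.id ℝ (EuclideanSpace ℝ (Fin n))))) :
      EuclideanSpace ℝ (Fin n) → ℝ) = -(L : EuclideanSpace ℝ (Fin n) → ℝ) := by ext; simp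
  rw [h3, variance_neg]

lemma measurePreserving_neg_gaussianCols (r n : ℕ) :
    MeasurePreserving (fun x : Fin r → EuclideanSpace ℝ (Fin n) => -x)
      (gaussianCols r n) (gaussianCols r n) :=
  measurePreserving_pi _ _ fun _ => measurePreserving_neg_gaussianCol n

lemma measurePreserving_neg_initLaw (r₁ r₃ n nd : ℕ) :
    MeasurePreserving (fun x => -x) (initLaw r₁ r₃ n nd) (initLaw r₁ r₃ n nd) :=
  (measurePreserving_neg_gaussianCols r₁ n).prod (measurePreserving_neg_gaussianCols r₃ nd)

/-! ### Gaussian marginals and quadratic forms -/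

section OneDim

variable {n : ℕ}

lemma posSemidef_inv_smul_one (n : ℕ) :
    ((n : ℝ)⁻¹ • (1 : Matrix (Fin n) (Fin n) ℝ)).PosSemidef :=
  Matrix.PosSemidef.one.smul (by positivity)

lemma map_inner_gaussianCol (w : EuclideanSpace ℝ (Fin n)) :
    (gaussianCol n).map (fun x => ⟪w, x⟫_ℝ) = gaussianReal 0 (‖w‖ ^ 2 / n).toNNReal := by
  have h := IsGaussian.map_eq_gaussianReal (μ := gaussianCol n) (innerSL ℝ w)
  have h1 : ∫ x, (innerSL ℝ w) x ∂(gaussianCol n) = 0 :=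
    integral_dual_eq_zero_of_neg (measurePreserving_neg_gaussianCol n) _
  have h2 : Var[innerSL ℝ w; gaussianCol n] = ‖w‖ ^ 2 / n := by
    have h3 := covarianceBilin_self (μ := gaussianCol n) IsGaussian.memLp_two_id w
    have h4 := covarianceBilin_multivariateGaussian (μ := 0) (posSemidef_inv_smul_one n) w w
    rw [gaussianCol] at h3 ⊢
    rw [h4] at h3
    change Var[fun x => ⟪w, x⟫_ℝ; _] = _
    rw [← h3, Matrix.smul_mulVec, Matrix.one_mulVec, dotProduct_smul, ← inner_eq_dotProduct',
      real_inner_self_eq_norm_sq, smul_eq_mul, div_eq_inv_mul]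
  rw [h1, h2] at h
  exact h

lemma integral_inner_sq_gaussianCol (w : EuclideanSpace ℝ (Fin n)) :
    ∫ x, ⟪w, x⟫_ℝ ^ 2 ∂(gaussianCol n) = ‖w‖ ^ 2 / n := by
  have h1 : ∫ y, y ^ 2 ∂((gaussianCol n).map (fun x => ⟪w, x⟫_ℝ)) = ‖w‖ ^ 2 / n := by
    rw [map_inner_gaussianCol]
    have h := variance_of_integral_eq_zero (X := fun x : ℝ => x)
      (μ := gaussianReal 0 (‖w‖ ^ 2 / n).toNNReal) (by fun_prop) integral_id_gaussianReal
    rw [← h, variance_fun_id_gaussianReal, Real.coe_toNNReal _ (by positivity)]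
  rw [← h1, integral_map (by fun_prop) (by fun_prop)]

lemma integrable_inner_sq_gaussianCol (w : EuclideanSpace ℝ (Fin n)) :
    Integrable (fun x => ⟪w, x⟫_ℝ ^ 2) (gaussianCol n) :=
  (IsGaussian.memLp_dual (gaussianCol n) (innerSL ℝ w) 2 (by simp)).integrable_sq

/-- The probability that a standard Gaussian exceeds `1 / 2`. -/
def tailProb : ℝ := (gaussianReal 0 1).real (Set.Ici (1 / 2))

lemma tailProb_pos : 0 < tailProb := by
  have h : volume ≪ gaussianReal 0 1 := gaussianReal_absolutelyContinuous' 0 one_ne_zero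
  rw [tailProb, measureReal_def, ENNReal.toReal_pos_iff]
  refine ⟨pos_iff_ne_zero.2 fun h0 => ?_, measure_lt_top _ _⟩
  have := h h0
  simp at this

lemma tailProb_le_one : tailProb ≤ 1 := measureReal_le_one

/-- The pairing is a centered Gaussian with standard deviation ‖w‖/√n, and the hypothesis says that
`s` is at most half of it in absolute value. -/
lemma tailProb_le_inner (hn : 0 < n) (w : EuclideanSpace ℝ (Fin n)) {s : ℝ}
    (h : s ^ 2 ≤ ‖w‖ ^ 2 / (4 * n)) :
    tailProb ≤ (gaussianCol n).real {x | s ≤ ⟪w, x⟫_ℝ} := by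
  have hn' : (0 : ℝ) < n := by exact_mod_cast hn
  set σ : ℝ := Real.sqrt (‖w‖ ^ 2 / n) with hσ
  have hσ0 : 0 ≤ σ := Real.sqrt_nonneg _
  have hσ2 : σ ^ 2 = ‖w‖ ^ 2 / n := Real.sq_sqrt (by positivity)
  have hmap : (gaussianReal 0 1).map (σ * ·) = gaussianReal 0 (‖w‖ ^ 2 / n).toNNReal := by
    rw [gaussianReal_map_const_mul]
    congr 1
    · simp
    · ext
      simp [hσ2, Real.coe_toNNReal _ (show 0 ≤ ‖w‖ ^ 2 / n by positivity)]
  have hsσ : s ≤ σ * (1 / 2) := by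
    refine abs_le_of_sq_le_sq' ?_ (by positivity) |>.2
    calc s ^ 2 ≤ ‖w‖ ^ 2 / (4 * n) := h
      _ = (σ * (1 / 2)) ^ 2 := by rw [mul_pow, hσ2]; field_simp; norm_num
  have h1 : {x : EuclideanSpace ℝ (Fin n) | s ≤ ⟪w, x⟫_ℝ} =
      (fun x => ⟪w, x⟫_ℝ) ⁻¹' (Set.Ici s) := rfl
  rw [h1, ← map_measureReal_apply (by fun_prop) measurableSet_Ici, map_inner_gaussianCol, ← hmap,
    map_measureReal_apply (by fun_prop) measurableSet_Ici]
  refine measureReal_mono fun x hx => ?_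
  exact hsσ.trans (mul_le_mul_of_nonneg_left hx hσ0)

end OneDim

section Columns

variable {a n : ℕ} (M : Matrix (Fin a) (Fin n) ℝ)

lemma norm_lin_sq_eq_sum (x : EuclideanSpace ℝ (Fin n)) :
    ‖lin M x‖ ^ 2 = ∑ i, ⟪(WithLp.toLp 2 (M i) : EuclideanSpace ℝ (Fin n)), x⟫_ℝ ^ 2 := by
  rw [EuclideanSpace.real_norm_sq_eq]
  refine Finset.sum_congr rfl fun i _ => ?_
  rw [inner_eq_dotProduct', lin_apply]
  rfl

lemma frob_eq_sum_norm_sq :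
    frob M = ∑ i, ‖(WithLp.toLp 2 (M i) : EuclideanSpace ℝ (Fin n))‖ ^ 2 := by
  simp [frob, EuclideanSpace.real_norm_sq_eq]

lemma frob_nonneg : 0 ≤ frob M :=
  Finset.sum_nonneg fun _ _ => Finset.sum_nonneg fun _ _ => sq_nonneg _

lemma integrable_norm_lin_sq : Integrable (fun x => ‖lin M x‖ ^ 2) (gaussianCol n) := by
  simp only [norm_lin_sq_eq_sum]
  exact integrable_finsetSum _ fun i _ => integrable_inner_sq_gaussianCol _

lemma integral_norm_lin_sq : ∫ x, ‖lin M x‖ ^ 2 ∂(gaussianCol n) = frob M / n := by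
  simp only [norm_lin_sq_eq_sum]
  rw [integral_finsetSum _ fun i _ => integrable_inner_sq_gaussianCol _]
  simp only [integral_inner_sq_gaussianCol]
  rw [frob_eq_sum_norm_sq, Finset.sum_div]

lemma measureReal_lt_le_div {Ω : Type*} [MeasurableSpace Ω] {μ : Measure Ω} [IsFiniteMeasure μ]
    {f : Ω → ℝ} (hf : ∀ x, 0 ≤ f x) (hi : Integrable f μ) {K : ℝ} (hK : 0 < K) :
    μ.real {x | K < f x} ≤ (∫ x, f x ∂μ) / K := by
  rw [le_div_iff₀ hK, mul_comm]
  refine le_trans ?_ (mul_meas_ge_le_integral_of_nonneg (ae_of_all _ hf) hi K)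
  refine mul_le_mul_of_nonneg_left (measureReal_mono fun x hx => ?_) hK.le
  exact (le_of_lt hx : K ≤ f x)

lemma measureReal_lt_norm_lin_sq_le {K : ℝ} (hK : 0 < K) :
    (gaussianCol n).real {x | K < ‖lin M x‖ ^ 2} ≤ frob M / n / K := by
  rw [← integral_norm_lin_sq]
  exact measureReal_lt_le_div (fun _ => by positivity) (integrable_norm_lin_sq M) hK

lemma measureReal_lt_inner_sq_le (w : EuclideanSpace ℝ (Fin n)) {K : ℝ} (hK : 0 < K) :
    (gaussianCol n).real {x | K < ⟪w, x⟫_ℝ ^ 2} ≤ ‖w‖ ^ 2 / n / K := by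
  rw [← integral_inner_sq_gaussianCol]
  exact measureReal_lt_le_div (fun _ => by positivity) (integrable_inner_sq_gaussianCol w) hK

/-- A Gaussian quadratic form is at least a constant fraction of its mean with probability bounded
below. -/
lemma le_measureReal_le_norm_lin_sq (hn : 0 < n) :
    tailProb / 2 ≤ (gaussianCol n).real {x | tailProb / 8 * (frob M / n) ≤ ‖lin M x‖ ^ 2} := by
  have hn' : (0 : ℝ) < n := by exact_mod_cast hn
  have ht := tailProb_pos
  have ht1 := tailProb_le_one
  rcases (div_nonneg (frob_nonneg M) hn'.le).eq_or_lt with h0 | hF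
  · rw [← h0]
    have : {x : EuclideanSpace ℝ (Fin n) | tailProb / 8 * 0 ≤ ‖lin M x‖ ^ 2} = Set.univ := by
      ext x; simp
    rw [this]
    simp
    linarith
  set F := frob M / n with hFdef
  let w : Fin a → EuclideanSpace ℝ (Fin n) := fun i => WithLp.toLp 2 (M i)
  let S : Fin a → Set (EuclideanSpace ℝ (Fin n)) := fun i => {x | ‖w i‖ / (2 * √n) ≤ ⟪w i, x⟫_ℝ}
  have hSm : ∀ i, MeasurableSet (S i) := fun i => measurableSet_le measurable_const (by fun_prop)
  have hS : ∀ i, tailProb ≤ (gaussianCol n).real (S i) := fun i => by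
    refine tailProb_le_inner hn (w i) ?_
    rw [div_pow, mul_pow, Real.sq_sqrt hn'.le]
    norm_num
  -- On `S i` the i-th square is at least a quarter of its mean, so Q/4 is a lower bound for the
  -- quadratic form. Unlike the form itself, Q is bounded by F while its mean is at least `tailProb
  -- * F`; a reverse Markov inequality then suffices, without fourth moments.
  let Q : EuclideanSpace ℝ (Fin n) → ℝ := fun x => ∑ i, ‖w i‖ ^ 2 / n * (S i).indicator 1 x
  have hFsum : F = ∑ i, ‖w i‖ ^ 2 / n := by rw [hFdef, frob_eq_sum_norm_sq, Finset.sum_div]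
  have hQF : ∀ x, Q x ≤ F := by
    intro x
    rw [hFsum]
    refine Finset.sum_le_sum fun i _ => mul_le_of_le_one_right (by positivity) ?_
    exact Set.indicator_le_self' (fun _ _ => by simp) x
  have hQ4 : ∀ x, Q x / 4 ≤ ‖lin M x‖ ^ 2 := by
    intro x
    rw [norm_lin_sq_eq_sum, Finset.sum_div]
    refine Finset.sum_le_sum fun i _ => ?_
    by_cases hx : x ∈ S i
    · rw [Set.indicator_of_mem hx]
      have h1 : (‖w i‖ / (2 * √n)) ^ 2 ≤ ⟪w i, x⟫_ℝ ^ 2 := by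
        have : ‖w i‖ / (2 * √n) ≤ ⟪w i, x⟫_ℝ := hx
        gcongr
      refine le_trans (le_of_eq ?_) h1
      rw [div_pow, mul_pow, Real.sq_sqrt hn'.le]
      simp
      field_simp
      norm_num
    · rw [Set.indicator_of_notMem hx]
      simp
      positivity
  have hi : ∀ i, Integrable (fun x => ‖w i‖ ^ 2 / n * (S i).indicator (1 : EuclideanSpace ℝ (Fin n) → ℝ) x)
      (gaussianCol n) := fun i => ((integrable_const (1 : ℝ)).indicator (hSm i)).const_mul _
  have hQi : Integrable Q (gaussianCol n) := integrable_finsetSum _ fun i _ => hi i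
  have hEQ : tailProb * F ≤ ∫ x, Q x ∂(gaussianCol n) := by
    rw [integral_finsetSum _ fun i _ => hi i, hFsum, Finset.mul_sum]
    refine Finset.sum_le_sum fun i _ => ?_
    rw [integral_const_mul, integral_indicator_one (hSm i), mul_comm]
    exact mul_le_mul_of_nonneg_left (hS i) (by positivity)
  set A : Set (EuclideanSpace ℝ (Fin n)) := {x | tailProb / 8 * F ≤ ‖lin M x‖ ^ 2} with hA
  have hAm : MeasurableSet A := measurableSet_le measurable_const (by fun_prop)
  have hQle : ∀ x, Q x ≤ tailProb / 2 * F + F * A.indicator 1 x := by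
    intro x
    by_cases hx : x ∈ A
    · rw [Set.indicator_of_mem hx]
      have := hQF x
      simp
      nlinarith
    · rw [Set.indicator_of_notMem hx]
      have h1 : ‖lin M x‖ ^ 2 < tailProb / 8 * F := not_le.1 hx
      have := hQ4 x
      linarith
  have h2 := integral_mono hQi ((integrable_const (tailProb / 2 * F)).add
    (((integrable_const (1 : ℝ)).indicator hAm).const_mul F)) hQle
  rw [integral_add' (integrable_const _) (((integrable_const (1 : ℝ)).indicator hAm).const_mul F),
    integral_const_mul F, integral_const] at h2
  have h3 : ∫ x, A.indicator (fun _ => (1 : ℝ)) x ∂(gaussianCol n) = (gaussianCol n).real A :=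
    integral_indicator_one hAm
  rw [h3] at h2
  simp only [probReal_univ, smul_eq_mul, one_mul] at h2
  have h4 : F * (tailProb / 2) ≤ F * (gaussianCol n).real A := by linarith
  exact le_of_mul_le_mul_left h4 hF

end Columns

/-! ### Typical and nearly orthogonal families of columns -/

section Product

lemma measureReal_gaussianCols_eval {r n : ℕ} (p : Fin r) {S : Set (EuclideanSpace ℝ (Fin n))}
    (hS : MeasurableSet S) :
    (gaussianCols r n).real {x | x p ∈ S} = (gaussianCol n).real S :=
  (measurePreserving_eval (fun _ : Fin r => gaussianCol n) p).measureReal_preimage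
    hS.nullMeasurableSet

/-- With high probability, the pairings of Gaussian columns with given vectors and their images
under a matrix are bounded. -/
lemma exists_columns_bound (r N : ℕ) {K ε : ℝ} (hK : 0 < K) (hε : 0 < ε) :
    ∃ C : ℝ, 0 < C ∧ ∀ {a n : ℕ} (_ : 0 < a) (_ : 0 < n) (M : Matrix (Fin a) (Fin n) ℝ)
      (_ : frob M ≤ K * (a * n)) (v : Fin N → EuclideanSpace ℝ (Fin n)) (_ : ∀ j, ‖v j‖ ^ 2 ≤ K * n),
      1 - ε ≤ (gaussianCols r n).real
        {x | (∀ p j, ⟪v j, x p⟫_ℝ ^ 2 ≤ C) ∧ ∀ p, ‖lin M (x p)‖ ^ 2 ≤ C * a} := by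
  -- Union bound over r N + r events, each of probability at most K / C by Markov; the extra 1 keeps
  -- C positive when r = 0.
  obtain ⟨C, hC⟩ : ∃ C : ℝ, C = (r * N + r + 1) * K / ε := ⟨_, rfl⟩
  have hC0 : 0 < C := by rw [hC]; positivity
  refine ⟨C, hC0, ?_⟩
  intro a n ha hn M hM v hv
  have ha' : (0 : ℝ) < a := by exact_mod_cast ha
  have hn' : (0 : ℝ) < n := by exact_mod_cast hn
  set A : Set (Fin r → EuclideanSpace ℝ (Fin n)) :=
    {x | (∀ p j, ⟪v j, x p⟫_ℝ ^ 2 ≤ C) ∧ ∀ p, ‖lin M (x p)‖ ^ 2 ≤ C * a} with hA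
  have hAm : MeasurableSet A := by
    rw [hA]
    refine (MeasurableSet.of_compl ?_)
    have : IsClosed {x : Fin r → EuclideanSpace ℝ (Fin n) |
        (∀ p j, ⟪v j, x p⟫_ℝ ^ 2 ≤ C) ∧ ∀ p, ‖lin M (x p)‖ ^ 2 ≤ C * a} := by
      simp only [Set.ofPred_and, Set.ofPred_forall]
      refine IsClosed.inter ?_ ?_
      · exact isClosed_iInter fun p => isClosed_iInter fun j =>
          isClosed_le (by fun_prop) continuous_const
      · exact isClosed_iInter fun p => isClosed_le (by fun_prop) continuous_const
    exact this.measurableSet.compl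
  have hcompl : Aᶜ ⊆ (⋃ p : Fin r, ⋃ j : Fin N, {x | x p ∈ {y | C < ⟪v j, y⟫_ℝ ^ 2}}) ∪
      ⋃ p : Fin r, {x | x p ∈ {y | C * a < ‖lin M y‖ ^ 2}} := by
    intro x hx
    rw [hA, Set.mem_compl_iff, Set.mem_ofPred_eq, not_and_or] at hx
    push Not at hx
    rcases hx with ⟨p, j, h⟩ | ⟨p, h⟩
    · exact Or.inl (Set.mem_iUnion.2 ⟨p, Set.mem_iUnion.2 ⟨j, h⟩⟩)
    · exact Or.inr (Set.mem_iUnion.2 ⟨p, h⟩)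
  have h1 : ∀ (p : Fin r) (j : Fin N),
      (gaussianCols r n).real {x | x p ∈ {y | C < ⟪v j, y⟫_ℝ ^ 2}} ≤ K / C := by
    intro p j
    rw [measureReal_gaussianCols_eval p (measurableSet_lt measurable_const (by fun_prop))]
    refine (measureReal_lt_inner_sq_le (v j) hC0).trans ?_
    have : ‖v j‖ ^ 2 / n ≤ K := by rw [div_le_iff₀ hn']; exact hv j
    gcongr
  have h2 : ∀ p : Fin r,
      (gaussianCols r n).real {x | x p ∈ {y | C * a < ‖lin M y‖ ^ 2}} ≤ K / C := by
    intro p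
    rw [measureReal_gaussianCols_eval p (measurableSet_lt measurable_const (by fun_prop))]
    refine (measureReal_lt_norm_lin_sq_le M (by positivity)).trans ?_
    rw [div_div, div_le_div_iff₀ (by positivity) hC0]
    calc frob M * C ≤ K * (a * n) * C := by gcongr
      _ = K * (n * (C * a)) := by ring
  have h3 : (gaussianCols r n).real Aᶜ ≤ ε := by
    calc (gaussianCols r n).real Aᶜ
        ≤ _ := measureReal_mono hcompl
      _ ≤ _ := measureReal_union_le _ _
      _ ≤ (∑ p : Fin r, ∑ j : Fin N, K / C) + ∑ p : Fin r, K / C := by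
          refine add_le_add ?_ ?_
          · refine (measureReal_iUnion_fintype_le _).trans (Finset.sum_le_sum fun p _ => ?_)
            exact (measureReal_iUnion_fintype_le _).trans (Finset.sum_le_sum fun j _ => h1 p j)
          · exact (measureReal_iUnion_fintype_le _).trans (Finset.sum_le_sum fun p _ => h2 p)
      _ = (r * N + r) * K / C := by
          simp only [Finset.sum_const, Finset.card_univ, Fintype.card_fin, nsmul_eq_mul]
          ring
      _ ≤ ε := by
          rw [hC, div_le_iff₀ (by positivity), mul_div_cancel₀ _ hε.ne']
          nlinarith
  rw [probReal_compl_eq_one_sub hAm] at h3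
  linarith

/-- Lower bound for the probability of an event on a product by conditioning on the first
variable. -/
lemma mul_le_measureReal_prod {X Y : Type*} [MeasurableSpace X] [MeasurableSpace Y] {μ : Measure X}
    {ν : Measure Y} [IsProbabilityMeasure μ] [IsProbabilityMeasure ν] {S : Set (X × Y)}
    (hS : MeasurableSet S) {A : Set X} (hA : MeasurableSet A) {a b : ℝ} (hb : 0 ≤ b)
    (ha : a ≤ μ.real A) (h : ∀ x ∈ A, b ≤ ν.real {y | (x, y) ∈ S}) :
    a * b ≤ (μ.prod ν).real S := by
  have h1 : ∫ x, A.indicator (fun _ => b) x ∂μ ≤ ∫ x, ν.real {y | (x, y) ∈ S} ∂μ := by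
    refine integral_mono ((integrable_const b).indicator hA) ?_ ?_
    · exact Measure.integrable_measure_prodMk_left hS (measure_ne_top _ _)
    · intro x
      by_cases hx : x ∈ A
      · simpa [Set.indicator_of_mem hx] using h x hx
      · simp [Set.indicator_of_notMem hx]
  rw [integral_indicator_const _ hA, smul_eq_mul] at h1
  have h2 : ∫ x, ν.real {y | (x, y) ∈ S} ∂μ = (μ.prod ν).real S := by
    rw [← integral_indicator_one hS, integral_prod (S.indicator 1) ((integrable_const (1 : ℝ)).indicator hS)]
    refine integral_congr_ae (ae_of_all _ fun x => ?_)
    have : (fun y => S.indicator (1 : X × Y → ℝ) (x, y)) =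
        Set.indicator {y | (x, y) ∈ S} (1 : Y → ℝ) := by
      classical
      funext y
      by_cases hy : (x, y) ∈ S
      · rw [Set.indicator_of_mem hy, Set.indicator_of_mem (show y ∈ {y | (x, y) ∈ S} from hy)]
        rfl
      · rw [Set.indicator_of_notMem hy,
          Set.indicator_of_notMem (show y ∉ {y | (x, y) ∈ S} from hy)]
    exact (integral_indicator_one (measurable_prodMk_left hS)).symm.trans
      (congrArg (integral ν) this.symm)
  rw [← h2]
  exact (mul_le_mul_of_nonneg_right ha hb).trans h1

/-- Pigeonhole: a centered Gaussian vector has finitely many bounded statistics close to zero with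
probability bounded below, on a set that contains the normalized differences of typical points. -/
lemma le_measureReal_of_differences {V J : Type*} [NormedAddCommGroup V] [NormedSpace ℝ V]
    [MeasurableSpace V] [BorelSpace V] [SecondCountableTopology V] [CompleteSpace V] [Fintype J]
    (μ : Measure V) [IsGaussian μ] (hμ : ∀ L : StrongDual ℝ V, ∫ x, L x ∂μ = 0)
    {A B : Set V} (hA : MeasurableSet A) (hB : MeasurableSet B) (f : J → V → ℝ)
    (hf : ∀ j, Measurable (f j)) {C δ a : ℝ} (hδ : 0 < δ) (ha0 : 0 ≤ a) (ha : a ≤ μ.real A)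
    (hC : ∀ x ∈ A, ∀ j, |f j x| ≤ C)
    (h : ∀ x ∈ A, ∀ y ∈ A, (∀ j, |f j x - f j y| ≤ δ) → (√2)⁻¹ • x - (√2)⁻¹ • y ∈ B) :
    (a / (2 * ⌈C / δ⌉₊ + 1) ^ Fintype.card J) ^ 2 ≤ μ.real B := by
  classical
  set N : ℤ := ((⌈C / δ⌉₊ : ℕ) : ℤ) with hN
  let I : Finset (J → ℤ) := Fintype.piFinset fun _ => Finset.Icc (-N) N
  have hI : (I.card : ℝ) = (2 * ⌈C / δ⌉₊ + 1) ^ Fintype.card J := by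
    have h1 : (Finset.Icc (-N) N).card = 2 * ⌈C / δ⌉₊ + 1 := by
      rw [Int.card_Icc]; omega
    simp [I, Fintype.card_piFinset, h1]
  let cell : V → J → ℤ := fun x j => ⌊f j x / δ⌋
  let Z : (J → ℤ) → Set V := fun c => A ∩ {x | cell x = c}
  have hZm : ∀ c, MeasurableSet (Z c) := by
    intro c
    refine hA.inter ?_
    have hm : Measurable cell := measurable_pi_lambda _ fun j =>
      Int.measurable_floor.comp ((hf j).div_const δ)
    exact hm (measurableSet_singleton c)
  have hcover : A ⊆ ⋃ c ∈ I, Z c := by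
    intro x hx
    refine Set.mem_biUnion (x := cell x) ?_ ⟨hx, rfl⟩
    rw [Finset.mem_coe, Fintype.mem_piFinset]
    intro j
    have h1 := abs_le.1 (hC x hx j)
    have h2 : C / δ ≤ N := by rw [hN]; exact_mod_cast Nat.le_ceil _
    rw [div_le_iff₀ hδ] at h2
    rw [Finset.mem_Icc]
    constructor
    · rw [Int.le_floor, le_div_iff₀ hδ]
      push_cast
      linarith
    · refine Int.floor_le_iff.2 ?_
      rw [div_lt_iff₀ hδ]
      nlinarith
  have hIpos : 0 < (I.card : ℝ) := by rw [hI]; positivity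
  obtain ⟨c, -, hc⟩ : ∃ c ∈ I, a / I.card ≤ μ.real (Z c) := by
    by_contra! hcon
    have h1 : μ.real A ≤ ∑ c ∈ I, μ.real (Z c) :=
      (measureReal_mono hcover (measure_ne_top _ _)).trans (measureReal_biUnion_finset_le _ _)
    have hIne : I.Nonempty := Finset.card_pos.1 (by exact_mod_cast hIpos)
    have h2 : ∑ c ∈ I, μ.real (Z c) < ∑ c ∈ I, a / I.card := Finset.sum_lt_sum_of_nonempty hIne hcon
    rw [Finset.sum_const, nsmul_eq_mul, mul_div_cancel₀ _ hIpos.ne'] at h2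
    linarith
  -- The normalized difference of two independent points again has law μ. Hence the squared mass of
  -- one heavy cell bounds `μ.real B` from below.
  have hrot := measurePreserving_rotate μ hμ (a := (√2)⁻¹) (b := -(√2)⁻¹) (by
    rw [neg_sq, inv_pow, Real.sq_sqrt (by norm_num)]; norm_num)
  have hsub : Z c ×ˢ Z c ⊆ (fun z : V × V => (√2)⁻¹ • z.1 + (-(√2)⁻¹) • z.2) ⁻¹' B := by
    rintro ⟨x, y⟩ ⟨hx, hy⟩
    have := h x hx.1 y hy.1 fun j => ?_
    · simpa [sub_eq_add_neg] using this
    · have h1 : ⌊f j x / δ⌋ = ⌊f j y / δ⌋ := by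
        have h1 := congrFun hx.2 j
        have h2 := congrFun hy.2 j
        exact h1.trans h2.symm
      have h2 := Int.abs_sub_lt_one_of_floor_eq_floor h1
      rw [← sub_div, abs_div, abs_of_pos hδ, div_lt_one hδ] at h2
      exact h2.le
  have h1 := measureReal_mono (μ := μ.prod μ) hsub
  rw [hrot.measureReal_preimage hB.nullMeasurableSet, measureReal_prod_prod] at h1
  rw [← hI, sq]
  refine le_trans ?_ h1
  have : 0 ≤ a / I.card := by positivity
  gcongr

end Product

lemma integral_dual_gaussianCols (r n : ℕ) (L : StrongDual ℝ (Fin r → EuclideanSpace ℝ (Fin n))) :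
    ∫ x, L x ∂(gaussianCols r n) = 0 :=
  integral_dual_eq_zero_of_neg (measurePreserving_neg_gaussianCols r n) L

/-- With probability bounded below, Gaussian columns are nearly orthogonal to given vectors. -/
lemma exists_columns_small (r N : ℕ) {K : ℝ} (hK : 0 < K) :
    ∃ C : ℝ, 0 < C ∧ ∀ δ : ℝ, 0 < δ → ∃ π : ℝ, 0 < π ∧
      ∀ {a n : ℕ} (_ : 0 < a) (_ : 0 < n) (M : Matrix (Fin a) (Fin n) ℝ)
      (_ : frob M ≤ K * (a * n)) (v : Fin N → EuclideanSpace ℝ (Fin n)) (_ : ∀ j, ‖v j‖ ^ 2 ≤ K * n),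
      π ≤ (gaussianCols r n).real
        {x | (∀ p j, |⟪v j, x p⟫_ℝ| ≤ δ) ∧ ∀ p, ‖lin M (x p)‖ ^ 2 ≤ C * a} := by
  obtain ⟨C, hC0, hC⟩ := exists_columns_bound r N hK (ε := 1 / 2) (by norm_num)
  -- The parallelogram law bounds the squared norm of the image of a normalized difference by the
  -- sum of the two squared norms, hence the 2C. It does not depend on δ; only the probability does.
  -- The cells cover [-(C + 1), C + 1] because a square at most C has absolute value at most C + 1.
  refine ⟨2 * C, by positivity, fun δ hδ =>
    ⟨(1 / 2 / (2 * ⌈(C + 1) / δ⌉₊ + 1) ^ Fintype.card (Fin r × Fin N)) ^ 2, by positivity, ?_⟩⟩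
  intro a n ha hn M hM v hv
  have hA := hC ha hn M hM v hv
  have h2 : (√2)⁻¹ ^ 2 = (1 / 2 : ℝ) := by rw [inv_pow, Real.sq_sqrt (by norm_num)]; norm_num
  have h20 : (0 : ℝ) ≤ (√2)⁻¹ := by positivity
  have h21 : (√2 : ℝ)⁻¹ ≤ 1 := by nlinarith
  refine le_measureReal_of_differences (J := Fin r × Fin N) (gaussianCols r n)
    (integral_dual_gaussianCols r n) (A := {x | (∀ p j, ⟪v j, x p⟫_ℝ ^ 2 ≤ C) ∧
      ∀ p, ‖lin M (x p)‖ ^ 2 ≤ C * a}) ?_ ?_ (fun j x => ⟪v j.2, x j.1⟫_ℝ) (fun j => by fun_prop)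
    hδ (by norm_num) (le_trans (by norm_num) hA) ?_ ?_
  · apply IsClosed.measurableSet
    simp only [Set.ofPred_and, Set.ofPred_forall]
    exact (isClosed_iInter fun p => isClosed_iInter fun j =>
      isClosed_le (by fun_prop) continuous_const).inter
      (isClosed_iInter fun p => isClosed_le (by fun_prop) continuous_const)
  · apply IsClosed.measurableSet
    simp only [Set.ofPred_and, Set.ofPred_forall]
    exact (isClosed_iInter fun p => isClosed_iInter fun j =>
      isClosed_le (by fun_prop) continuous_const).inter
      (isClosed_iInter fun p => isClosed_le (by fun_prop) continuous_const)
  · intro x hx j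
    have := hx.1 j.1 j.2
    exact abs_le_of_sq_le_sq (by nlinarith) (by linarith)
  · intro x hx y hy hxy
    constructor
    · intro p j
      have h := hxy (p, j)
      simp only [Pi.sub_apply, Pi.smul_apply, inner_sub_right, inner_smul_right, ← mul_sub]
      rw [abs_mul, abs_of_nonneg h20]
      calc _ ≤ 1 * δ := mul_le_mul h21 h (abs_nonneg _) (by norm_num)
        _ = δ := one_mul δ
    · intro p
      simp only [Pi.sub_apply, Pi.smul_apply, ← smul_sub, map_smul, map_sub]
      rw [norm_smul, mul_pow, Real.norm_eq_abs, sq_abs, h2]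
      have h3 := hx.2 p
      have h4 := hy.2 p
      have h5 := parallelogram_law_with_norm ℝ (lin M (x p)) (lin M (y p))
      nlinarith [mul_self_nonneg ‖lin M (x p) + lin M (y p)‖]

/-! ### Initializations dominated by one small pairing -/

/-- Columnwise rotations of two independent families of Gaussian columns. -/
lemma measurePreserving_mix (r n : ℕ) {α β : Fin r → ℝ} (h : ∀ p, α p ^ 2 + β p ^ 2 = 1) :
    MeasurePreserving (fun (z : (Fin r → EuclideanSpace ℝ (Fin n)) ×
        (Fin r → EuclideanSpace ℝ (Fin n))) p => α p • z.1 p + β p • z.2 p)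
      ((gaussianCols r n).prod (gaussianCols r n)) (gaussianCols r n) := by
  have h1 := (measurePreserving_arrowProdEquivProdArrow (EuclideanSpace ℝ (Fin n))
    (EuclideanSpace ℝ (Fin n)) (Fin r) (fun _ => gaussianCol n) (fun _ => gaussianCol n)).symm
  have h2 := measurePreserving_pi (fun _ : Fin r => (gaussianCol n).prod (gaussianCol n))
    (fun _ => gaussianCol n)
    (f := fun p z => α p • z.1 + β p • z.2) fun p => measurePreserving_rotate (gaussianCol n)
      (integral_dual_eq_zero_of_neg (measurePreserving_neg_gaussianCol n)) (h p)
  exact h2.comp h1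

/-- Samples are drawn in the order right, left, right, left, so that each can be conditioned on the
earlier ones, while the rotation of columns needs the two left and the two right samples grouped
together. -/
lemma measurePreserving_interleave {X Y : Type*} [MeasurableSpace X] [MeasurableSpace Y]
    (μ : Measure X) (ν : Measure Y) [IsProbabilityMeasure μ] [IsProbabilityMeasure ν] :
    MeasurePreserving (fun z : Y × X × Y × X => ((z.2.1, z.2.2.2), (z.1, z.2.2.1)))
      (ν.prod (μ.prod (ν.prod μ))) ((μ.prod μ).prod (ν.prod ν)) := by
  have a1 : MeasurePreserving (fun z : X × Y × X => ((z.1, z.2.1), z.2.2))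
      (μ.prod (ν.prod μ)) ((μ.prod ν).prod μ) := (measurePreserving_prodAssoc μ ν μ).symm
  have a2 : MeasurePreserving (fun z : (X × Y) × X => ((z.1.2, z.1.1), z.2))
      ((μ.prod ν).prod μ) ((ν.prod μ).prod μ) :=
    (Measure.measurePreserving_swap (μ := μ) (ν := ν)).prod (MeasurePreserving.id μ)
  have a3 : MeasurePreserving (fun z : (Y × X) × X => (z.1.1, (z.1.2, z.2)))
      ((ν.prod μ).prod μ) (ν.prod (μ.prod μ)) := measurePreserving_prodAssoc ν μ μ
  have a4 : MeasurePreserving (fun z : Y × Y × X × X => ((z.1, z.2.1), z.2.2))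
      (ν.prod (ν.prod (μ.prod μ))) ((ν.prod ν).prod (μ.prod μ)) :=
    (measurePreserving_prodAssoc ν ν (μ.prod μ)).symm
  have a5 := (MeasurePreserving.id ν).prod ((a3.comp a2).comp a1)
  exact (Measure.measurePreserving_swap.comp a4).comp a5

/-- The pairings of the columns `u` with the columns `w` through `X` are dominated by a single
one, which is of order `τ`. -/
structure NearlySingle {r₁ r₃ n nd : ℕ} (X : Matrix (Fin n) (Fin nd) ℝ) (p : Fin r₁) (k : Fin r₃)
    (c C τ : ℝ) (u : Fin r₁ → EuclideanSpace ℝ (Fin n))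
    (w : Fin r₃ → EuclideanSpace ℝ (Fin nd)) : Prop where
  norm_left : ∀ p', ‖lin Xᵀ (u p')‖ ^ 2 ≤ C * nd
  norm_right : ∀ k', ‖lin X (w k')‖ ^ 2 ≤ C * n
  lower : c * τ ≤ ⟪u p, lin X (w k)⟫_ℝ
  upper : ⟪u p, lin X (w k)⟫_ℝ ≤ C * τ
  off : ∀ p' k', (p', k') ≠ (p, k) → |⟪u p', lin X (w k')⟫_ℝ| ≤ τ ^ 2

variable {r₁ r₃ n nd : ℕ}

lemma measurableSet_nearlySingle (X : Matrix (Fin n) (Fin nd) ℝ) (p : Fin r₁) (k : Fin r₃)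
    (c C τ : ℝ) : MeasurableSet {ω : (Fin r₁ → EuclideanSpace ℝ (Fin n)) ×
      (Fin r₃ → EuclideanSpace ℝ (Fin nd)) |
      NearlySingle X p k c C τ ω.1 ω.2 ∧ c * n ≤ ‖lin X (ω.2 k)‖ ^ 2} := by
  have : {ω : (Fin r₁ → EuclideanSpace ℝ (Fin n)) × (Fin r₃ → EuclideanSpace ℝ (Fin nd)) |
      NearlySingle X p k c C τ ω.1 ω.2 ∧ c * n ≤ ‖lin X (ω.2 k)‖ ^ 2} =
      {ω | (((((∀ p', ‖lin Xᵀ (ω.1 p')‖ ^ 2 ≤ C * nd) ∧ (∀ k', ‖lin X (ω.2 k')‖ ^ 2 ≤ C * n)) ∧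
        c * τ ≤ ⟪ω.1 p, lin X (ω.2 k)⟫_ℝ) ∧ ⟪ω.1 p, lin X (ω.2 k)⟫_ℝ ≤ C * τ) ∧
        (∀ p' k', (p', k') ≠ (p, k) → |⟪ω.1 p', lin X (ω.2 k')⟫_ℝ| ≤ τ ^ 2)) ∧
        c * n ≤ ‖lin X (ω.2 k)‖ ^ 2} := by
    ext ω
    constructor
    · rintro ⟨⟨h1, h2, h3, h4, h5⟩, h6⟩
      exact ⟨⟨⟨⟨⟨h1, h2⟩, h3⟩, h4⟩, h5⟩, h6⟩
    · rintro ⟨⟨⟨⟨⟨h1, h2⟩, h3⟩, h4⟩, h5⟩, h6⟩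
      exact ⟨⟨h1, h2, h3, h4, h5⟩, h6⟩
  rw [this]
  apply IsClosed.measurableSet
  simp only [Set.ofPred_and, Set.ofPred_forall]
  refine ((((IsClosed.inter ?_ ?_).inter ?_).inter ?_).inter ?_).inter ?_
  · exact isClosed_iInter fun p => isClosed_le (by fun_prop) continuous_const
  · exact isClosed_iInter fun p => isClosed_le (by fun_prop) continuous_const
  · exact isClosed_le continuous_const (by fun_prop)
  · exact isClosed_le (by fun_prop) continuous_const
  · exact isClosed_iInter fun p => isClosed_iInter fun k => isClosed_iInter fun _ =>
      isClosed_le (by fun_prop) continuous_const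
  · exact isClosed_le continuous_const (by fun_prop)

lemma add_sub_one_le_measureReal_inter {Ω : Type*} [MeasurableSpace Ω] {μ : Measure Ω}
    [IsProbabilityMeasure μ] {A B : Set Ω} (hB : MeasurableSet B) {a b : ℝ}
    (ha : a ≤ μ.real A) (hb : b ≤ μ.real B) : a + b - 1 ≤ μ.real (A ∩ B) := by
  have h1 := measureReal_union_add_inter (μ := μ) (s := A) hB
  have h2 : μ.real (A ∪ B) ≤ 1 := measureReal_le_one
  linarith

lemma isClosed_columns_bound {r N a n : ℕ} (M : Matrix (Fin a) (Fin n) ℝ)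
    (v : Fin N → EuclideanSpace ℝ (Fin n)) (C C' : ℝ) :
    IsClosed {x : Fin r → EuclideanSpace ℝ (Fin n) |
      (∀ p j, ⟪v j, x p⟫_ℝ ^ 2 ≤ C) ∧ ∀ p, ‖lin M (x p)‖ ^ 2 ≤ C'} := by
  simp only [Set.ofPred_and, Set.ofPred_forall]
  exact (isClosed_iInter fun p => isClosed_iInter fun j =>
    isClosed_le (by fun_prop) continuous_const).inter
    (isClosed_iInter fun p => isClosed_le (by fun_prop) continuous_const)

lemma isClosed_columns_small {r N a n : ℕ} (M : Matrix (Fin a) (Fin n) ℝ)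
    (v : Fin N → EuclideanSpace ℝ (Fin n)) (C C' : ℝ) :
    IsClosed {x : Fin r → EuclideanSpace ℝ (Fin n) |
      (∀ p j, |⟪v j, x p⟫_ℝ| ≤ C) ∧ ∀ p, ‖lin M (x p)‖ ^ 2 ≤ C'} := by
  simp only [Set.ofPred_and, Set.ofPred_forall]
  exact (isClosed_iInter fun p => isClosed_iInter fun j =>
    isClosed_le (by fun_prop) continuous_const).inter
    (isClosed_iInter fun p => isClosed_le (by fun_prop) continuous_const)

/-- The deterministic part of the construction. In column `p`, the component τ x₁ supplies the
pairing of order τ with `y k`, while every pairing involving `x₂` and every pairing of `x₁` with the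
other `y k'` is at most δ. Thus the off-diagonal entries are at most 2δ ≤ τ², and the dominant one
keeps at least τ s/2 - δ ≥ τ s/4. -/
lemma nearlySingle_mix {r₁ r₃ n nd : ℕ} (X : Matrix (Fin n) (Fin nd) ℝ) {p : Fin r₁} {k : Fin r₃}
    {c s C₁ C₂ C₃ C₄ τ ρ δ : ℝ} (hC₁ : 0 < C₁) (hC₂ : 0 < C₂) (hC₃ : 0 < C₃) (hC₄ : 0 < C₄)
    (hτ : 0 < τ) (hτ1 : τ ≤ 1) (hρ2 : ρ ^ 2 = 1 - τ ^ 2) (hρ0 : 0 ≤ ρ) (hδ1 : δ ≤ τ ^ 2 / 2)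
    (hδ2 : δ ≤ τ * (s / 4)) {x₁ : EuclideanSpace ℝ (Fin n)} {x x₂ : Fin r₁ → EuclideanSpace ℝ (Fin n)}
    {y : Fin r₃ → EuclideanSpace ℝ (Fin nd)}
    (hyC : ∀ k', ‖lin X (y k')‖ ^ 2 ≤ (C₁ + C₃) * n)
    (hx₁l : s / 2 ≤ ⟪lin X (y k), x₁⟫_ℝ) (hx₁u : ⟪lin X (y k), x₁⟫_ℝ ^ 2 ≤ C₂)
    (hc : c ≤ s / 4) (hx₁C : ‖lin Xᵀ x₁‖ ^ 2 ≤ C₂ * nd)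
    (hy₂s : ∀ k', k' ≠ k → |⟪lin Xᵀ x₁, y k'⟫_ℝ| ≤ δ)
    (hx₂s : ∀ p' k', |⟪lin X (y k'), x₂ p'⟫_ℝ| ≤ δ)
    (hx₂C : ∀ p', ‖lin Xᵀ (x₂ p')‖ ^ 2 ≤ C₄ * nd)
    (hxp : x p = τ • x₁ + ρ • x₂ p) (hxp' : ∀ p', p' ≠ p → x p' = x₂ p') :
    NearlySingle X p k c (C₁ + C₃ + 2 * C₂ + 2 * C₄ + 2) τ x y := by
  have hτ2 : τ ^ 2 ≤ 1 := pow_le_one₀ hτ.le hτ1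
  have hρ1 : ρ ≤ 1 := by nlinarith
  have hδτ : δ ≤ τ ^ 2 := hδ1.trans (by nlinarith)
  have e1 : ∀ k', ⟪x p, lin X (y k')⟫_ℝ =
      τ * ⟪lin X (y k'), x₁⟫_ℝ + ρ * ⟪lin X (y k'), x₂ p⟫_ℝ := by
    intro k'
    rw [hxp, real_inner_comm, inner_add_right, inner_smul_right, inner_smul_right]
  have e2 : ∀ k', |ρ * ⟪lin X (y k'), x₂ p⟫_ℝ| ≤ δ := by
    intro k'
    rw [abs_mul, abs_of_nonneg hρ0]
    calc _ ≤ 1 * δ := mul_le_mul hρ1 (hx₂s p k') (abs_nonneg _) (by norm_num)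
      _ = δ := one_mul δ
  have e3 := abs_le.1 (e2 k)
  have e4 := e1 k
  refine ⟨?_, ?_, ?_, ?_, ?_⟩
  · intro p'
    by_cases h : p' = p
    · rw [h, hxp, map_add, map_smul, map_smul]
      have h1 := hx₁C
      have h2 := hx₂C p
      have h3 := parallelogram_law_with_norm ℝ (τ • lin Xᵀ (x₁)) (ρ • lin Xᵀ (x₂ p))
      have h4 : ‖τ • lin Xᵀ (x₁)‖ ^ 2 ≤ C₂ * nd := by
        rw [norm_smul, mul_pow, Real.norm_eq_abs, sq_abs]
        exact (mul_le_of_le_one_left (by positivity) hτ2).trans h1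
      have h5 : ‖ρ • lin Xᵀ (x₂ p)‖ ^ 2 ≤ C₄ * nd := by
        rw [norm_smul, mul_pow, Real.norm_eq_abs, sq_abs]
        exact (mul_le_of_le_one_left (by positivity) (by nlinarith)).trans h2
      have h6 : 0 ≤ (C₁ + C₃ + 2) * nd := by positivity
      nlinarith [mul_self_nonneg ‖τ • lin Xᵀ (x₁) - ρ • lin Xᵀ (x₂ p)‖]
    · rw [hxp' p' h]
      exact (hx₂C p').trans (by gcongr; linarith)
  · intro k'
    exact (hyC k').trans (mul_le_mul_of_nonneg_right (by linarith) (by positivity))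
  · rw [e4]
    have h1 : c * τ ≤ s / 4 * τ := by gcongr
    have h2 : τ * (s / 2) ≤ τ * ⟪lin X (y k), x₁⟫_ℝ := by gcongr
    linarith [e3.1]
  · rw [e4]
    have h1 : ⟪lin X (y k), x₁⟫_ℝ ≤ 1 + C₂ := by nlinarith
    have h2 : τ * ⟪lin X (y k), x₁⟫_ℝ ≤ τ * (1 + C₂) := by gcongr
    have h3 : δ ≤ τ := hδτ.trans (by nlinarith)
    have h4 : 0 ≤ (C₁ + C₃ + C₂ + 2 * C₄) * τ := by positivity
    linarith [e3.2]
  · intro p' k' hne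
    by_cases h : p' = p
    · have hk : k' ≠ k := fun hk => hne (by rw [h, hk])
      rw [h, e1]
      have h1 := e2 k'
      refine (abs_add_le _ _).trans ?_
      have h2 : |τ * ⟪lin X (y k'), x₁⟫_ℝ| ≤ δ := by
        rw [abs_mul, abs_of_pos hτ, real_inner_comm, ← inner_lin_transpose]
        calc _ ≤ 1 * δ := mul_le_mul hτ1 (hy₂s k' hk) (abs_nonneg _) (by norm_num)
          _ = δ := one_mul δ
      linarith
    · rw [hxp' p' h, real_inner_comm]
      exact (hx₂s p' k').trans hδτ

set_option maxHeartbeats 400000 in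
/-- The event that the pairings are nearly concentrated on a single entry of order `τ` has
probability bounded below uniformly in the size of the model. -/
theorem exists_nearlySingle_right (r₁ r₃ : ℕ) {κ K : ℝ} (hκ : 0 < κ) (hK : 0 < K) :
    ∃ c C : ℝ, 0 < c ∧ 0 < C ∧ ∀ τ : ℝ, 0 < τ → τ ≤ 1 → ∃ π : ℝ, 0 < π ∧
      ∀ {n nd : ℕ} (_ : 0 < n) (_ : 0 < nd) (X : Matrix (Fin n) (Fin nd) ℝ)
      (_ : κ * (n * nd) ≤ frob X) (_ : frob X ≤ K * (n * nd)) (p : Fin r₁) (k : Fin r₃),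
      π ≤ (initLaw r₁ r₃ n nd).real {ω | NearlySingle X p k c C τ ω.1 ω.2 ∧
        c * n ≤ ‖lin X (ω.2 k)‖ ^ 2} := by
  have ht := tailProb_pos
  have ht1 := tailProb_le_one
  set t := tailProb with htdef
  -- Each constant is fed into the size hypothesis of the later samples. The failure probabilities
  -- are half of those with which the required lower bounds hold (t/2 for the quadratic form, t for
  -- the pairing), so t/4 and t/2 remain. None of C₁, ..., C₄ depends on τ; only δ and the
  -- probabilities π₃, π₄ do.
  obtain ⟨C₁, hC₁, H₁⟩ := exists_columns_bound r₃ 0 hK (ε := t / 4) (by positivity)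
  obtain ⟨C₂, hC₂, H₂⟩ := exists_columns_bound r₁ 1 (K := K + C₁) (ε := t / 2)
    (by positivity) (by positivity)
  obtain ⟨C₃, hC₃, H₃⟩ := exists_columns_small r₃ 1 (K := K + C₂) (by positivity)
  obtain ⟨C₄, hC₄, H₄⟩ := exists_columns_small r₁ r₃ (K := K + C₁ + C₃) (by positivity)
  obtain ⟨c₁, hc₁⟩ : ∃ c₁, c₁ = t / 8 * κ := ⟨_, rfl⟩
  have hc₁0 : 0 < c₁ := by rw [hc₁]; positivity
  have hs0 : 0 < √c₁ := Real.sqrt_pos.2 hc₁0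
  have hs2 : √c₁ ^ 2 = c₁ := Real.sq_sqrt hc₁0.le
  refine ⟨min c₁ (√c₁ / 4), C₁ + C₃ + 2 * C₂ + 2 * C₄ + 2, lt_min hc₁0 (by positivity),
    by positivity, fun τ hτ hτ1 => ?_⟩
  obtain ⟨δ, hδdef⟩ : ∃ δ, δ = min (τ ^ 2 / 2) (τ * (√c₁ / 4)) := ⟨_, rfl⟩
  have hδ : 0 < δ := by rw [hδdef]; exact lt_min (by positivity) (by positivity)
  have hδ1 : δ ≤ τ ^ 2 / 2 := by rw [hδdef]; exact min_le_left _ _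
  have hδ2 : δ ≤ τ * (√c₁ / 4) := by rw [hδdef]; exact min_le_right _ _
  obtain ⟨π₃, hπ₃, H₃⟩ := H₃ δ hδ
  obtain ⟨π₄, hπ₄, H₄⟩ := H₄ δ hδ
  refine ⟨t / 4 * (t / 2 * (π₃ * π₄)), by positivity, ?_⟩
  intro n nd hn hnd X hκX hXK p k
  have hn' : (0 : ℝ) < n := by exact_mod_cast hn
  have hnd' : (0 : ℝ) < nd := by exact_mod_cast hnd
  have hXt : frob Xᵀ ≤ K * (nd * n) := by rw [frob_transpose, mul_comm (nd : ℝ)]; exact hXK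
  set ρ : ℝ := √(1 - τ ^ 2) with hρ
  have hτ2 : τ ^ 2 ≤ 1 := pow_le_one₀ hτ.le hτ1
  have hρ2 : ρ ^ 2 = 1 - τ ^ 2 := Real.sq_sqrt (by linarith)
  have hρ0 : 0 ≤ ρ := Real.sqrt_nonneg _
  have hρ1 : ρ ≤ 1 := by nlinarith
  -- Left column `p` is τ x₁ + √(1 - τ²) x₂ and the other left columns come from x₂; right column
  -- `k` comes from y₁ and the others from y₂. All coefficient pairs lie on the unit circle, so the
  -- law is the initial one.
  let α : Fin r₁ → ℝ := fun p' => if p' = p then τ else 0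
  let β : Fin r₁ → ℝ := fun p' => if p' = p then ρ else 1
  let α' : Fin r₃ → ℝ := fun k' => if k' = k then 1 else 0
  let β' : Fin r₃ → ℝ := fun k' => if k' = k then 0 else 1
  have hαβ : ∀ p', α p' ^ 2 + β p' ^ 2 = 1 := by
    intro p'
    by_cases h : p' = p <;> simp [α, β, h, hρ2]
  have hαβ' : ∀ k', α' k' ^ 2 + β' k' ^ 2 = 1 := by
    intro k'
    by_cases h : k' = k <;> simp [α', β', h]
  have hΦ := ((measurePreserving_mix r₁ n hαβ).prod (measurePreserving_mix r₃ nd hαβ')).comp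
    (measurePreserving_interleave (gaussianCols r₁ n) (gaussianCols r₃ nd))
  rw [initLaw_eq, ← hΦ.measureReal_preimage (measurableSet_nearlySingle X p k _ _ τ).nullMeasurableSet]
  have hSm := hΦ.measurable (measurableSet_nearlySingle X p k (min c₁ (√c₁ / 4))
    (C₁ + C₃ + 2 * C₂ + 2 * C₄ + 2) τ)
  -- first choice of the right columns
  set A₁ : Set (Fin r₃ → EuclideanSpace ℝ (Fin nd)) := {y | y k ∈ {z | c₁ * n ≤ ‖lin X z‖ ^ 2}} ∩
    {y | (∀ k' (j : Fin 0), ⟪(Fin.elim0 j : EuclideanSpace ℝ (Fin nd)), y k'⟫_ℝ ^ 2 ≤ C₁) ∧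
      ∀ k', ‖lin X (y k')‖ ^ 2 ≤ C₁ * n} with hA₁
  have hA₁c : MeasurableSet {z : EuclideanSpace ℝ (Fin nd) | c₁ * n ≤ ‖lin X z‖ ^ 2} :=
    measurableSet_le measurable_const (by fun_prop)
  have hA₁m : MeasurableSet A₁ := by
    refine MeasurableSet.inter ?_ (isClosed_columns_bound X _ _ _).measurableSet
    exact (measurable_pi_apply k) hA₁c
  have hA₁p : t / 4 ≤ (gaussianCols r₃ nd).real A₁ := by
    have h1 := H₁ hn hnd X hXK (fun j => Fin.elim0 j) (fun j => Fin.elim0 j)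
    have h2 := le_measureReal_le_norm_lin_sq X hnd
    have h3 : t / 2 ≤ (gaussianCols r₃ nd).real {y | y k ∈ {z | c₁ * n ≤ ‖lin X z‖ ^ 2}} := by
      rw [measureReal_gaussianCols_eval k hA₁c]
      refine h2.trans (measureReal_mono fun z hz => ?_)
      refine le_trans ?_ (show tailProb / 8 * (frob X / nd) ≤ ‖lin X z‖ ^ 2 from hz)
      have : κ * n ≤ frob X / nd := by rw [le_div_iff₀ hnd']; linarith
      calc c₁ * n = t / 8 * (κ * n) := by rw [hc₁]; ring
        _ ≤ _ := by gcongr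
    have h4 := add_sub_one_le_measureReal_inter
      (isClosed_columns_bound X _ _ _).measurableSet h3 h1
    refine le_trans ?_ h4
    linarith
  refine mul_le_measureReal_prod hSm hA₁m (by positivity) hA₁p fun y₁ hy₁ => ?_
  have hy₁c : c₁ * n ≤ ‖lin X (y₁ k)‖ ^ 2 := hy₁.1
  have hy₁C : ∀ k', ‖lin X (y₁ k')‖ ^ 2 ≤ C₁ * n := hy₁.2.2
  have hS₁m := measurable_prodMk_left (x := y₁) hSm
  -- first choice of the left columns
  set A₂ : Set (Fin r₁ → EuclideanSpace ℝ (Fin n)) :=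
    {x | x p ∈ {z | √c₁ / 2 ≤ ⟪lin X (y₁ k), z⟫_ℝ}} ∩
    {x | (∀ p' (j : Fin 1), ⟪lin X (y₁ k), x p'⟫_ℝ ^ 2 ≤ C₂) ∧
      ∀ p', ‖lin Xᵀ (x p')‖ ^ 2 ≤ C₂ * nd} with hA₂
  have hA₂c : MeasurableSet {z : EuclideanSpace ℝ (Fin n) | √c₁ / 2 ≤ ⟪lin X (y₁ k), z⟫_ℝ} :=
    measurableSet_le measurable_const (by fun_prop)
  have hA₂m : MeasurableSet A₂ := by
    refine MeasurableSet.inter ?_ (isClosed_columns_bound Xᵀ (fun _ : Fin 1 => _) _ _).measurableSet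
    exact (measurable_pi_apply p) hA₂c
  have hA₂p : t / 2 ≤ (gaussianCols r₁ n).real A₂ := by
    have h1 := H₂ hnd hn Xᵀ (hXt.trans (by gcongr; linarith)) (fun _ => lin X (y₁ k))
      (fun _ => (hy₁C k).trans (by gcongr; linarith))
    have h3 : t ≤ (gaussianCols r₁ n).real {x | x p ∈ {z | √c₁ / 2 ≤ ⟪lin X (y₁ k), z⟫_ℝ}} := by
      rw [measureReal_gaussianCols_eval p hA₂c]
      refine tailProb_le_inner hn _ ?_
      rw [div_pow, hs2, div_le_div_iff₀ (by positivity) (by positivity)]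
      linarith
    have h4 := add_sub_one_le_measureReal_inter
      (isClosed_columns_bound Xᵀ (fun _ : Fin 1 => lin X (y₁ k)) _ _).measurableSet h3 h1
    refine le_trans ?_ h4
    linarith
  refine mul_le_measureReal_prod hS₁m hA₂m (by positivity) hA₂p fun x₁ hx₁ => ?_
  have hx₁l : √c₁ / 2 ≤ ⟪lin X (y₁ k), x₁ p⟫_ℝ := hx₁.1
  have hx₁u : ⟪lin X (y₁ k), x₁ p⟫_ℝ ^ 2 ≤ C₂ := hx₁.2.1 p 0
  have hx₁C : ∀ p', ‖lin Xᵀ (x₁ p')‖ ^ 2 ≤ C₂ * nd := hx₁.2.2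
  have hS₂m := measurable_prodMk_left (x := x₁) hS₁m
  -- second choice of the right columns
  refine mul_le_measureReal_prod hS₂m
    (isClosed_columns_small X (fun _ : Fin 1 => lin Xᵀ (x₁ p)) δ (C₃ * n)).measurableSet hπ₄.le
    (H₃ hn hnd X (hXK.trans (by gcongr; linarith)) (fun _ => lin Xᵀ (x₁ p))
      (fun _ => (hx₁C p).trans (by gcongr; linarith))) fun y₂ hy₂ => ?_
  have hy₂s : ∀ k', |⟪lin Xᵀ (x₁ p), y₂ k'⟫_ℝ| ≤ δ := fun k' => hy₂.1 k' 0
  have hy₂C : ∀ k', ‖lin X (y₂ k')‖ ^ 2 ≤ C₃ * n := hy₂.2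
  set y : Fin r₃ → EuclideanSpace ℝ (Fin nd) := fun k' => α' k' • y₁ k' + β' k' • y₂ k' with hy
  have hyk : y k = y₁ k := by simp [hy, α', β']
  have hyk' : ∀ k', k' ≠ k → y k' = y₂ k' := fun k' h => by simp [hy, α', β', h]
  have hyC : ∀ k', ‖lin X (y k')‖ ^ 2 ≤ (C₁ + C₃) * n := by
    intro k'
    by_cases h : k' = k
    · rw [h, hyk]
      exact (hy₁C k).trans (by gcongr; linarith)
    · rw [hyk' k' h]
      exact (hy₂C k').trans (by gcongr; linarith)
  refine (H₄ hnd hn Xᵀ (hXt.trans (by gcongr; linarith)) (fun k' => lin X (y k'))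
      (fun k' => (hyC k').trans (by gcongr; linarith))).trans (measureReal_mono ?_)
  -- the final configuration
  intro x₂ hx₂
  have hx₂s : ∀ p' k', |⟪lin X (y k'), x₂ p'⟫_ℝ| ≤ δ := hx₂.1
  have hx₂C : ∀ p', ‖lin Xᵀ (x₂ p')‖ ^ 2 ≤ C₄ * nd := hx₂.2
  set x : Fin r₁ → EuclideanSpace ℝ (Fin n) := fun p' => α p' • x₁ p' + β p' • x₂ p' with hx
  have hxp : x p = τ • x₁ p + ρ • x₂ p := by simp [hx, α, β]
  have hxp' : ∀ p', p' ≠ p → x p' = x₂ p' := fun p' h => by simp [hx, α, β, h]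
  change NearlySingle X p k _ _ τ x y ∧ _ ≤ ‖lin X (y k)‖ ^ 2
  refine ⟨nearlySingle_mix X hC₁ hC₂ hC₃ hC₄ hτ hτ1 hρ2 hρ0 hδ1 hδ2 hyC ?_ ?_ ?_ (hx₁C p) ?_
    hx₂s hx₂C hxp hxp', ?_⟩
  · rw [hyk]; exact hx₁l
  · rw [hyk]; exact hx₁u
  · exact min_le_right _ _
  · intro k' hk'
    rw [hyk' k' hk']
    exact hy₂s k'
  · rw [hyk]
    refine le_trans ?_ hy₁c
    gcongr
    exact min_le_left _ _

/-- The right version applied to the transpose of X, with left and right columns exchanged. The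
lower bound for the image of a `U₁` column serves the terms of `U₃`, as the right version serves
those of `U₁`. -/
theorem exists_nearlySingle_left (r₁ r₃ : ℕ) {κ K : ℝ} (hκ : 0 < κ) (hK : 0 < K) :
    ∃ c C : ℝ, 0 < c ∧ 0 < C ∧ ∀ τ : ℝ, 0 < τ → τ ≤ 1 → ∃ π : ℝ, 0 < π ∧
      ∀ {n nd : ℕ} (_ : 0 < n) (_ : 0 < nd) (X : Matrix (Fin n) (Fin nd) ℝ)
      (_ : κ * (n * nd) ≤ frob X) (_ : frob X ≤ K * (n * nd)) (p : Fin r₁) (k : Fin r₃),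
      π ≤ (initLaw r₁ r₃ n nd).real {ω | NearlySingle X p k c C τ ω.1 ω.2 ∧
        c * nd ≤ ‖lin Xᵀ (ω.1 p)‖ ^ 2} := by
  obtain ⟨c, C, hc, hC, H⟩ := exists_nearlySingle_right r₃ r₁ hκ hK
  refine ⟨c, C, hc, hC, fun τ hτ hτ1 => ?_⟩
  obtain ⟨π, hπ, H⟩ := H τ hτ hτ1
  refine ⟨π, hπ, ?_⟩
  intro n nd hn hnd X h1 h2 p k
  have h := H hnd hn Xᵀ (by rwa [frob_transpose, mul_comm (nd : ℝ)])
    (by rwa [frob_transpose, mul_comm (nd : ℝ)]) k p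
  rw [initLaw_eq] at h ⊢
  have hsw : MeasurePreserving Prod.swap ((gaussianCols r₁ n).prod (gaussianCols r₃ nd))
    ((gaussianCols r₃ nd).prod (gaussianCols r₁ n)) := Measure.measurePreserving_swap
  rw [← hsw.measureReal_preimage (measurableSet_nearlySingle Xᵀ k p c C τ).nullMeasurableSet] at h
  refine h.trans (measureReal_mono ?_)
  rintro ⟨u, w⟩ ⟨⟨a1, a2, a3, a4, a5⟩, a6⟩
  simp only [Prod.swap_prod_mk, Matrix.transpose_transpose] at a1 a2 a3 a4 a5 a6
  have e : ∀ p' k', ⟪w k', lin Xᵀ (u p')⟫_ℝ = ⟪u p', lin X (w k')⟫_ℝ := fun p' k' => by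
    rw [real_inner_comm, inner_lin_transpose]
  refine ⟨⟨a2, a1, by rwa [e] at a3, by rwa [e] at a4, fun p' k' hne => ?_⟩, a6⟩
  rw [← e]
  exact a5 k' p' fun hh => hne (by simp_all)

/-- With high probability, the pairings and the images of the columns are bounded. -/
theorem exists_init_bound (r₁ r₃ : ℕ) {K ε : ℝ} (hK : 0 < K) (hε : 0 < ε) :
    ∃ C : ℝ, 0 < C ∧ ∀ {n nd : ℕ} (_ : 0 < n) (_ : 0 < nd) (X : Matrix (Fin n) (Fin nd) ℝ)
      (_ : frob X ≤ K * (n * nd)),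
      1 - ε ≤ (initLaw r₁ r₃ n nd).real {ω | (∀ p, ‖lin Xᵀ (ω.1 p)‖ ^ 2 ≤ C * nd) ∧
        (∀ k, ‖lin X (ω.2 k)‖ ^ 2 ≤ C * n) ∧ ∀ p k, ⟪ω.1 p, lin X (ω.2 k)⟫_ℝ ^ 2 ≤ C} := by
  -- Conditioning on the right columns gives (1 - ε')², which is at least 1 - 2ε'; the bound ε' ≤ 1
  -- keeps the factors nonnegative.
  obtain ⟨ε', hε', hε'ε, hε'1⟩ : ∃ ε', 0 < ε' ∧ ε' ≤ ε / 2 ∧ ε' ≤ 1 :=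
    ⟨min (ε / 2) 1, lt_min (by positivity) one_pos, min_le_left _ _, min_le_right _ _⟩
  obtain ⟨C₁, hC₁, H₁⟩ := exists_columns_bound r₃ 0 hK hε'
  obtain ⟨C₂, hC₂, H₂⟩ := exists_columns_bound r₁ r₃ (K := K + C₁) (by positivity) hε'
  refine ⟨C₁ + C₂, by positivity, ?_⟩
  intro n nd hn hnd X hXK
  have hXt : frob Xᵀ ≤ K * (nd * n) := by rw [frob_transpose, mul_comm (nd : ℝ)]; exact hXK
  set S : Set ((Fin r₁ → EuclideanSpace ℝ (Fin n)) × (Fin r₃ → EuclideanSpace ℝ (Fin nd))) :=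
    {ω | (∀ p, ‖lin Xᵀ (ω.1 p)‖ ^ 2 ≤ (C₁ + C₂) * nd) ∧
      (∀ k, ‖lin X (ω.2 k)‖ ^ 2 ≤ (C₁ + C₂) * n) ∧
      ∀ p k, ⟪ω.1 p, lin X (ω.2 k)⟫_ℝ ^ 2 ≤ C₁ + C₂} with hS
  have hSm : MeasurableSet S := by
    apply IsClosed.measurableSet
    rw [hS]
    simp only [Set.ofPred_and, Set.ofPred_forall]
    refine IsClosed.inter ?_ (IsClosed.inter ?_ ?_)
    · exact isClosed_iInter fun p => isClosed_le (by fun_prop) continuous_const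
    · exact isClosed_iInter fun p => isClosed_le (by fun_prop) continuous_const
    · exact isClosed_iInter fun p => isClosed_iInter fun k =>
        isClosed_le (by fun_prop) continuous_const
  have hsw : MeasurePreserving Prod.swap ((gaussianCols r₃ nd).prod (gaussianCols r₁ n))
    ((gaussianCols r₁ n).prod (gaussianCols r₃ nd)) := Measure.measurePreserving_swap
  rw [initLaw_eq, ← hsw.measureReal_preimage hSm.nullMeasurableSet]
  have h := mul_le_measureReal_prod (μ := gaussianCols r₃ nd) (ν := gaussianCols r₁ n)
    (hsw.measurable hSm)
    (isClosed_columns_bound X (fun j : Fin 0 => Fin.elim0 j) C₁ (C₁ * n)).measurableSet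
    (a := 1 - ε') (b := 1 - ε') (by linarith)
    (H₁ hn hnd X hXK (fun j => Fin.elim0 j) (fun j => Fin.elim0 j)) (fun y hy => ?_)
  · nlinarith
  have hyC : ∀ k, ‖lin X (y k)‖ ^ 2 ≤ C₁ * n := hy.2
  refine (H₂ hnd hn Xᵀ (hXt.trans (by gcongr; linarith)) (fun k => lin X (y k))
    (fun k => (hyC k).trans (by gcongr; linarith))).trans (measureReal_mono fun x hx => ?_)
  refine ⟨fun p => (hx.2 p).trans (by gcongr; linarith),
    fun k => (hyC k).trans (by gcongr; linarith), fun p k => ?_⟩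
  have := hx.1 p k
  change ⟪x p, lin X (y k)⟫_ℝ ^ 2 ≤ _
  rw [real_inner_comm]
  linarith

/-! ### Invariance of training under rescaling -/

variable {r₁ r₂ r₃ n m nd : ℕ}

/-- The task with `X` replaced by `X / s` and the same pre-trained output. -/
def Task.rescale (T : Task n m nd) (s : ℝ) : Task n m nd where
  basis := fun k z => s⁻¹ * T.basis k z
  pretrained := fun p q k => s * T.pretrained p q k
  x := T.x
  y := T.y

/-- The parameters with `U₁` multiplied by `a` and `U₃` multiplied by `b`. -/
def Params.rescale (θ : Params r₁ r₂ r₃ n m nd) (a b : ℝ) : Params r₁ r₂ r₃ n m nd where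
  G := θ.G
  U₁ := fun p => a • θ.U₁ p
  U₂ := θ.U₂
  U₃ := fun k => b • θ.U₃ k

/-- The learning rates for the rescaled parameters. -/
def rescaleRates (η : Fin 4 → ℝ) (a b : ℝ) : Fin 4 → ℝ := ![η 0, a ^ 2 * η 1, η 2, b ^ 2 * η 3]

lemma Params.ext' {θ θ' : Params r₁ r₂ r₃ n m nd} (hG : ∀ p q k, θ.G (p, q, k) = θ'.G (p, q, k))
    (h₁ : ∀ p, θ.U₁ p = θ'.U₁ p) (h₂ : ∀ q, θ.U₂ q = θ'.U₂ q) (h₃ : ∀ k, θ.U₃ k = θ'.U₃ k) :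
    θ = θ' := by
  cases θ
  cases θ'
  rw [Params.mk.injEq]
  exact ⟨funext fun _ => hG _ _ _, funext h₁, funext h₂, funext h₃⟩

section

variable (T : Task n m nd) {a b : ℝ} (ha : a ≠ 0) (hb : b ≠ 0) (θ : Params r₁ r₂ r₃ n m nd)
  (η : Fin 4 → ℝ)

lemma Task.rescale_X (s : ℝ) : (T.rescale s).X = s⁻¹ • T.X := by
  ext p k
  simp [Task.X, Task.rescale]

lemma lin_smul {a b : ℕ} (s : ℝ) (M : Matrix (Fin a) (Fin b) ℝ)
    (w : EuclideanSpace ℝ (Fin b)) : lin (s • M) w = s • lin M w := by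
  simp [lin_apply, Matrix.smul_mulVec]

lemma frob_smul {a b : ℕ} (s : ℝ) (M : Matrix (Fin a) (Fin b) ℝ) :
    frob (s • M) = s ^ 2 * frob M := by
  simp [frob, mul_pow, Finset.mul_sum]

lemma Task.rescale_initialResidual {s : ℝ} (hs : s ≠ 0) :
    (T.rescale s).initialResidual = T.initialResidual := by
  have : (T.rescale s).pretrainedOutput = T.pretrainedOutput := by
    ext q
    simp only [Task.pretrainedOutput, kan, Task.rescale]
    refine Finset.sum_congr rfl fun p _ => Finset.sum_congr rfl fun k _ => ?_
    field_simp
  simp only [Task.initialResidual, this]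
  rfl

include ha hb

lemma Task.rescale_lin (w : EuclideanSpace ℝ (Fin nd)) :
    a • lin (T.rescale (a * b)).X (b • w) = lin T.X w := by
  rw [Task.rescale_X, lin_smul, map_smul, smul_smul, smul_smul]
  have : a * (a * b)⁻¹ * b = 1 := by field_simp
  rw [this, one_smul]

lemma Task.rescale_lin_transpose (u : EuclideanSpace ℝ (Fin n)) :
    b • lin (T.rescale (a * b)).Xᵀ (a • u) = lin T.Xᵀ u := by
  rw [Task.rescale_X, Matrix.transpose_smul, lin_smul, map_smul, smul_smul, smul_smul]
  have : b * (a * b)⁻¹ * a = 1 := by field_simp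
  rw [this, one_smul]

lemma Task.rescale_bil (p : Fin r₁) (k : Fin r₃) :
    (T.rescale (a * b)).bil ((θ.rescale a b).U₁ p) ((θ.rescale a b).U₃ k) =
      T.bil (θ.U₁ p) (θ.U₃ k) := by
  rw [Task.bil_eq, Task.bil_eq, ← T.rescale_lin ha hb, inner_smul_right]
  simp [Params.rescale, inner_smul_left]

lemma Task.rescale_coef (q : Fin r₂) :
    (T.rescale (a * b)).coef (θ.rescale a b) q = T.coef θ q := by
  simp only [Task.coef, T.rescale_bil ha hb]
  rfl

lemma Task.rescale_residual : (T.rescale (a * b)).residual (θ.rescale a b) = T.residual θ := by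
  rw [Task.residual_eq, Task.residual_eq, Task.rescale_initialResidual _ (mul_ne_zero ha hb),
    Task.adapter_eq_sum_coef, Task.adapter_eq_sum_coef]
  simp only [T.rescale_coef ha hb]
  rfl

lemma Task.rescale_contr (p : Fin r₁) (k : Fin r₃) :
    (T.rescale (a * b)).contr (θ.rescale a b) p k = T.contr θ p k := by
  simp only [Task.contr, T.rescale_residual ha hb]
  rfl

/-- Replacing u by a u divides its gradient by a, while the step must be multiplied by a; hence the
factor a² in the rate. The pairings, and with them the residual and the core, are unchanged because
X is divided by a b. -/
lemma Task.rescale_gdStep :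
    (T.rescale (a * b)).gdStep (rescaleRates η a b) (θ.rescale a b) =
      (T.gdStep η θ).rescale a b := by
  refine Params.ext' (fun p q k => ?_) (fun p => ?_) (fun q => ?_) (fun k => ?_)
  · rw [Task.gdStep_G, T.rescale_residual ha hb, T.rescale_bil ha hb]
    exact (T.gdStep_G η θ p q k).symm
  · rw [Task.gdStep_U₁]
    change _ = a • (T.gdStep η θ).U₁ p
    rw [Task.gdStep_U₁, smul_sub]
    congr 1
    simp only [← T.rescale_lin ha hb, T.rescale_contr ha hb, Finset.smul_sum, smul_smul]
    refine Finset.sum_congr rfl fun k _ => ?_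
    congr 1
    simp [rescaleRates]
    ring
  · rw [Task.gdStep_U₂, T.rescale_residual ha hb, T.rescale_coef ha hb]
    exact (T.gdStep_U₂ η θ q).symm
  · rw [Task.gdStep_U₃]
    change _ = b • (T.gdStep η θ).U₃ k
    rw [Task.gdStep_U₃, smul_sub]
    congr 1
    simp only [← T.rescale_lin_transpose ha hb, T.rescale_contr ha hb, Finset.smul_sum, smul_smul]
    refine Finset.sum_congr rfl fun p _ => ?_
    congr 1
    simp [rescaleRates]
    ring

lemma Task.rescale_gd (t : ℕ) :
    (T.rescale (a * b)).gd (rescaleRates η a b) (θ.rescale a b) t = (T.gd η θ t).rescale a b := by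
  induction t with
  | zero => rfl
  | succ t ih => rw [Task.gd_succ, Task.gd_succ, ih, T.rescale_gdStep ha hb]

lemma Task.rescale_delta₀ (p : Fin r₁) (q : Fin r₂) (k : Fin r₃) :
    (T.rescale (a * b)).delta₀ (rescaleRates η a b) (θ.rescale a b) p q k =
      T.delta₀ η θ p q k := by
  rw [Task.delta₀, T.rescale_residual ha hb, T.rescale_bil ha hb]
  rfl

lemma Task.rescale_delta₁ (p : Fin r₁) :
    (T.rescale (a * b)).delta₁ (rescaleRates η a b) (θ.rescale a b) p = T.delta₁ η θ p := by
  rw [Task.delta₁_eq, Task.delta₁_eq]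
  simp only [← T.rescale_lin ha hb, T.rescale_contr ha hb, Finset.smul_sum, smul_smul,
    inner_smul_right, Finset.mul_sum, sum_inner, inner_smul_left]
  refine Finset.sum_congr rfl fun q _ => ?_
  congr 1
  refine Finset.sum_congr rfl fun k _ => Finset.sum_congr rfl fun k' _ => ?_
  simp [rescaleRates, Params.rescale]
  ring

lemma Task.rescale_delta₂ (q : Fin r₂) :
    (T.rescale (a * b)).delta₂ (rescaleRates η a b) (θ.rescale a b) q = T.delta₂ η θ q := by
  rw [Task.delta₂_eq, Task.delta₂_eq, T.rescale_residual ha hb, T.rescale_coef ha hb]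
  rfl

lemma Task.rescale_delta₃ (k : Fin r₃) :
    (T.rescale (a * b)).delta₃ (rescaleRates η a b) (θ.rescale a b) k = T.delta₃ η θ k := by
  rw [Task.delta₃_eq, Task.delta₃_eq]
  simp only [← T.rescale_lin_transpose ha hb, T.rescale_contr ha hb, Finset.smul_sum, smul_smul,
    inner_smul_right, Finset.mul_sum, sum_inner, inner_smul_left]
  refine Finset.sum_congr rfl fun q _ => ?_
  congr 1
  refine Finset.sum_congr rfl fun k _ => Finset.sum_congr rfl fun k' _ => ?_
  simp [rescaleRates, Params.rescale]
  ring

end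

/-! ### Uniform bounds along the normalized dynamics -/

section VecBigO

variable {κ : Type*} {L : Filter κ} {E : κ → Type*} [∀ z, NormedAddCommGroup (E z)]

/-- Big-O for families of vectors in varying spaces. -/
def VecBigO (L : Filter κ) (f : ∀ z, E z) (g : κ → ℝ) : Prop := (fun z => ‖f z‖) =O[L] g

namespace VecBigO

variable {f f' : ∀ z, E z} {g g' : κ → ℝ} {c : κ → ℝ}

lemma trans (hf : VecBigO L f g) (h : g =O[L] g') : VecBigO L f g' := IsBigO.trans hf h

lemma of_norm_le {h : κ → ℝ} (hle : ∀ᶠ z in L, ‖f z‖ ≤ h z) (hh : h =O[L] g) : VecBigO L f g := by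
  refine IsBigO.trans (IsBigO.of_bound 1 ?_) hh
  filter_upwards [hle] with z hz
  rw [norm_norm, one_mul]
  exact hz.trans (le_abs_self _)

lemma add (hf : VecBigO L f g) (hf' : VecBigO L f' g) : VecBigO L (fun z => f z + f' z) g :=
  of_norm_le (.of_forall fun _ => norm_add_le _ _) (IsBigO.add hf hf')

lemma sub (hf : VecBigO L f g) (hf' : VecBigO L f' g) : VecBigO L (fun z => f z - f' z) g :=
  of_norm_le (.of_forall fun _ => norm_sub_le _ _) (IsBigO.add hf hf')

lemma zero : VecBigO L (fun z => (0 : E z)) g := by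
  simp only [VecBigO, norm_zero]
  exact isBigO_zero _ _

lemma sum {ι : Type*} (s : Finset ι) {f : ι → ∀ z, E z} (hf : ∀ i ∈ s, VecBigO L (f i) g) :
    VecBigO L (fun z => ∑ i ∈ s, f i z) g :=
  of_norm_le (.of_forall fun _ => norm_sum_le _ _) (IsBigO.fun_sum hf)

variable [∀ z, InnerProductSpace ℝ (E z)]

lemma smul (hc : c =O[L] g) (hf : VecBigO L f g') : VecBigO L (fun z => c z • f z) (g * g') := by
  have h : (fun z => ‖c z‖ * ‖f z‖) =O[L] (g * g') := hc.norm_left.mul hf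
  exact of_norm_le (.of_forall fun _ => (norm_smul _ _).le) h

lemma inner (hf : VecBigO L f g) (hf' : VecBigO L f' g') :
    (fun z => ⟪f z, f' z⟫_ℝ) =O[L] (g * g') := by
  refine IsBigO.trans (IsBigO.of_bound 1 ?_) (IsBigO.mul hf hf')
  refine .of_forall fun z => ?_
  rw [one_mul, norm_mul, norm_norm, norm_norm]
  exact norm_inner_le_norm _ _

end VecBigO

end VecBigO

lemma isBigO_mul_one {κ : Type*} {L : Filter κ} {f g h : κ → ℝ} (hf : f =O[L] (g * h))
    (hh : h =O[L] (1 : κ → ℝ)) : f =O[L] g :=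
  hf.trans (((isBigO_refl g L).mul hh).trans (by simpa using isBigO_refl g L))

lemma isBigO_one_mul {κ : Type*} {L : Filter κ} {f g h : κ → ℝ} (hf : f =O[L] (g * h))
    (hg : g =O[L] (1 : κ → ℝ)) : f =O[L] h :=
  isBigO_mul_one (mul_comm g h ▸ hf) hg

section Dynamics

variable {r₁ r₂ r₃ : ℕ} {κ : Type*} {L : Filter κ} {n m nd : κ → ℕ}

lemma VecBigO.lin {a b : κ → ℕ} {M : ∀ z, Matrix (Fin (a z)) (Fin (b z)) ℝ}
    {f : ∀ z, EuclideanSpace ℝ (Fin (b z))} {g : κ → ℝ}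
    (hM : (fun z => frob (M z)) =O[L] (1 : κ → ℝ)) (hf : VecBigO L f g) :
    VecBigO L (fun z => LoTRA.lin (M z) (f z)) g := by
  have h1 : (fun z => frob (M z) * ‖f z‖ ^ 2) =O[L] fun z => g z ^ 2 := by
    have := hM.mul (IsBigO.pow hf 2)
    simpa using this
  have h2 : (fun z => ‖LoTRA.lin (M z) (f z)‖ ^ 2) =O[L] fun z => g z ^ 2 := by
    refine IsBigO.trans (IsBigO.of_bound 1 (.of_forall fun z => ?_)) h1
    rw [one_mul, norm_pow, norm_norm]
    exact (norm_lin_sq_le _ _).trans (le_abs_self _)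
  exact IsBigO.of_pow two_ne_zero h2

/-- Uniform bounds at initialization for a family of normalized models; the pairings of the
columns are of order `s`. -/
structure Regular (L : Filter κ) (T : ∀ z, Task (n z) (m z) (nd z)) (η : κ → Fin 4 → ℝ)
    (θ : ∀ z, Params r₁ r₂ r₃ (n z) (m z) (nd z)) (s : κ → ℝ) : Prop where
  scale : s =O[L] (1 : κ → ℝ)
  G : ∀ z j, (θ z).G j = 0
  frob : (fun z => frob (T z).X) =O[L] (1 : κ → ℝ)
  rate : ∀ j, (fun z => η z j) =O[L] (1 : κ → ℝ)
  res : VecBigO L (fun z => (T z).initialResidual) 1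
  U₂ : ∀ q, VecBigO L (fun z => (θ z).U₂ q) 1
  lin_U₁ : ∀ p, VecBigO L (fun z => lin (T z).Xᵀ ((θ z).U₁ p)) 1
  lin_U₃ : ∀ k, VecBigO L (fun z => lin (T z).X ((θ z).U₃ k)) 1
  bil : ∀ p k, (fun z => (T z).bil ((θ z).U₁ p) ((θ z).U₃ k)) =O[L] s

/-- The parameters `θ'` are a perturbation of order `s` of the initial parameters `θ`. -/
structure Near (L : Filter κ) (θ θ' : ∀ z, Params r₁ r₂ r₃ (n z) (m z) (nd z)) (s : κ → ℝ) :
    Prop where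
  G : ∀ j, (fun z => (θ' z).G j) =O[L] s
  U₁ : ∀ p, VecBigO L (fun z => (θ' z).U₁ p - (θ z).U₁ p) s
  -- Second order: the gradient for `U₂` is `coef` times the residual, and `coef` is a sum of
  -- products of a core entry and a pairing, each of order s.
  U₂ : ∀ q, VecBigO L (fun z => (θ' z).U₂ q - (θ z).U₂ q) (s * s)
  U₃ : ∀ k, VecBigO L (fun z => (θ' z).U₃ k - (θ z).U₃ k) s

namespace Near

variable {T : ∀ z, Task (n z) (m z) (nd z)} {η : κ → Fin 4 → ℝ}
  {θ θ' : ∀ z, Params r₁ r₂ r₃ (n z) (m z) (nd z)} {s : κ → ℝ}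

lemma sq_le (hR : Regular L T η θ s) : (s * s) =O[L] s :=
  isBigO_mul_one (isBigO_refl _ _) hR.scale

lemma sq_one (hR : Regular L T η θ s) : (s * s) =O[L] (1 : κ → ℝ) := (sq_le hR).trans hR.scale

lemma frob_transpose (hR : Regular L T η θ s) :
    (fun z => LoTRA.frob (T z).Xᵀ) =O[L] (1 : κ → ℝ) := by
  simpa only [LoTRA.frob_transpose] using hR.frob

lemma lin_U₃_sub (hR : Regular L T η θ s) (h : Near L θ θ' s) (k : Fin r₃) :
    VecBigO L (fun z => lin (T z).X ((θ' z).U₃ k) - lin (T z).X ((θ z).U₃ k)) s := by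
  simpa only [map_sub] using (h.U₃ k).lin hR.frob

lemma lin_U₁_sub (hR : Regular L T η θ s) (h : Near L θ θ' s) (p : Fin r₁) :
    VecBigO L (fun z => lin (T z).Xᵀ ((θ' z).U₁ p) - lin (T z).Xᵀ ((θ z).U₁ p)) s := by
  simpa only [map_sub] using (h.U₁ p).lin (frob_transpose hR)

lemma lin_U₃ (hR : Regular L T η θ s) (h : Near L θ θ' s) (k : Fin r₃) :
    VecBigO L (fun z => lin (T z).X ((θ' z).U₃ k)) 1 := by
  simpa using ((h.lin_U₃_sub hR k).trans hR.scale).add (hR.lin_U₃ k)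

lemma lin_U₁ (hR : Regular L T η θ s) (h : Near L θ θ' s) (p : Fin r₁) :
    VecBigO L (fun z => lin (T z).Xᵀ ((θ' z).U₁ p)) 1 := by
  simpa using ((h.lin_U₁_sub hR p).trans hR.scale).add (hR.lin_U₁ p)

lemma norm_U₂ (hR : Regular L T η θ s) (h : Near L θ θ' s) (q : Fin r₂) :
    VecBigO L (fun z => (θ' z).U₂ q) 1 := by
  simpa using ((h.U₂ q).trans (sq_one hR)).add (hR.U₂ q)

lemma bil (hR : Regular L T η θ s) (h : Near L θ θ' s) (p : Fin r₁) (k : Fin r₃) :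
    (fun z => (T z).bil ((θ' z).U₁ p) ((θ' z).U₃ k)) =O[L] s := by
  have e : (fun z => (T z).bil ((θ' z).U₁ p) ((θ' z).U₃ k)) = fun z =>
      ⟪(θ' z).U₁ p - (θ z).U₁ p, lin (T z).X ((θ' z).U₃ k)⟫_ℝ +
      ⟪lin (T z).Xᵀ ((θ z).U₁ p), (θ' z).U₃ k - (θ z).U₃ k⟫_ℝ +
      (T z).bil ((θ z).U₁ p) ((θ z).U₃ k) := by
    ext z
    rw [Task.bil_eq, Task.bil_eq, inner_lin_transpose, map_sub, inner_sub_left, inner_sub_right]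
    ring
  rw [e]
  refine IsBigO.add (IsBigO.add ?_ ?_) (hR.bil p k)
  · exact isBigO_mul_one ((h.U₁ p).inner (h.lin_U₃ hR k)) (isBigO_refl _ _)
  · exact isBigO_one_mul ((hR.lin_U₁ p).inner (h.U₃ k)) (isBigO_refl _ _)

lemma coef (hR : Regular L T η θ s) (h : Near L θ θ' s) (q : Fin r₂) :
    (fun z => (T z).coef (θ' z) q) =O[L] (s * s) :=
  IsBigO.fun_sum fun p _ => IsBigO.fun_sum fun k _ => (h.G _).mul (h.bil hR p k)

lemma residual_sub (hR : Regular L T η θ s) (h : Near L θ θ' s) :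
    VecBigO L (fun z => (T z).residual (θ' z) - (T z).initialResidual) (s * s) := by
  simp only [Task.residual_eq, Task.adapter_eq_sum_coef, add_sub_cancel_left]
  exact VecBigO.sum _ fun q _ =>
    ((VecBigO.smul (h.coef hR q) (h.norm_U₂ hR q)).trans (by simpa using isBigO_refl (s * s) L))

lemma residual (hR : Regular L T η θ s) (h : Near L θ θ' s) :
    VecBigO L (fun z => (T z).residual (θ' z)) 1 := by
  simpa using ((h.residual_sub hR).trans (sq_one hR)).add hR.res

lemma inner_residual_sub (hR : Regular L T η θ s) (h : Near L θ θ' s) (q : Fin r₂) :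
    (fun z => ⟪(T z).residual (θ' z), (θ' z).U₂ q⟫_ℝ - ⟪(T z).initialResidual, (θ z).U₂ q⟫_ℝ)
      =O[L] (s * s) := by
  have e : (fun z => ⟪(T z).residual (θ' z), (θ' z).U₂ q⟫_ℝ -
      ⟪(T z).initialResidual, (θ z).U₂ q⟫_ℝ) = fun z =>
      ⟪(T z).residual (θ' z) - (T z).initialResidual, (θ' z).U₂ q⟫_ℝ +
      ⟪(T z).initialResidual, (θ' z).U₂ q - (θ z).U₂ q⟫_ℝ := by
    ext z
    rw [inner_sub_left, inner_sub_right]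
    ring
  rw [e]
  exact (isBigO_mul_one ((h.residual_sub hR).inner (h.norm_U₂ hR q)) (isBigO_refl _ _)).add
    (isBigO_one_mul (hR.res.inner (h.U₂ q)) (isBigO_refl _ _))

lemma inner_residual (hR : Regular L T η θ s) (h : Near L θ θ' s) (q : Fin r₂) :
    (fun z => ⟪(T z).residual (θ' z), (θ' z).U₂ q⟫_ℝ) =O[L] (1 : κ → ℝ) :=
  isBigO_one_mul ((h.residual hR).inner (h.norm_U₂ hR q)) (isBigO_refl _ _)

lemma contr (hR : Regular L T η θ s) (h : Near L θ θ' s) (p : Fin r₁) (k : Fin r₃) :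
    (fun z => (T z).contr (θ' z) p k) =O[L] s :=
  IsBigO.fun_sum fun q _ => isBigO_mul_one ((h.G _).mul (h.inner_residual hR q)) (isBigO_refl _ _)

lemma sum_contr_U₃ (hR : Regular L T η θ s) (h : Near L θ θ' s) (p : Fin r₁) :
    VecBigO L (fun z => ∑ k, (T z).contr (θ' z) p k • lin (T z).X ((θ' z).U₃ k)) s :=
  VecBigO.sum _ fun k _ => (VecBigO.smul (h.contr hR p k) (h.lin_U₃ hR k)).trans
    (by simpa using isBigO_refl s L)

lemma sum_contr_U₁ (hR : Regular L T η θ s) (h : Near L θ θ' s) (k : Fin r₃) :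
    VecBigO L (fun z => ∑ p, (T z).contr (θ' z) p k • lin (T z).Xᵀ ((θ' z).U₁ p)) s :=
  VecBigO.sum _ fun p _ => (VecBigO.smul (h.contr hR p k) (h.lin_U₁ hR p)).trans
    (by simpa using isBigO_refl s L)

/-- The core moves by a rate times a bounded pairing with the residual times a pairing of order s;
`U₁` and `U₃` move by `contr`, of order s, times bounded vectors. The implied constants grow with
the number of steps, which is harmless since that number is fixed. -/
lemma step (hR : Regular L T η θ s) (h : Near L θ θ' s) :
    Near L θ (fun z => (T z).gdStep (η z) (θ' z)) s where
  G := by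
    rintro ⟨p, q, k⟩
    simp only [Task.gdStep_G]
    refine (h.G _).sub ?_
    exact isBigO_one_mul ((hR.rate 0).mul
      (isBigO_one_mul ((h.inner_residual hR q).mul (h.bil hR p k)) (isBigO_refl _ _)))
      (isBigO_refl _ _)
  U₁ := by
    intro p
    simp only [Task.gdStep_U₁, sub_right_comm _ _ ((θ _).U₁ p)]
    exact (h.U₁ p).sub ((VecBigO.smul (hR.rate 1) (h.sum_contr_U₃ hR p)).trans
      (by simpa using isBigO_refl s L))
  U₂ := by
    intro q
    simp only [Task.gdStep_U₂, sub_right_comm _ _ ((θ _).U₂ q)]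
    refine (h.U₂ q).sub ((VecBigO.smul (hR.rate 2) (VecBigO.smul (h.coef hR q)
      (h.residual hR))).trans (by simpa using isBigO_refl (s * s) L))
  U₃ := by
    intro k
    simp only [Task.gdStep_U₃, sub_right_comm _ _ ((θ _).U₃ k)]
    exact (h.U₃ k).sub ((VecBigO.smul (hR.rate 3) (h.sum_contr_U₁ hR k)).trans
      (by simpa using isBigO_refl s L))

end Near

variable {T : ∀ z, Task (n z) (m z) (nd z)} {η : κ → Fin 4 → ℝ}
  {θ : ∀ z, Params r₁ r₂ r₃ (n z) (m z) (nd z)} {s : κ → ℝ}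

lemma Regular.near (hR : Regular L T η θ s) (t : ℕ) :
    Near L θ (fun z => (T z).gd (η z) (θ z) t) s := by
  induction t with
  | zero =>
    simp only [Task.gd_zero]
    refine ⟨fun j => ?_, fun p => ?_, fun q => ?_, fun k => ?_⟩
    · simp only [hR.G]
      exact isBigO_zero _ _
    all_goals
      simp only [sub_self]
      exact VecBigO.zero
  | succ t ih =>
    simp only [Task.gd_succ]
    exact ih.step hR

namespace Near

variable {θ' : ∀ z, Params r₁ r₂ r₃ (n z) (m z) (nd z)}

lemma delta₀ (hR : Regular L T η θ s) (h : Near L θ θ' s) (p : Fin r₁) (q : Fin r₂) (k : Fin r₃) :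
    VecBigO L (fun z => (T z).delta₀ (η z) (θ' z) p q k) 1 := by
  have h1 := ((hR.rate 0).mul (h.inner_residual hR q)).mul (((h.bil hR p k).trans hR.scale).pow 2)
  simp only [Task.delta₀]
  exact (VecBigO.smul h1.neg_left (h.norm_U₂ hR q)).trans
    (IsBigO.of_bound 1 (.of_forall fun _ => by simp))

lemma delta₁ (hR : Regular L T η θ s) (h : Near L θ θ' s) (p : Fin r₁) :
    VecBigO L (fun z => (T z).delta₁ (η z) (θ' z) p) 1 := by
  simp only [Task.delta₁_eq]
  refine (VecBigO.smul (g := 1) (g' := 1) (hR.rate 1).neg_left (VecBigO.sum _ fun q _ => ?_)).trans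
    (by simpa using isBigO_refl (1 : κ → ℝ) L)
  refine (VecBigO.smul (g := 1) (g' := 1) (IsBigO.fun_sum fun k _ => ?_) (h.norm_U₂ hR q)).trans
    (by simpa using isBigO_refl (1 : κ → ℝ) L)
  have := ((h.G (p, q, k)).trans hR.scale).mul
    (((h.sum_contr_U₃ hR p).trans hR.scale).inner (h.lin_U₃ hR k))
  exact this.trans (IsBigO.of_bound 1 (.of_forall fun _ => by simp))

lemma delta₂ (hR : Regular L T η θ s) (h : Near L θ θ' s) (q : Fin r₂) :
    VecBigO L (fun z => (T z).delta₂ (η z) (θ' z) q) 1 := by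
  have h1 := (hR.rate 2).mul (((h.coef hR q).trans (sq_one hR)).pow 2)
  simp only [Task.delta₂_eq]
  exact (VecBigO.smul h1.neg_left (h.residual hR)).trans
    (IsBigO.of_bound 1 (.of_forall fun _ => by simp))

lemma delta₃ (hR : Regular L T η θ s) (h : Near L θ θ' s) (k : Fin r₃) :
    VecBigO L (fun z => (T z).delta₃ (η z) (θ' z) k) 1 := by
  simp only [Task.delta₃_eq]
  refine (VecBigO.smul (g := 1) (g' := 1) (hR.rate 3).neg_left (VecBigO.sum _ fun q _ => ?_)).trans
    (by simpa using isBigO_refl (1 : κ → ℝ) L)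
  refine (VecBigO.smul (g := 1) (g' := 1) (IsBigO.fun_sum fun p _ => ?_) (h.norm_U₂ hR q)).trans
    (by simpa using isBigO_refl (1 : κ → ℝ) L)
  have := ((h.G (p, q, k)).trans hR.scale).mul
    (((h.sum_contr_U₁ hR k).trans hR.scale).inner (h.lin_U₁ hR p))
  exact this.trans (IsBigO.of_bound 1 (.of_forall fun _ => by simp))

end Near

end Dynamics

/-! ### Positivity in the linear leading-order model -/

/-- The product `Mᵀ P M Q` has nonnegative trace for positive semidefinite `P` and `Q`. -/
lemma trace_transpose_mul_mul_mul_nonneg {r r' : ℕ} {P : Matrix (Fin r) (Fin r) ℝ}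
    {Q : Matrix (Fin r') (Fin r') ℝ} (hP : P.PosSemidef) (hQ : Q.PosSemidef)
    (M : Matrix (Fin r) (Fin r') ℝ) : 0 ≤ (Mᵀ * (P * M * Q)).trace := by
  obtain ⟨S, rfl⟩ : ∃ S : Matrix (Fin r') (Fin r') ℝ, Q = Sᴴ * S := by
    open scoped MatrixOrder in
    exact CStarAlgebra.nonneg_iff_eq_star_mul_self.1 hQ.nonneg
  have h := (hP.conjTranspose_mul_mul_same M).mul_mul_conjTranspose_same S
  have e : (Mᵀ * (P * M * (Sᴴ * S))).trace = (S * (Mᴴ * P * M) * Sᴴ).trace := by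
    rw [Matrix.trace_mul_comm (S * _), ← Matrix.mul_assoc Sᴴ, Matrix.trace_mul_comm (Sᴴ * S)]
    simp only [Matrix.mul_assoc, Matrix.conjTranspose_eq_transpose_of_trivial]
  rw [e]
  exact h.trace_nonneg

/-- The leading-order dynamics of the matrix of pairings and of the contracted core. -/
def model {r r' : ℕ} (a b e : ℝ) (P : Matrix (Fin r) (Fin r) ℝ) (Q : Matrix (Fin r') (Fin r') ℝ)
    (B : Matrix (Fin r) (Fin r') ℝ) : ℕ → Matrix (Fin r) (Fin r') ℝ × Matrix (Fin r) (Fin r') ℝ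
  | 0 => (B, 0)
  | t + 1 => ((model a b e P Q B t).1 + a • ((model a b e P Q B t).2 * Q) +
      b • (P * (model a b e P Q B t).2), (model a b e P Q B t).2 + e • (model a b e P Q B t).1)

section Model

variable {r r' : ℕ} {a b e x : ℝ} {P : Matrix (Fin r) (Fin r) ℝ} {Q : Matrix (Fin r') (Fin r') ℝ}
  {p : Fin r} {k : Fin r'}

lemma pow_mul_model_fst_mul_pow (B : Matrix (Fin r) (Fin r') ℝ) (t i j : ℕ) :
    P ^ i * (model a b e P Q B (t + 1)).1 * Q ^ j = P ^ i * (model a b e P Q B t).1 * Q ^ j +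
      a • (P ^ i * (model a b e P Q B t).2 * Q ^ (j + 1)) +
      b • (P ^ (i + 1) * (model a b e P Q B t).2 * Q ^ j) := by
  simp only [model, Matrix.mul_smul, Matrix.smul_mul, pow_succ' Q, pow_succ P,
    Matrix.mul_assoc, Matrix.mul_add, Matrix.add_mul]

lemma pow_mul_model_snd_mul_pow (B : Matrix (Fin r) (Fin r') ℝ) (t i j : ℕ) :
    P ^ i * (model a b e P Q B (t + 1)).2 * Q ^ j = P ^ i * (model a b e P Q B t).2 * Q ^ j +
      e • (P ^ i * (model a b e P Q B t).1 * Q ^ j) := by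
  simp only [model, Matrix.mul_add, Matrix.add_mul, Matrix.mul_smul, Matrix.smul_mul]

/-- Positive semidefinite matrices may have negative entries, so entrywise positivity of the model
fails. The entry at `(p, k)` of all `P ^ i * M * Q ^ j` is stable: the recursion only raises the
exponents with nonnegative coefficients, and at time zero the entry is x times diagonal entries of
powers of P and Q. -/
lemma model_entry_nonneg (ha : 0 ≤ a) (hb : 0 ≤ b) (he : 0 ≤ e) (hx : 0 ≤ x)
    (hP : P.PosSemidef) (hQ : Q.PosSemidef) (t : ℕ) : ∀ i j : ℕ,
    0 ≤ (P ^ i * (model a b e P Q (Matrix.single p k x) t).1 * Q ^ j) p k ∧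
    0 ≤ (P ^ i * (model a b e P Q (Matrix.single p k x) t).2 * Q ^ j) p k := by
  induction t with
  | zero =>
    intro i j
    have h : (P ^ i * Matrix.single p k x * Q ^ j) p k = (P ^ i) p p * x * (Q ^ j) k k := by
      rw [Matrix.mul_assoc, Matrix.mul_apply, Finset.sum_eq_single p]
      · rw [Matrix.single_mul_apply_same, mul_assoc]
      · intro q _ hq
        rw [Matrix.single_mul_apply_of_ne _ _ _ _ _ hq, mul_zero]
      · simp
    refine ⟨?_, by simp [model]⟩
    simp only [model]
    rw [h]
    exact mul_nonneg (mul_nonneg (hP.pow i).diag_nonneg hx) (hQ.pow j).diag_nonneg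
  | succ t ih =>
    intro i j
    rw [pow_mul_model_fst_mul_pow, pow_mul_model_snd_mul_pow]
    simp only [Matrix.add_apply, Matrix.smul_apply, smul_eq_mul]
    exact ⟨add_nonneg (add_nonneg (ih i j).1 (mul_nonneg ha (ih i (j + 1)).2))
      (mul_nonneg hb (ih (i + 1) j).2), add_nonneg (ih i j).2 (mul_nonneg he (ih i j).1)⟩

/-- With Γ and B the two components, expanding one step of tr(Γᵀ P^i B Q^j) gives traces of the same
kind at the previous time and squares tr(Mᵀ P^i M Q^j), all with nonnegative coefficients. Allowing
all exponents closes the induction. -/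
lemma model_trace_nonneg (ha : 0 ≤ a) (hb : 0 ≤ b) (he : 0 ≤ e)
    (hP : P.PosSemidef) (hQ : Q.PosSemidef) (B : Matrix (Fin r) (Fin r') ℝ) (t : ℕ) : ∀ i j : ℕ,
    0 ≤ ((model a b e P Q B t).2ᵀ * (P ^ i * (model a b e P Q B t).1 * Q ^ j)).trace := by
  have hsymm : ∀ (M N : Matrix (Fin r) (Fin r') ℝ) (i j : ℕ),
      (Mᵀ * (P ^ i * N * Q ^ j)).trace = (Nᵀ * (P ^ i * M * Q ^ j)).trace := by
    intro M N i j
    have h1 : (P ^ i)ᵀ = P ^ i := (hP.pow i).1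
    have h2 : (Q ^ j)ᵀ = Q ^ j := (hQ.pow j).1
    rw [← Matrix.trace_transpose, Matrix.transpose_mul, Matrix.transpose_mul, Matrix.transpose_mul,
      Matrix.transpose_transpose, h1, h2, Matrix.mul_assoc, Matrix.trace_mul_comm]
    simp only [Matrix.mul_assoc]
  have hsq : ∀ (M : Matrix (Fin r) (Fin r') ℝ) (i j : ℕ),
      0 ≤ (Mᵀ * (P ^ i * M * Q ^ j)).trace := fun M i j =>
    trace_transpose_mul_mul_mul_nonneg (hP.pow i) (hQ.pow j) M
  induction t with
  | zero => simp [model]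
  | succ t ih =>
    intro i j
    rw [pow_mul_model_fst_mul_pow]
    simp only [model, Matrix.transpose_add, Matrix.transpose_smul, Matrix.mul_add, Matrix.add_mul,
      Matrix.trace_add, Matrix.smul_mul, Matrix.mul_smul, Matrix.trace_smul, smul_eq_mul]
    rw [hsymm (model a b e P Q B t).1 (model a b e P Q B t).2 i (j + 1),
      hsymm (model a b e P Q B t).1 (model a b e P Q B t).2 (i + 1) j]
    have h1 := ih i j
    have h2 := ih i (j + 1)
    have h3 := ih (i + 1) j
    have h4 := hsq (model a b e P Q B t).2 i (j + 1)
    have h5 := hsq (model a b e P Q B t).2 (i + 1) j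
    have h6 := hsq (model a b e P Q B t).1 i j
    exact add_nonneg (add_nonneg (add_nonneg h1 (mul_nonneg he h6))
      (mul_nonneg ha (add_nonneg h4 (mul_nonneg he h2))))
      (mul_nonneg hb (add_nonneg h5 (mul_nonneg he h3)))

lemma le_model_fst (ha : 0 ≤ a) (hb : 0 ≤ b) (he : 0 ≤ e) (hx : 0 ≤ x)
    (hP : P.PosSemidef) (hQ : Q.PosSemidef) (t : ℕ) :
    x ≤ (model a b e P Q (Matrix.single p k x) t).1 p k := by
  induction t with
  | zero => simp [model]
  | succ t ih =>
    have h1 := (model_entry_nonneg (p := p) (k := k) ha hb he hx hP hQ t 0 1).2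
    have h2 := (model_entry_nonneg (p := p) (k := k) ha hb he hx hP hQ t 1 0).2
    simp only [pow_zero, pow_one, Matrix.one_mul, Matrix.mul_one] at h1 h2
    simp only [model, Matrix.add_apply, Matrix.smul_apply, smul_eq_mul]
    have := mul_nonneg ha h1
    have := mul_nonneg hb h2
    linarith

lemma le_model_snd_mul (ha : 0 ≤ a) (hb : 0 ≤ b) (he : 0 ≤ e) (hx : 0 ≤ x)
    (hP : P.PosSemidef) (hQ : Q.PosSemidef) (t : ℕ) :
    e * (x * Q k k) ≤ ((model a b e P Q (Matrix.single p k x) (t + 1)).2 * Q) p k := by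
  induction t with
  | zero => simp [model, mul_assoc]
  | succ t ih =>
    have h1 := (model_entry_nonneg (p := p) (k := k) ha hb he hx hP hQ (t + 1) 0 1).1
    have h2 := pow_mul_model_snd_mul_pow (a := a) (b := b) (e := e) (P := P) (Q := Q)
      (Matrix.single p k x) (t + 1) 0 1
    simp only [pow_zero, pow_one, Matrix.one_mul] at h1 h2
    rw [h2]
    simp only [Matrix.add_apply, Matrix.smul_apply, smul_eq_mul]
    have := mul_nonneg he h1
    linarith

lemma le_mul_model_snd (ha : 0 ≤ a) (hb : 0 ≤ b) (he : 0 ≤ e) (hx : 0 ≤ x)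
    (hP : P.PosSemidef) (hQ : Q.PosSemidef) (t : ℕ) :
    e * (x * P p p) ≤ (P * (model a b e P Q (Matrix.single p k x) (t + 1)).2) p k := by
  induction t with
  | zero => exact le_of_eq (by simp [model]; ring)
  | succ t ih =>
    have h1 := (model_entry_nonneg (p := p) (k := k) ha hb he hx hP hQ (t + 1) 1 0).1
    have h2 := pow_mul_model_snd_mul_pow (a := a) (b := b) (e := e) (P := P) (Q := Q)
      (Matrix.single p k x) (t + 1) 1 0
    simp only [pow_zero, pow_one, Matrix.mul_one] at h1 h2
    rw [h2]
    simp only [Matrix.add_apply, Matrix.smul_apply, smul_eq_mul]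
    have := mul_nonneg he h1
    linarith

/-- Among the nonnegative traces that arise when the last step is expanded is e tr(BᵀB), and B has
an entry at least x. The time is `t + 1` because the second component vanishes at time zero. -/
lemma le_model_trace (ha : 0 ≤ a) (hb : 0 ≤ b) (he : 0 ≤ e) (hx : 0 ≤ x)
    (hP : P.PosSemidef) (hQ : Q.PosSemidef) (t : ℕ) :
    e * x ^ 2 ≤ ∑ p', ∑ k', (model a b e P Q (Matrix.single p k x) (t + 1)).2 p' k' *
      (model a b e P Q (Matrix.single p k x) (t + 1)).1 p' k' := by
  set M := model a b e P Q (Matrix.single p k x) t with hM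
  have htr : ∀ A B : Matrix (Fin r) (Fin r') ℝ,
      ∑ p', ∑ k', A p' k' * B p' k' = (Aᵀ * B).trace := by
    intro A B
    rw [Finset.sum_comm]
    simp [Matrix.trace, Matrix.mul_apply]
  have hsymm : ∀ A B : Matrix (Fin r) (Fin r') ℝ, (Aᵀ * B).trace = (Bᵀ * A).trace := by
    intro A B
    simp only [← htr, mul_comm]
  have h1 := model_trace_nonneg ha hb he hP hQ (Matrix.single p k x) t
  have h2 := h1 0 0
  have h3 := h1 0 1
  have h4 := h1 1 0
  have h5 := trace_transpose_mul_mul_mul_nonneg (hP.pow 0) hQ M.2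
  have h6 := trace_transpose_mul_mul_mul_nonneg hP (hQ.pow 0) M.2
  have hid : M.1ᵀ * (M.2 * Q) = M.1ᵀ * M.2 * Q := (Matrix.mul_assoc _ _ _).symm
  have hs1 : (M.1ᵀ * (M.2 * Q)).trace = (M.2ᵀ * (M.1 * Q)).trace := by
    have hq : Qᵀ = Q := hQ.1
    rw [hsymm, Matrix.transpose_mul, hq, Matrix.mul_assoc, Matrix.trace_mul_comm, Matrix.mul_assoc]
  have hs2 : (M.1ᵀ * (P * M.2)).trace = (M.2ᵀ * (P * M.1)).trace := by
    have hp : Pᵀ = P := hP.1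
    rw [hsymm, Matrix.transpose_mul, hp, Matrix.mul_assoc]
  have h7 : x ^ 2 ≤ (M.1ᵀ * M.1).trace := by
    rw [← htr]
    have hx' := le_model_fst (p := p) (k := k) ha hb he hx hP hQ t
    calc x ^ 2 ≤ M.1 p k * M.1 p k := by rw [sq]; exact mul_self_le_mul_self hx hx'
      _ ≤ ∑ k', M.1 p k' * M.1 p k' :=
        Finset.single_le_sum (f := fun k' => M.1 p k' * M.1 p k')
          (fun _ _ => mul_self_nonneg _) (Finset.mem_univ k)
      _ ≤ _ := Finset.single_le_sum (f := fun p' => ∑ k', M.1 p' k' * M.1 p' k')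
          (fun _ _ => Finset.sum_nonneg fun _ _ => mul_self_nonneg _) (Finset.mem_univ p)
  rw [htr]
  simp only [← hM, pow_zero, pow_one, Matrix.one_mul, Matrix.mul_one] at h2 h3 h4 h5 h6
  simp only [model, ← hM, Matrix.transpose_add, Matrix.transpose_smul, Matrix.mul_add,
    Matrix.add_mul, Matrix.trace_add, Matrix.smul_mul, Matrix.mul_smul, Matrix.trace_smul,
    smul_eq_mul, hs1, hs2]
  have h8 := mul_le_mul_of_nonneg_left h7 he
  have : 0 ≤ a * (M.2ᵀ * (M.2 * Q)).trace := by positivity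
  have : 0 ≤ b * (M.2ᵀ * (P * M.2)).trace := by positivity
  have : 0 ≤ e * (a * (M.2ᵀ * (M.1 * Q)).trace) := by positivity
  have : 0 ≤ e * (b * (M.2ᵀ * (P * M.1)).trace) := by positivity
  nlinarith

end Model

/-! ### Comparison of training with the model -/

lemma isBigO_bounded_mul {κ : Type*} {L : Filter κ} {c f g : κ → ℝ} (hc : c =O[L] (1 : κ → ℝ))
    (hf : f =O[L] g) : (fun z => c z * f z) =O[L] g :=
  isBigO_one_mul (hc.mul hf) (isBigO_refl (1 : κ → ℝ) L)

/-- A lower bound for `f'` passes to `f` if `f` and `f'` differ by a smaller order. -/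
lemma isBigO_of_isBigO_of_sub {κ : Type*} {L : Filter κ} {f f' g h : κ → ℝ} (hg : g =O[L] f')
    (hf : (fun z => f z - f' z) =O[L] h) (hh : h =o[L] g) : g =O[L] f := by
  have := ((hf.trans_isLittleO hh).trans_isBigO hg).right_isBigO_add
  simp only [sub_add_cancel] at this
  exact hg.trans this

/-- The pairing of the initial residual with the column `q` of the initial `U₂`. -/
def Task.pairing {r₁ r₂ r₃ n m nd : ℕ} (T : Task n m nd) (θ : Params r₁ r₂ r₃ n m nd)
    (q : Fin r₂) : ℝ :=
  ⟪T.initialResidual, θ.U₂ q⟫_ℝ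

/-- The sum of the squared pairings. -/
def Task.strength {r₁ r₂ r₃ n m nd : ℕ} (T : Task n m nd) (θ : Params r₁ r₂ r₃ n m nd) : ℝ :=
  ∑ q, T.pairing θ q ^ 2

/-- The leading-order prediction for the pairings `u₁ᵀ X u₃` and the negated contracted core, for
an initialization at which the pairing of the columns `p` and `k` dominates. -/
def Task.prediction {r₁ r₂ r₃ n m nd : ℕ} (T : Task n m nd) (η : Fin 4 → ℝ)
    (θ : Params r₁ r₂ r₃ n m nd) (p : Fin r₁) (k : Fin r₃) (t : ℕ) :
    Matrix (Fin r₁) (Fin r₃) ℝ × Matrix (Fin r₁) (Fin r₃) ℝ :=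
  model (η 1) (η 3) (η 0 * T.strength θ) (Matrix.gram ℝ fun p => lin T.Xᵀ (θ.U₁ p))
    (Matrix.gram ℝ fun k => lin T.X (θ.U₃ k)) (Matrix.single p k (T.bil (θ.U₁ p) (θ.U₃ k))) t

section

variable {r₁ r₂ r₃ : ℕ} {κ : Type*} {L : Filter κ} {n m nd : κ → ℕ}
  {T : ∀ z, Task (n z) (m z) (nd z)} {η : κ → Fin 4 → ℝ}
  {θ θ' : ∀ z, Params r₁ r₂ r₃ (n z) (m z) (nd z)} {s : κ → ℝ}

namespace Regular

lemma pairing (hR : Regular L T η θ s) (q : Fin r₂) :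
    (fun z => (T z).pairing (θ z) q) =O[L] (1 : κ → ℝ) :=
  isBigO_one_mul (hR.res.inner (hR.U₂ q)) (isBigO_refl _ _)

lemma strength (hR : Regular L T η θ s) : (fun z => (T z).strength (θ z)) =O[L] (1 : κ → ℝ) :=
  IsBigO.fun_sum fun q _ => ((hR.pairing q).pow 2).trans (IsBigO.of_bound 1 (.of_forall fun _ => by simp))

lemma gram_U₁ (hR : Regular L T η θ s) (p p' : Fin r₁) :
    (fun z => ⟪lin (T z).Xᵀ ((θ z).U₁ p), lin (T z).Xᵀ ((θ z).U₁ p')⟫_ℝ) =O[L] (1 : κ → ℝ) :=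
  isBigO_one_mul ((hR.lin_U₁ p).inner (hR.lin_U₁ p')) (isBigO_refl _ _)

lemma gram_U₃ (hR : Regular L T η θ s) (k k' : Fin r₃) :
    (fun z => ⟪lin (T z).X ((θ z).U₃ k), lin (T z).X ((θ z).U₃ k')⟫_ℝ) =O[L] (1 : κ → ℝ) :=
  isBigO_one_mul ((hR.lin_U₃ k).inner (hR.lin_U₃ k')) (isBigO_refl _ _)

end Regular

namespace Near

lemma gram_U₃_sub (hR : Regular L T η θ s) (h : Near L θ θ' s) (k k' : Fin r₃) :
    (fun z => ⟪lin (T z).X ((θ' z).U₃ k), lin (T z).X ((θ' z).U₃ k')⟫_ℝ -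
      ⟪lin (T z).X ((θ z).U₃ k), lin (T z).X ((θ z).U₃ k')⟫_ℝ) =O[L] s := by
  have e : (fun z => ⟪lin (T z).X ((θ' z).U₃ k), lin (T z).X ((θ' z).U₃ k')⟫_ℝ -
      ⟪lin (T z).X ((θ z).U₃ k), lin (T z).X ((θ z).U₃ k')⟫_ℝ) = fun z =>
      ⟪lin (T z).X ((θ' z).U₃ k) - lin (T z).X ((θ z).U₃ k), lin (T z).X ((θ' z).U₃ k')⟫_ℝ +
      ⟪lin (T z).X ((θ z).U₃ k), lin (T z).X ((θ' z).U₃ k') - lin (T z).X ((θ z).U₃ k')⟫_ℝ := by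
    ext z
    rw [inner_sub_left, inner_sub_right]
    ring
  rw [e]
  exact (isBigO_mul_one ((h.lin_U₃_sub hR k).inner (h.lin_U₃ hR k')) (isBigO_refl _ _)).add
    (isBigO_one_mul ((hR.lin_U₃ k).inner (h.lin_U₃_sub hR k')) (isBigO_refl _ _))

lemma gram_U₁_sub (hR : Regular L T η θ s) (h : Near L θ θ' s) (p p' : Fin r₁) :
    (fun z => ⟪lin (T z).Xᵀ ((θ' z).U₁ p), lin (T z).Xᵀ ((θ' z).U₁ p')⟫_ℝ -
      ⟪lin (T z).Xᵀ ((θ z).U₁ p), lin (T z).Xᵀ ((θ z).U₁ p')⟫_ℝ) =O[L] s := by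
  have e : (fun z => ⟪lin (T z).Xᵀ ((θ' z).U₁ p), lin (T z).Xᵀ ((θ' z).U₁ p')⟫_ℝ -
      ⟪lin (T z).Xᵀ ((θ z).U₁ p), lin (T z).Xᵀ ((θ z).U₁ p')⟫_ℝ) = fun z =>
      ⟪lin (T z).Xᵀ ((θ' z).U₁ p) - lin (T z).Xᵀ ((θ z).U₁ p), lin (T z).Xᵀ ((θ' z).U₁ p')⟫_ℝ +
      ⟪lin (T z).Xᵀ ((θ z).U₁ p),
        lin (T z).Xᵀ ((θ' z).U₁ p') - lin (T z).Xᵀ ((θ z).U₁ p')⟫_ℝ := by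
    ext z
    rw [inner_sub_left, inner_sub_right]
    ring
  rw [e]
  exact (isBigO_mul_one ((h.lin_U₁_sub hR p).inner (h.lin_U₁ hR p')) (isBigO_refl _ _)).add
    (isBigO_one_mul ((hR.lin_U₁ p).inner (h.lin_U₁_sub hR p')) (isBigO_refl _ _))

lemma inner_sum_contr_U₃_sub (hR : Regular L T η θ s) (h : Near L θ θ' s) (p : Fin r₁)
    (k : Fin r₃) :
    (fun z => ⟪∑ k', (T z).contr (θ' z) p k' • lin (T z).X ((θ' z).U₃ k'),
        lin (T z).X ((θ' z).U₃ k)⟫_ℝ - ∑ k', (T z).contr (θ' z) p k' *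
      ⟪lin (T z).X ((θ z).U₃ k'), lin (T z).X ((θ z).U₃ k)⟫_ℝ) =O[L] (s * s) := by
  simp only [sum_inner, inner_smul_left, conj_trivial, ← Finset.sum_sub_distrib, ← mul_sub]
  exact IsBigO.fun_sum fun k' _ => (h.contr hR p k').mul (h.gram_U₃_sub hR k' k)

lemma inner_sum_contr_U₁_sub (hR : Regular L T η θ s) (h : Near L θ θ' s) (p : Fin r₁)
    (k : Fin r₃) :
    (fun z => ⟪∑ p', (T z).contr (θ' z) p' k • lin (T z).Xᵀ ((θ' z).U₁ p'),
        lin (T z).Xᵀ ((θ' z).U₁ p)⟫_ℝ - ∑ p', (T z).contr (θ' z) p' k *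
      ⟪lin (T z).Xᵀ ((θ z).U₁ p'), lin (T z).Xᵀ ((θ z).U₁ p)⟫_ℝ) =O[L] (s * s) := by
  simp only [sum_inner, inner_smul_left, conj_trivial, ← Finset.sum_sub_distrib, ← mul_sub]
  exact IsBigO.fun_sum fun p' _ => (h.contr hR p' k).mul (h.gram_U₁_sub hR p' p)

/-- The updates of `U₁` and `U₃` are of order s, so their joint contribution is of order s². In the
two linear contributions the Gram matrices may be frozen at initialization: their drift is of order
s and is multiplied by `contr`, also of order s. -/
lemma bil_step (hR : Regular L T η θ s) (h : Near L θ θ' s) (p : Fin r₁) (k : Fin r₃) :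
    (fun z => (T z).bil (((T z).gdStep (η z) (θ' z)).U₁ p) (((T z).gdStep (η z) (θ' z)).U₃ k) -
      ((T z).bil ((θ' z).U₁ p) ((θ' z).U₃ k) -
        η z 1 * ∑ k', (T z).contr (θ' z) p k' *
          ⟪lin (T z).X ((θ z).U₃ k'), lin (T z).X ((θ z).U₃ k)⟫_ℝ -
        η z 3 * ∑ p', (T z).contr (θ' z) p' k *
          ⟪lin (T z).Xᵀ ((θ z).U₁ p'), lin (T z).Xᵀ ((θ z).U₁ p)⟫_ℝ)) =O[L] (s * s) := by
  have e : (fun z => (T z).bil (((T z).gdStep (η z) (θ' z)).U₁ p)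
        (((T z).gdStep (η z) (θ' z)).U₃ k) -
      ((T z).bil ((θ' z).U₁ p) ((θ' z).U₃ k) -
        η z 1 * ∑ k', (T z).contr (θ' z) p k' *
          ⟪lin (T z).X ((θ z).U₃ k'), lin (T z).X ((θ z).U₃ k)⟫_ℝ -
        η z 3 * ∑ p', (T z).contr (θ' z) p' k *
          ⟪lin (T z).Xᵀ ((θ z).U₁ p'), lin (T z).Xᵀ ((θ z).U₁ p)⟫_ℝ)) = fun z =>
      η z 1 * (η z 3 * ⟪∑ k', (T z).contr (θ' z) p k' • lin (T z).X ((θ' z).U₃ k'),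
        lin (T z).X (∑ p', (T z).contr (θ' z) p' k • lin (T z).Xᵀ ((θ' z).U₁ p'))⟫_ℝ) -
      η z 1 * (⟪∑ k', (T z).contr (θ' z) p k' • lin (T z).X ((θ' z).U₃ k'),
        lin (T z).X ((θ' z).U₃ k)⟫_ℝ - ∑ k', (T z).contr (θ' z) p k' *
          ⟪lin (T z).X ((θ z).U₃ k'), lin (T z).X ((θ z).U₃ k)⟫_ℝ) -
      η z 3 * (⟪∑ p', (T z).contr (θ' z) p' k • lin (T z).Xᵀ ((θ' z).U₁ p'),
        lin (T z).Xᵀ ((θ' z).U₁ p)⟫_ℝ - ∑ p', (T z).contr (θ' z) p' k *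
          ⟪lin (T z).Xᵀ ((θ z).U₁ p'), lin (T z).Xᵀ ((θ z).U₁ p)⟫_ℝ) := by
    ext z
    rw [Task.bil_eq, Task.bil_eq, Task.gdStep_U₁, Task.gdStep_U₃]
    set W := ∑ k', (T z).contr (θ' z) p k' • lin (T z).X ((θ' z).U₃ k')
    set Y := ∑ p', (T z).contr (θ' z) p' k • lin (T z).Xᵀ ((θ' z).U₁ p')
    rw [map_sub, map_smul, inner_sub_left, inner_sub_right, inner_sub_right]
    simp only [inner_smul_left, inner_smul_right, conj_trivial]
    rw [real_inner_comm _ Y, inner_lin_transpose _ ((θ' z).U₁ p)]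
    ring
  rw [e]
  refine ((isBigO_bounded_mul (hR.rate 1) (isBigO_bounded_mul (hR.rate 3) ?_)).sub
    (isBigO_bounded_mul (hR.rate 1) (h.inner_sum_contr_U₃_sub hR p k))).sub
    (isBigO_bounded_mul (hR.rate 3) (h.inner_sum_contr_U₁_sub hR p k))
  exact (h.sum_contr_U₃ hR p).inner ((h.sum_contr_U₁ hR k).lin hR.frob)

lemma contr_sub (hR : Regular L T η θ s) (h : Near L θ θ' s) (p : Fin r₁) (k : Fin r₃) :
    (fun z => (T z).contr (θ' z) p k - ∑ q, (θ' z).G (p, q, k) * (T z).pairing (θ z) q)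
      =O[L] (s * s) := by
  simp only [Task.contr, ← Finset.sum_sub_distrib, ← mul_sub]
  exact IsBigO.fun_sum fun q _ => isBigO_bounded_mul ((h.G _).trans hR.scale)
    (h.inner_residual_sub hR q)

/-- To second order the pairings of the residual with `U₂` keep their initial values, so contracting
the core update with them produces their sum of squares, `strength`. -/
lemma contr_step (hR : Regular L T η θ s) (h : Near L θ θ' s) (p : Fin r₁) (k : Fin r₃) :
    (fun z => (T z).contr ((T z).gdStep (η z) (θ' z)) p k - ((T z).contr (θ' z) p k -
      η z 0 * (T z).strength (θ z) * (T z).bil ((θ' z).U₁ p) ((θ' z).U₃ k))) =O[L] (s * s) := by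
  have e : (fun z => (T z).contr ((T z).gdStep (η z) (θ' z)) p k - ((T z).contr (θ' z) p k -
      η z 0 * (T z).strength (θ z) * (T z).bil ((θ' z).U₁ p) ((θ' z).U₃ k))) = fun z =>
      ((T z).contr ((T z).gdStep (η z) (θ' z)) p k -
        ∑ q, ((T z).gdStep (η z) (θ' z)).G (p, q, k) * (T z).pairing (θ z) q) -
      ((T z).contr (θ' z) p k - ∑ q, (θ' z).G (p, q, k) * (T z).pairing (θ z) q) -
      ∑ q, η z 0 * ((T z).bil ((θ' z).U₁ p) ((θ' z).U₃ k) * ((T z).pairing (θ z) q *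
        (⟪(T z).residual (θ' z), (θ' z).U₂ q⟫_ℝ - (T z).pairing (θ z) q))) := by
    ext z
    simp only [Task.gdStep_G, Task.strength, sub_mul, mul_sub, Finset.sum_sub_distrib,
      Finset.mul_sum, Finset.sum_mul]
    have h1 : ∀ q, η z 0 * (⟪(T z).residual (θ' z), (θ' z).U₂ q⟫_ℝ *
        (T z).bil ((θ' z).U₁ p) ((θ' z).U₃ k)) * (T z).pairing (θ z) q =
        η z 0 * ((T z).bil ((θ' z).U₁ p) ((θ' z).U₃ k) * ((T z).pairing (θ z) q *
          ⟪(T z).residual (θ' z), (θ' z).U₂ q⟫_ℝ)) := fun q => by ring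
    have h2 : ∀ q, η z 0 * (T z).pairing (θ z) q ^ 2 * (T z).bil ((θ' z).U₁ p) ((θ' z).U₃ k) =
        η z 0 * ((T z).bil ((θ' z).U₁ p) ((θ' z).U₃ k) * ((T z).pairing (θ z) q *
          (T z).pairing (θ z) q)) := fun q => by ring
    simp only [h1, h2]
    ring
  rw [e]
  exact (((h.step hR).contr_sub hR p k).sub (h.contr_sub hR p k)).sub
    (IsBigO.fun_sum fun q _ => isBigO_bounded_mul (hR.rate 0)
      (isBigO_bounded_mul ((h.bil hR p k).trans hR.scale) (isBigO_bounded_mul (hR.pairing q)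
        (h.inner_residual_sub hR q))))

lemma core_step (hR : Regular L T η θ s) (h : Near L θ θ' s) (p : Fin r₁) (q : Fin r₂)
    (k : Fin r₃) (ih : (fun z => (T z).strength (θ z) * (θ' z).G (p, q, k) -
      (T z).pairing (θ z) q * (T z).contr (θ' z) p k) =O[L] (s * s)) :
    (fun z => (T z).strength (θ z) * ((T z).gdStep (η z) (θ' z)).G (p, q, k) -
      (T z).pairing (θ z) q * (T z).contr ((T z).gdStep (η z) (θ' z)) p k) =O[L] (s * s) := by
  have e : (fun z => (T z).strength (θ z) * ((T z).gdStep (η z) (θ' z)).G (p, q, k) -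
      (T z).pairing (θ z) q * (T z).contr ((T z).gdStep (η z) (θ' z)) p k) = fun z =>
      ((T z).strength (θ z) * (θ' z).G (p, q, k) -
        (T z).pairing (θ z) q * (T z).contr (θ' z) p k) -
      η z 0 * ((T z).strength (θ z) * ((T z).bil ((θ' z).U₁ p) ((θ' z).U₃ k) *
        (⟪(T z).residual (θ' z), (θ' z).U₂ q⟫_ℝ - (T z).pairing (θ z) q))) -
      (T z).pairing (θ z) q * ((T z).contr ((T z).gdStep (η z) (θ' z)) p k -
        ((T z).contr (θ' z) p k -
          η z 0 * (T z).strength (θ z) * (T z).bil ((θ' z).U₁ p) ((θ' z).U₃ k))) := by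
    ext z
    rw [Task.gdStep_G]
    ring
  rw [e]
  exact (ih.sub (isBigO_bounded_mul (hR.rate 0) (isBigO_bounded_mul hR.strength
    (isBigO_bounded_mul ((h.bil hR p k).trans hR.scale) (h.inner_residual_sub hR q))))).sub
    (isBigO_bounded_mul (hR.pairing q) (h.contr_step hR p k))

end Near

namespace Regular

/-- Every core update is to leading order proportional to the initial pairing vector in the index q.
Hence the core is recovered from its contraction, and the model needs no index q. -/
lemma core_sub (hR : Regular L T η θ s) (p : Fin r₁) (q : Fin r₂) (k : Fin r₃) (t : ℕ) :
    (fun z => (T z).strength (θ z) * ((T z).gd (η z) (θ z) t).G (p, q, k) -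
      (T z).pairing (θ z) q * (T z).contr ((T z).gd (η z) (θ z) t) p k) =O[L] (s * s) := by
  induction t with
  | zero =>
    simp only [Task.gd_zero, Task.contr, hR.G, zero_mul, Finset.sum_const_zero, mul_zero, sub_zero]
    exact isBigO_zero _ _
  | succ t ih =>
    simp only [Task.gd_succ]
    exact (hR.near t).core_step hR p q k ih

end Regular

/-- An initialization at which the pairing of the columns `p` and `k` is of the small order `s`
and dominates the other pairings. -/
structure Excited (L : Filter κ) (T : ∀ z, Task (n z) (m z) (nd z)) (η : κ → Fin 4 → ℝ)
    (θ : ∀ z, Params r₁ r₂ r₃ (n z) (m z) (nd z)) (s : κ → ℝ) (p : Fin r₁) (k : Fin r₃) : Prop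
    extends Regular L T η θ s where
  tendsto : Tendsto s L (𝓝 0)
  rate_nonneg : ∀ z j, 0 ≤ η z j
  one_le_rate : ∀ j, (1 : κ → ℝ) =O[L] fun z => η z j
  one_le_pairing : ∀ q, (1 : κ → ℝ) =O[L] fun z => (T z).pairing (θ z) q
  bil_nonneg : ∀ᶠ z in L, 0 ≤ (T z).bil ((θ z).U₁ p) ((θ z).U₃ k)
  le_bil : s =O[L] fun z => (T z).bil ((θ z).U₁ p) ((θ z).U₃ k)
  off : ∀ p' k', (p', k') ≠ (p, k) →
    (fun z => (T z).bil ((θ z).U₁ p') ((θ z).U₃ k')) =O[L] (s * s)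

namespace Excited

variable {p : Fin r₁} {k : Fin r₃}

/-- The one-step expansions have exactly the form of `model`, whose coefficients are bounded, so
errors of order s² propagate linearly. The initial off-diagonal pairings are themselves of order s²,
which permits starting the model from a single entry. The contraction has the opposite sign because
descent moves the core against the pairings. -/
lemma prediction_sub (hE : Excited L T η θ s p k) (t : ℕ) : ∀ p' k',
    (fun z => (T z).bil (((T z).gd (η z) (θ z) t).U₁ p') (((T z).gd (η z) (θ z) t).U₃ k') -
      ((T z).prediction (η z) (θ z) p k t).1 p' k') =O[L] (s * s) ∧
    (fun z => (T z).contr ((T z).gd (η z) (θ z) t) p' k' -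
      -((T z).prediction (η z) (θ z) p k t).2 p' k') =O[L] (s * s) := by
  have hR := hE.toRegular
  induction t with
  | zero =>
    intro p' k'
    simp only [Task.gd_zero, Task.prediction, model]
    constructor
    · by_cases h : (p', k') = (p, k)
      · obtain ⟨rfl, rfl⟩ := Prod.mk.inj h
        simp only [Matrix.single_apply_same, sub_self]
        exact isBigO_zero _ _
      · have : ∀ x : ℝ, Matrix.single p k x p' k' = 0 := fun x => by
          rw [Matrix.single_apply_of_ne]
          rintro ⟨rfl, rfl⟩
          exact h rfl
        simp only [this, sub_zero]
        exact hE.off _ _ h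
    · simp only [Task.contr, hR.G, zero_mul, Finset.sum_const_zero, Matrix.zero_apply, neg_zero,
        sub_zero]
      exact isBigO_zero _ _
  | succ t ih =>
    intro p' k'
    simp only [Task.gd_succ]
    have h := hR.near t
    constructor
    · have e : (fun z => (T z).bil (((T z).gdStep (η z) ((T z).gd (η z) (θ z) t)).U₁ p')
          (((T z).gdStep (η z) ((T z).gd (η z) (θ z) t)).U₃ k') -
          ((T z).prediction (η z) (θ z) p k (t + 1)).1 p' k') = fun z =>
          ((T z).bil (((T z).gdStep (η z) ((T z).gd (η z) (θ z) t)).U₁ p')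
            (((T z).gdStep (η z) ((T z).gd (η z) (θ z) t)).U₃ k') -
          ((T z).bil (((T z).gd (η z) (θ z) t).U₁ p') (((T z).gd (η z) (θ z) t).U₃ k') -
            η z 1 * ∑ k'', (T z).contr ((T z).gd (η z) (θ z) t) p' k'' *
              ⟪lin (T z).X ((θ z).U₃ k''), lin (T z).X ((θ z).U₃ k')⟫_ℝ -
            η z 3 * ∑ p'', (T z).contr ((T z).gd (η z) (θ z) t) p'' k' *
              ⟪lin (T z).Xᵀ ((θ z).U₁ p''), lin (T z).Xᵀ ((θ z).U₁ p')⟫_ℝ)) +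
          ((T z).bil (((T z).gd (η z) (θ z) t).U₁ p') (((T z).gd (η z) (θ z) t).U₃ k') -
            ((T z).prediction (η z) (θ z) p k t).1 p' k') -
          η z 1 * ∑ k'', ⟪lin (T z).X ((θ z).U₃ k''), lin (T z).X ((θ z).U₃ k')⟫_ℝ *
            ((T z).contr ((T z).gd (η z) (θ z) t) p' k'' -
              -((T z).prediction (η z) (θ z) p k t).2 p' k'') -
          η z 3 * ∑ p'', ⟪lin (T z).Xᵀ ((θ z).U₁ p''), lin (T z).Xᵀ ((θ z).U₁ p')⟫_ℝ *
            ((T z).contr ((T z).gd (η z) (θ z) t) p'' k' -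
              -((T z).prediction (η z) (θ z) p k t).2 p'' k') := by
        ext z
        simp only [Task.prediction, model, Matrix.add_apply, Matrix.smul_apply, smul_eq_mul,
          Matrix.mul_apply, Matrix.gram_apply, sub_neg_eq_add, add_mul, Finset.sum_add_distrib,
          real_inner_comm _ (lin (T z).Xᵀ ((θ z).U₁ p')),
          mul_comm ⟪lin (T z).X _, _⟫_ℝ, mul_comm ⟪lin (T z).Xᵀ _, _⟫_ℝ]
        ring
      rw [e]
      exact (((h.bil_step hR p' k').add (ih p' k').1).sub (isBigO_bounded_mul (hR.rate 1)
        (IsBigO.fun_sum fun k'' _ => isBigO_bounded_mul (hR.gram_U₃ k'' k') (ih p' k'').2))).sub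
        (isBigO_bounded_mul (hR.rate 3)
        (IsBigO.fun_sum fun p'' _ => isBigO_bounded_mul (hR.gram_U₁ p'' p') (ih p'' k').2))
    · have e : (fun z => (T z).contr ((T z).gdStep (η z) ((T z).gd (η z) (θ z) t)) p' k' -
          -((T z).prediction (η z) (θ z) p k (t + 1)).2 p' k') = fun z =>
          ((T z).contr ((T z).gdStep (η z) ((T z).gd (η z) (θ z) t)) p' k' -
            ((T z).contr ((T z).gd (η z) (θ z) t) p' k' - η z 0 * (T z).strength (θ z) *
              (T z).bil (((T z).gd (η z) (θ z) t).U₁ p') (((T z).gd (η z) (θ z) t).U₃ k'))) +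
          ((T z).contr ((T z).gd (η z) (θ z) t) p' k' -
            -((T z).prediction (η z) (θ z) p k t).2 p' k') -
          η z 0 * ((T z).strength (θ z) *
            ((T z).bil (((T z).gd (η z) (θ z) t).U₁ p') (((T z).gd (η z) (θ z) t).U₃ k') -
            ((T z).prediction (η z) (θ z) p k t).1 p' k')) := by
        ext z
        simp only [Task.prediction, model, Matrix.add_apply, Matrix.smul_apply, smul_eq_mul]
        ring
      rw [e]
      exact ((h.contr_step hR p' k').add (ih p' k').2).sub (isBigO_bounded_mul (hR.rate 0)
        (isBigO_bounded_mul hR.strength (ih p' k').1))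

end Excited

end

/-! ### Lower bounds for the first-order terms at small pairings -/

section

variable {κ : Type*} {L : Filter κ} {c f g : κ → ℝ}

lemma isBigO_mul_of_one_isBigO (hc : (1 : κ → ℝ) =O[L] c) (hf : g =O[L] f) :
    g =O[L] fun z => c z * f z := by
  have := hc.mul hf
  refine IsBigO.trans (IsBigO.of_bound 1 (.of_forall fun _ => ?_)) this
  simp

lemma isBigO_of_eventually_nonneg_le (hf : ∀ᶠ z in L, 0 ≤ f z ∧ f z ≤ g z) : f =O[L] g := by
  refine IsBigO.of_bound 1 ?_
  filter_upwards [hf] with z hz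
  rw [one_mul, Real.norm_of_nonneg hz.1]
  exact hz.2.trans (le_abs_self _)

end

section

variable {r₁ r₂ r₃ : ℕ} {κ : Type*} {L : Filter κ} {n m nd : κ → ℕ}
  {T : ∀ z, Task (n z) (m z) (nd z)} {η : κ → Fin 4 → ℝ}
  {θ θ' : ∀ z, Params r₁ r₂ r₃ (n z) (m z) (nd z)} {s : κ → ℝ} {p : Fin r₁} {k : Fin r₃}

namespace Excited

lemma sq_isLittleO (hE : Excited L T η θ s p k) : (s * s) =o[L] s := by
  have h : s =o[L] (1 : κ → ℝ) := (isLittleO_one_iff ℝ).2 hE.tendsto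
  have := (isBigO_refl s L).mul_isLittleO h
  exact this.trans_isBigO (IsBigO.of_bound 1 (.of_forall fun _ => by simp))

lemma sq_isLittleO_one (hE : Excited L T η θ s p k) : (s * s) =o[L] (1 : κ → ℝ) :=
  hE.sq_isLittleO.trans_isBigO hE.scale

lemma cube_isLittleO (hE : Excited L T η θ s p k) : (s * (s * s)) =o[L] (s * s) :=
  (isBigO_refl s L).mul_isLittleO hE.sq_isLittleO

lemma one_le_strength (hE : Excited L T η θ s p k) (q : Fin r₂) :
    (1 : κ → ℝ) =O[L] fun z => (T z).strength (θ z) := by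
  have h1 : (1 : κ → ℝ) =O[L] fun z => (T z).pairing (θ z) q * (T z).pairing (θ z) q :=
    isBigO_mul_of_one_isBigO (hE.one_le_pairing q) (hE.one_le_pairing q)
  refine h1.trans (isBigO_of_eventually_nonneg_le (.of_forall fun z => ⟨mul_self_nonneg _, ?_⟩))
  rw [← sq]
  exact Finset.single_le_sum (f := fun q => (T z).pairing (θ z) q ^ 2)
    (fun _ _ => sq_nonneg _) (Finset.mem_univ q)

lemma core_nonneg (hE : Excited L T η θ s p k) (z : κ) : 0 ≤ η z 0 * (T z).strength (θ z) :=
  mul_nonneg (hE.rate_nonneg z 0) (Finset.sum_nonneg fun _ _ => sq_nonneg _)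

lemma le_bil_gd (hE : Excited L T η θ s p k) (t : ℕ) :
    s =O[L] fun z => (T z).bil (((T z).gd (η z) (θ z) t).U₁ p)
      (((T z).gd (η z) (θ z) t).U₃ k) := by
  refine isBigO_of_isBigO_of_sub ?_ (hE.prediction_sub t p k).1 hE.sq_isLittleO
  refine hE.le_bil.trans (isBigO_of_eventually_nonneg_le ?_)
  filter_upwards [hE.bil_nonneg] with z hz
  exact ⟨hz, le_model_fst (hE.rate_nonneg z 1) (hE.rate_nonneg z 3) (hE.core_nonneg z) hz
    (Matrix.posSemidef_gram _ _) (Matrix.posSemidef_gram _ _) t⟩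

lemma one_le_inner_residual (hE : Excited L T η θ s p k) (t : ℕ) (q : Fin r₂) :
    (1 : κ → ℝ) =O[L] fun z =>
      ⟪(T z).residual ((T z).gd (η z) (θ z) t), ((T z).gd (η z) (θ z) t).U₂ q⟫_ℝ :=
  isBigO_of_isBigO_of_sub (hE.one_le_pairing q) ((hE.near t).inner_residual_sub hE.toRegular q)
    hE.sq_isLittleO_one

lemma inner_initialResidual_sub (hE : Excited L T η θ s p k) (t : ℕ) (q : Fin r₂) :
    (fun z => ⟪((T z).gd (η z) (θ z) t).U₂ q, (T z).initialResidual⟫_ℝ -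
      (T z).pairing (θ z) q) =O[L] (s * s) := by
  have := isBigO_one_mul (hE.res.inner ((hE.near t).U₂ q)) (isBigO_refl _ _)
  refine this.congr_left fun z => ?_
  rw [inner_sub_right, real_inner_comm]
  rfl

lemma one_le_inner_initialResidual (hE : Excited L T η θ s p k) (t : ℕ) (q : Fin r₂) :
    (1 : κ → ℝ) =O[L] fun z =>
      ⟪((T z).gd (η z) (θ z) t).U₂ q, (T z).initialResidual⟫_ℝ :=
  isBigO_of_isBigO_of_sub (hE.one_le_pairing q) (hE.inner_initialResidual_sub t q)
    hE.sq_isLittleO_one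

/-- The component along the initial residual is used instead of the norm because it is a scalar
polynomial in the initialization, as the small-ball bound requires. Its factors are of order one
except for the squared pairing. -/
lemma le_delta₀ (hE : Excited L T η θ s p k) (t : ℕ) (q : Fin r₂) :
    (s * s) =O[L] fun z =>
      ⟪(T z).delta₀ (η z) ((T z).gd (η z) (θ z) t) p q k, (T z).initialResidual⟫_ℝ := by
  have h := isBigO_mul_of_one_isBigO (hE.one_le_inner_initialResidual t q)
    (isBigO_mul_of_one_isBigO (hE.one_le_rate 0) (isBigO_mul_of_one_isBigO
      (hE.one_le_inner_residual t q) ((hE.le_bil_gd t).mul (hE.le_bil_gd t))))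
  refine h.neg_right.congr_right fun z => ?_
  rw [Task.delta₀, inner_smul_left, conj_trivial]
  ring

/-- Replacing the core by its contraction and both factors by the model turns `strength * coef` into
minus a pairing of order one times the trace bounded in `le_model_trace`. That trace is at least of
order s², whereas the replacements cost O(s³). -/
lemma le_coef (hE : Excited L T η θ s p k) (t : ℕ) (q : Fin r₂) :
    (s * s) =O[L] fun z => (T z).coef ((T z).gd (η z) (θ z) (t + 1)) q := by
  have hR := hE.toRegular
  have h0 : (s * s) =O[L] fun z => -((T z).pairing (θ z) q * ∑ p', ∑ k',
      ((T z).prediction (η z) (θ z) p k (t + 1)).2 p' k' *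
      ((T z).prediction (η z) (θ z) p k (t + 1)).1 p' k') := by
    refine (isBigO_mul_of_one_isBigO (hE.one_le_pairing q) ?_).neg_right
    have h1 := isBigO_mul_of_one_isBigO (isBigO_mul_of_one_isBigO (hE.one_le_rate 0)
      (hE.one_le_strength q)) (hE.le_bil.mul hE.le_bil)
    refine IsBigO.trans h1 (isBigO_of_eventually_nonneg_le ?_)
    filter_upwards [hE.bil_nonneg] with z hz
    refine ⟨mul_nonneg (hE.core_nonneg z) (mul_self_nonneg _), ?_⟩
    rw [← sq]
    exact le_model_trace (hE.rate_nonneg z 1) (hE.rate_nonneg z 3) (hE.core_nonneg z) hz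
      (Matrix.posSemidef_gram _ _) (Matrix.posSemidef_gram _ _) t
  set θ' := fun z => (T z).gd (η z) (θ z) (t + 1) with hθ'
  have hN : Near L θ θ' s := hR.near (t + 1)
  have hpred : ∀ p' k', (fun z => ((T z).prediction (η z) (θ z) p k (t + 1)).2 p' k') =O[L] s := by
    intro p' k'
    have := (hN.contr hR p' k').sub
      ((hE.prediction_sub (t + 1) p' k').2.trans hE.sq_isLittleO.isBigO)
    refine this.neg_left.congr_left fun z => ?_
    simp only [hθ']
    ring
  have hsub : (fun z => (T z).strength (θ z) * (T z).coef (θ' z) q -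
      -((T z).pairing (θ z) q * ∑ p', ∑ k', ((T z).prediction (η z) (θ z) p k (t + 1)).2 p' k' *
      ((T z).prediction (η z) (θ z) p k (t + 1)).1 p' k')) =O[L] (s * (s * s)) := by
    have e : (fun z => (T z).strength (θ z) * (T z).coef (θ' z) q -
      -((T z).pairing (θ z) q * ∑ p', ∑ k', ((T z).prediction (η z) (θ z) p k (t + 1)).2 p' k' *
      ((T z).prediction (η z) (θ z) p k (t + 1)).1 p' k')) = fun z => ∑ p', ∑ k',
      ((T z).bil ((θ' z).U₁ p') ((θ' z).U₃ k') * ((T z).strength (θ z) * (θ' z).G (p', q, k') -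
        (T z).pairing (θ z) q * (T z).contr (θ' z) p' k') +
      (T z).pairing (θ z) q * ((T z).bil ((θ' z).U₁ p') ((θ' z).U₃ k') *
        ((T z).contr (θ' z) p' k' - -((T z).prediction (η z) (θ z) p k (t + 1)).2 p' k') -
      ((T z).prediction (η z) (θ z) p k (t + 1)).2 p' k' *
        ((T z).bil ((θ' z).U₁ p') ((θ' z).U₃ k') -
          ((T z).prediction (η z) (θ z) p k (t + 1)).1 p' k'))) := by
      ext z
      simp only [Task.coef, Finset.mul_sum, sub_neg_eq_add, ← Finset.sum_add_distrib]
      refine Finset.sum_congr rfl fun p' _ => Finset.sum_congr rfl fun k' _ => ?_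
      ring
    rw [e]
    exact IsBigO.fun_sum fun p' _ => IsBigO.fun_sum fun k' _ =>
      ((hN.bil hR p' k').mul (hR.core_sub p' q k' (t + 1))).add
        (isBigO_bounded_mul (hR.pairing q)
          (((hN.bil hR p' k').mul (hE.prediction_sub (t + 1) p' k').2).sub
            ((hpred p' k').mul (hE.prediction_sub (t + 1) p' k').1)))
  exact (isBigO_of_isBigO_of_sub h0 hsub hE.cube_isLittleO).trans
    (isBigO_bounded_mul hR.strength (isBigO_refl _ _))

/-- The term is a rate times `coef`² times the residual. The residual is within O(s²) of the initial
one, whose norm is bounded below since it has pairings of order one with bounded vectors. -/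
lemma le_delta₂ (hE : Excited L T η θ s p k) (t : ℕ) (q : Fin r₂) :
    (s * s * (s * s)) =O[L] fun z =>
      ⟪(T z).delta₂ (η z) ((T z).gd (η z) (θ z) (t + 1)) q, (T z).initialResidual⟫_ℝ := by
  have hR := hE.toRegular
  have h1 : (1 : κ → ℝ) =O[L] fun z => ⟪(T z).initialResidual, (T z).initialResidual⟫_ℝ := by
    have h2 : (1 : κ → ℝ) =O[L] fun z => ‖(T z).initialResidual‖ :=
      (hE.one_le_pairing q).trans (isBigO_mul_one
        ((VecBigO.inner (g := fun z => ‖(T z).initialResidual‖) (isBigO_refl _ _) (hR.U₂ q)))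
        (isBigO_refl _ _))
    refine (isBigO_mul_of_one_isBigO h2 h2).congr_right fun z => ?_
    rw [real_inner_self_eq_norm_mul_norm]
  have h3 : (1 : κ → ℝ) =O[L] fun z =>
      ⟪(T z).residual ((T z).gd (η z) (θ z) (t + 1)), (T z).initialResidual⟫_ℝ := by
    refine isBigO_of_isBigO_of_sub h1 ?_ hE.sq_isLittleO_one
    simp only [← inner_sub_left]
    exact isBigO_mul_one (((hR.near (t + 1)).residual_sub hR).inner hR.res) (isBigO_refl _ _)
  have h := isBigO_mul_of_one_isBigO h3 (isBigO_mul_of_one_isBigO (hE.one_le_rate 2)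
    ((hE.le_coef t q).mul (hE.le_coef t q)))
  refine h.neg_right.congr_right fun z => ?_
  rw [Task.delta₂_eq, inner_smul_left, conj_trivial]
  ring

/-- The contraction of the core with the pairings of the current columns of `U₂` with the initial
residual agrees to leading order with the contraction with the current residual. -/
lemma sum_core_mul_inner_sub (hE : Excited L T η θ s p k) (t : ℕ) (p' : Fin r₁) (k' : Fin r₃) :
    (fun z => ∑ q, ((T z).gd (η z) (θ z) t).G (p', q, k') *
      ⟪((T z).gd (η z) (θ z) t).U₂ q, (T z).initialResidual⟫_ℝ -
      (T z).contr ((T z).gd (η z) (θ z) t) p' k') =O[L] (s * s) := by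
  have hR := hE.toRegular
  simp only [Task.contr, ← Finset.sum_sub_distrib, ← mul_sub]
  refine IsBigO.fun_sum fun q _ => isBigO_bounded_mul (((hR.near t).G _).trans hR.scale) ?_
  refine ((hE.inner_initialResidual_sub t q).sub
    ((hR.near t).inner_residual_sub hR q)).congr_left fun z => ?_
  simp [Task.pairing]

/-- With W = ∑ `contr` • X u₃, the component along the initial residual is -η₁ ‖W‖² up to O(s³). The
norm of W is tested against the image of column `k`: by the model that pairing is at least of order
s when this image is bounded below initially, which is the purpose of `hk`. -/
lemma le_delta₁ (hE : Excited L T η θ s p k) (t : ℕ) (q₀ : Fin r₂)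
    (hk : (1 : κ → ℝ) =O[L] fun z => ‖lin (T z).X ((θ z).U₃ k)‖ ^ 2) :
    (s * s) =O[L] fun z =>
      ⟪(T z).delta₁ (η z) ((T z).gd (η z) (θ z) (t + 1)) p, (T z).initialResidual⟫_ℝ := by
  have hR := hE.toRegular
  have h0 : s =O[L] fun z => -∑ k', ((T z).prediction (η z) (θ z) p k (t + 1)).2 p k' *
      ⟪lin (T z).X ((θ z).U₃ k'), lin (T z).X ((θ z).U₃ k)⟫_ℝ := by
    have h1 := isBigO_mul_of_one_isBigO (isBigO_mul_of_one_isBigO (hE.one_le_rate 0)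
      (hE.one_le_strength q₀)) (isBigO_mul_of_one_isBigO hk hE.le_bil)
    refine IsBigO.trans h1 (IsBigO.neg_right (isBigO_of_eventually_nonneg_le ?_))
    filter_upwards [hE.bil_nonneg] with z hz
    refine ⟨mul_nonneg (hE.core_nonneg z) (mul_nonneg (sq_nonneg _) hz), ?_⟩
    have := le_model_snd_mul (p := p) (k := k) (hE.rate_nonneg z 1) (hE.rate_nonneg z 3)
      (hE.core_nonneg z) hz
      (Matrix.posSemidef_gram ℝ fun p => lin (T z).Xᵀ ((θ z).U₁ p))
      (Matrix.posSemidef_gram ℝ fun k => lin (T z).X ((θ z).U₃ k)) t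
    rw [Matrix.mul_apply, Matrix.gram_apply, real_inner_self_eq_norm_sq, mul_comm _ (_ ^ 2)] at this
    exact this
  have hpred := hE.prediction_sub (t + 1)
  have hsum := hE.sum_core_mul_inner_sub (t + 1)
  have hN' := hR.near (t + 1)
  set θ' := fun z => (T z).gd (η z) (θ z) (t + 1) with hθ'
  have hN : Near L θ θ' s := hN'
  have h2 : s =O[L] fun z => ⟪∑ k', (T z).contr (θ' z) p k' • lin (T z).X ((θ' z).U₃ k'),
      lin (T z).X ((θ' z).U₃ k)⟫_ℝ := by
    refine isBigO_of_isBigO_of_sub h0 ?_ hE.sq_isLittleO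
    refine ((hN.inner_sum_contr_U₃_sub hR p k).add (IsBigO.fun_sum (s := Finset.univ)
      fun k' _ => isBigO_bounded_mul (hR.gram_U₃ k' k) (hpred p k').2)).congr_left fun z => ?_
    simp only [hθ', sub_neg_eq_add, add_mul, Finset.sum_add_distrib,
      mul_comm ⟪lin (T z).X _, lin (T z).X ((θ z).U₃ k)⟫_ℝ]
    ring
  have h3 : s =O[L] fun z => ‖∑ k', (T z).contr (θ' z) p k' • lin (T z).X ((θ' z).U₃ k')‖ :=
    h2.trans (isBigO_mul_one (VecBigO.inner (isBigO_refl _ _) (hN.lin_U₃ hR k)) (isBigO_refl _ _))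
  have h4 : (s * s) =O[L] fun z => ∑ k', (∑ q, (θ' z).G (p, q, k') *
      ⟪(θ' z).U₂ q, (T z).initialResidual⟫_ℝ) *
      ⟪∑ k', (T z).contr (θ' z) p k' • lin (T z).X ((θ' z).U₃ k'),
        lin (T z).X ((θ' z).U₃ k')⟫_ℝ := by
    -- Replacing the contraction with the initial residual by `contr` costs s² per entry, and the
    -- pairing with W contributes another factor s.
    refine isBigO_of_isBigO_of_sub (h3.mul h3) ?_ hE.cube_isLittleO
    refine (IsBigO.fun_sum (s := Finset.univ) fun k' _ => (isBigO_mul_one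
      ((hN.sum_contr_U₃ hR p).inner (hN.lin_U₃ hR k')) (isBigO_refl _ _)).mul
        (hsum p k')).congr_left fun z => ?_
    rw [← real_inner_self_eq_norm_mul_norm, inner_sum, ← Finset.sum_sub_distrib]
    refine Finset.sum_congr rfl fun k' _ => ?_
    rw [inner_smul_right]
    ring
  refine (isBigO_mul_of_one_isBigO (hE.one_le_rate 1) h4).neg_right.congr_right fun z => ?_
  rw [Task.delta₁_eq, inner_smul_left, sum_inner, conj_trivial, neg_mul]
  simp only [inner_smul_left, conj_trivial, Finset.sum_mul]
  rw [Finset.sum_comm]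
  congr 2
  refine Finset.sum_congr rfl fun q _ => Finset.sum_congr rfl fun k' _ => ?_
  ring

lemma le_delta₃ (hE : Excited L T η θ s p k) (t : ℕ) (q₀ : Fin r₂)
    (hp : (1 : κ → ℝ) =O[L] fun z => ‖lin (T z).Xᵀ ((θ z).U₁ p)‖ ^ 2) :
    (s * s) =O[L] fun z =>
      ⟪(T z).delta₃ (η z) ((T z).gd (η z) (θ z) (t + 1)) k, (T z).initialResidual⟫_ℝ := by
  have hR := hE.toRegular
  have h0 : s =O[L] fun z => -∑ p', ⟪lin (T z).Xᵀ ((θ z).U₁ p), lin (T z).Xᵀ ((θ z).U₁ p')⟫_ℝ *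
      ((T z).prediction (η z) (θ z) p k (t + 1)).2 p' k := by
    have h1 := isBigO_mul_of_one_isBigO (isBigO_mul_of_one_isBigO (hE.one_le_rate 0)
      (hE.one_le_strength q₀)) (isBigO_mul_of_one_isBigO hp hE.le_bil)
    refine IsBigO.trans h1 (IsBigO.neg_right (isBigO_of_eventually_nonneg_le ?_))
    filter_upwards [hE.bil_nonneg] with z hz
    refine ⟨mul_nonneg (hE.core_nonneg z) (mul_nonneg (sq_nonneg _) hz), ?_⟩
    have := le_mul_model_snd (p := p) (k := k) (hE.rate_nonneg z 1) (hE.rate_nonneg z 3)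
      (hE.core_nonneg z) hz
      (Matrix.posSemidef_gram ℝ fun p => lin (T z).Xᵀ ((θ z).U₁ p))
      (Matrix.posSemidef_gram ℝ fun k => lin (T z).X ((θ z).U₃ k)) t
    rw [Matrix.mul_apply, Matrix.gram_apply, real_inner_self_eq_norm_sq, mul_comm _ (_ ^ 2)] at this
    exact this
  have hpred := hE.prediction_sub (t + 1)
  have hsum := hE.sum_core_mul_inner_sub (t + 1)
  have hN' := hR.near (t + 1)
  set θ' := fun z => (T z).gd (η z) (θ z) (t + 1) with hθ'
  have hN : Near L θ θ' s := hN'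
  have h2 : s =O[L] fun z => ⟪∑ p', (T z).contr (θ' z) p' k • lin (T z).Xᵀ ((θ' z).U₁ p'),
      lin (T z).Xᵀ ((θ' z).U₁ p)⟫_ℝ := by
    refine isBigO_of_isBigO_of_sub h0 ?_ hE.sq_isLittleO
    refine ((hN.inner_sum_contr_U₁_sub hR p k).add (IsBigO.fun_sum (s := Finset.univ)
      fun p' _ => isBigO_bounded_mul (hR.gram_U₁ p' p) (hpred p' k).2)).congr_left fun z => ?_
    simp only [hθ', sub_neg_eq_add, add_mul, Finset.sum_add_distrib,
      mul_comm ⟪lin (T z).Xᵀ _, lin (T z).Xᵀ ((θ z).U₁ p)⟫_ℝ,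
      real_inner_comm _ (lin (T z).Xᵀ ((θ z).U₁ p))]
    ring
  have h3 : s =O[L] fun z => ‖∑ p', (T z).contr (θ' z) p' k • lin (T z).Xᵀ ((θ' z).U₁ p')‖ :=
    h2.trans (isBigO_mul_one (VecBigO.inner (isBigO_refl _ _) (hN.lin_U₁ hR p)) (isBigO_refl _ _))
  have h4 : (s * s) =O[L] fun z => ∑ p', (∑ q, (θ' z).G (p', q, k) *
      ⟪(θ' z).U₂ q, (T z).initialResidual⟫_ℝ) *
      ⟪∑ p', (T z).contr (θ' z) p' k • lin (T z).Xᵀ ((θ' z).U₁ p'),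
        lin (T z).Xᵀ ((θ' z).U₁ p')⟫_ℝ := by
    refine isBigO_of_isBigO_of_sub (h3.mul h3) ?_ hE.cube_isLittleO
    refine (IsBigO.fun_sum (s := Finset.univ) fun p' _ => (isBigO_mul_one
      ((hN.sum_contr_U₁ hR k).inner (hN.lin_U₁ hR p')) (isBigO_refl _ _)).mul
        (hsum p' k)).congr_left fun z => ?_
    rw [← real_inner_self_eq_norm_mul_norm, inner_sum, ← Finset.sum_sub_distrib]
    refine Finset.sum_congr rfl fun p' _ => ?_
    rw [inner_smul_right]
    ring
  refine (isBigO_mul_of_one_isBigO (hE.one_le_rate 3) h4).neg_right.congr_right fun z => ?_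
  rw [Task.delta₃_eq, inner_smul_left, sum_inner, conj_trivial, neg_mul]
  simp only [inner_smul_left, conj_trivial, Finset.sum_mul]
  rw [Finset.sum_comm]
  congr 2
  refine Finset.sum_congr rfl fun q _ => Finset.sum_congr rfl fun p' _ => ?_
  ring

end Excited

end

/-! ### From families of models to probabilities -/

/-- The space of initial values of the columns of `U₁` and `U₃`. -/
abbrev Init (r₁ r₃ n nd : ℕ) : Type :=
  (Fin r₁ → EuclideanSpace ℝ (Fin n)) × (Fin r₃ → EuclideanSpace ℝ (Fin nd))

section Terms

/-- The indices of the first-order terms. -/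
abbrev TermIndex (r₁ r₂ r₃ : ℕ) : Type := (Fin r₁ × Fin r₂ × Fin r₃) ⊕ Fin r₁ ⊕ Fin r₂ ⊕ Fin r₃

variable {r₁ r₂ r₃ n m nd : ℕ}

/-- The first-order terms as a single family. -/
def Task.term (T : Task n m nd) (η : Fin 4 → ℝ) (θ : Params r₁ r₂ r₃ n m nd) :
    TermIndex r₁ r₂ r₃ → EuclideanSpace ℝ (Fin m)
  | .inl (p, q, k) => T.delta₀ η θ p q k
  | .inr (.inl p) => T.delta₁ η θ p
  | .inr (.inr (.inl q)) => T.delta₂ η θ q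
  | .inr (.inr (.inr k)) => T.delta₃ η θ k

lemma Task.termsWithin_iff (T : Task n m nd) (η : Fin 4 → ℝ) (θ : Params r₁ r₂ r₃ n m nd)
    (c C : ℝ) : T.TermsWithin η θ c C ↔ ∀ j, ‖T.term η θ j‖ ∈ Set.Icc c C := by
  simp only [Task.TermsWithin, Sum.forall, Prod.forall, Task.term]

lemma vecPoly_term (T : Task n m nd) (η : Fin 4 → ℝ) (U₂ : Fin r₂ → EuclideanSpace ℝ (Fin m))
    (t : ℕ) (j : TermIndex r₁ r₂ r₃) :
    VecPoly (10 * 7 ^ t)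
      (fun ω : Init r₁ r₃ n nd => T.term η (T.gd η (initParams U₂ ω) t) j) := by
  have h := (paramsPoly_initParams (r₁ := r₁) (r₃ := r₃) (n := n) (nd := nd) U₂).gd T η t
  rw [mul_one] at h
  rcases j with ⟨p, q, k⟩ | p | q | k
  · exact h.delta₀ T η p q k
  · exact h.delta₁ T η p
  · exact h.delta₂ T η q
  · exact h.delta₃ T η k

end Terms

section Family

variable {r₁ r₂ r₃ : ℕ} {ι : Type*}

/-- The hypotheses on a family of models that do not concern the learning rates. -/
structure Admissible (l : Filter ι) {n m nd : ι → ℕ} (T : ∀ i, Task (n i) (m i) (nd i))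
    (U₂ : ∀ i, Fin r₂ → EuclideanSpace ℝ (Fin (m i))) : Prop where
  tendsto_n : Tendsto n l atTop
  tendsto_nd : Tendsto nd l atTop
  frob : (fun i => (T i).frobSq) =Θ[l] fun i => (n i : ℝ) * (nd i : ℝ)
  res : (fun i => ‖(T i).initialResidual‖) =O[l] fun _ => (1 : ℝ)
  norm : ∀ q, (fun i => ‖U₂ i q‖) =Θ[l] fun _ => (1 : ℝ)
  inner : ∀ q, (fun i => ⟪U₂ i q, (T i).initialResidual⟫_ℝ) =Θ[l] fun _ => (1 : ℝ)

/-- Learning rates of the orders that make training efficient. -/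
structure TunedRates (l : Filter ι) (n nd : ι → ℕ) (η : ι → Fin 4 → ℝ) : Prop where
  pos : ∀ i j, 0 < η i j
  zero : (fun i => η i 0) =Θ[l] fun _ => (1 : ℝ)
  one : (fun i => η i 1) =Θ[l] fun i => ((n i : ℝ))⁻¹
  two : (fun i => η i 2) =Θ[l] fun _ => (1 : ℝ)
  three : (fun i => η i 3) =Θ[l] fun i => ((nd i : ℝ))⁻¹

variable {l : Filter ι} {n m nd : ι → ℕ} {T : ∀ i, Task (n i) (m i) (nd i)}
  {U₂ : ∀ i, Fin r₂ → EuclideanSpace ℝ (Fin (m i))} {η : ι → Fin 4 → ℝ}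

/-- Rates of order `1 / n` become rates of order one after rescaling. -/
lemma isTheta_natCast_mul {a : ι → ℕ} {f : ι → ℝ} (ha : Tendsto a l atTop)
    (hf : f =Θ[l] fun i => ((a i : ℝ))⁻¹) :
    (fun i => √(a i : ℝ) ^ 2 * f i) =Θ[l] (1 : ι → ℝ) := by
  refine ((isTheta_refl (fun i => √(a i : ℝ) ^ 2) l).mul hf).trans_eventuallyEq ?_
  filter_upwards [ha.eventually_gt_atTop 0] with i hi
  have : (a i : ℝ) ≠ 0 := by exact_mod_cast hi.ne'
  rw [Real.sq_sqrt (Nat.cast_nonneg _), mul_inv_cancel₀ this]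
  rfl

lemma TunedRates.rescale_isTheta (hη : TunedRates l n nd η) (hn : Tendsto n l atTop)
    (hnd : Tendsto nd l atTop) (j : Fin 4) :
    (fun i => rescaleRates (η i) √(n i) √(nd i) j) =Θ[l] (1 : ι → ℝ) := by
  fin_cases j
  · exact hη.zero
  · exact isTheta_natCast_mul hn hη.one
  · exact hη.two
  · exact isTheta_natCast_mul hnd hη.three

namespace Admissible

lemma eventually_pos (hA : Admissible l T U₂) : ∀ᶠ i in l, 0 < n i ∧ 0 < nd i :=
  (hA.tendsto_n.eventually_gt_atTop 0).and (hA.tendsto_nd.eventually_gt_atTop 0)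

lemma eventually_frob (hA : Admissible l T U₂) : ∃ a b : ℝ, 0 < a ∧ 0 < b ∧
    ∀ᶠ i in l, a * (n i * nd i) ≤ LoTRA.frob (T i).X ∧ LoTRA.frob (T i).X ≤ b * (n i * nd i) := by
  obtain ⟨b, hb, h1⟩ := hA.frob.1.exists_pos
  obtain ⟨a, ha, h2⟩ := hA.frob.2.exists_pos
  refine ⟨a⁻¹, b, inv_pos.2 ha, hb, ?_⟩
  filter_upwards [h1.bound, h2.bound] with i hi1 hi2
  rw [Task.frobSq_eq, Real.norm_of_nonneg (frob_nonneg _), Real.norm_of_nonneg (by positivity)]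
    at hi1 hi2
  exact ⟨by rwa [inv_mul_le_iff₀ ha], hi1⟩

variable {κ : Type*} {L : Filter κ} {π : κ → ι} {s : κ → ℝ}

lemma sqrt_ne_zero {n : ℕ} (h : 0 < n) : √(n : ℝ) ≠ 0 :=
  Real.sqrt_ne_zero'.2 (by exact_mod_cast h)

lemma norm_rescale_sq_le {a b : ℝ} {E : Type*} [NormedAddCommGroup E] [NormedSpace ℝ E] {x y : E}
    {C : ℝ} (h : √a • x = y) (ha : 0 < a) (hC : ‖y‖ ^ 2 ≤ C * a) (hb : C = b) : ‖x‖ ^ 2 ≤ b := by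
  rw [← h, norm_smul, mul_pow, Real.norm_of_nonneg (Real.sqrt_nonneg _), Real.sq_sqrt ha.le,
    mul_comm] at hC
  exact hb ▸ le_of_mul_le_mul_right hC ha

lemma norm_isBigO_one {E : κ → Type*} [∀ z, NormedAddCommGroup (E z)] {f : ∀ z, E z} {C : ℝ}
    (h : ∀ᶠ z in L, ‖f z‖ ^ 2 ≤ C) : VecBigO L f 1 := by
  refine IsBigO.of_bound √C ?_
  filter_upwards [h] with z hz
  simpa using Real.le_sqrt_of_sq_le hz

/-- The scale `s` stays free because both regimes use this lemma: the constant 1 on typical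
initializations for upper bounds, and the small parameter τ on the constructed events for lower
bounds. -/
lemma regular (hA : Admissible l T U₂)
    (hη : ∀ j, (fun i => rescaleRates (η i) √(n i) √(nd i) j) =O[l] (1 : ι → ℝ))
    (hπ : Tendsto π L l) (ω : ∀ z, Init r₁ r₃ (n (π z)) (nd (π z))) {C : ℝ}
    (h₁ : ∀ᶠ z in L, ∀ p, ‖lin (T (π z)).Xᵀ ((ω z).1 p)‖ ^ 2 ≤ C * nd (π z))
    (h₃ : ∀ᶠ z in L, ∀ k, ‖lin (T (π z)).X ((ω z).2 k)‖ ^ 2 ≤ C * n (π z))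
    (hs : s =O[L] (1 : κ → ℝ))
    (hb : ∀ p k, (fun z => ⟪(ω z).1 p, lin (T (π z)).X ((ω z).2 k)⟫_ℝ) =O[L] s) :
    Regular L (fun z => (T (π z)).rescale (√(n (π z)) * √(nd (π z))))
      (fun z => rescaleRates (η (π z)) √(n (π z)) √(nd (π z)))
      (fun z => (initParams (U₂ (π z)) (ω z)).rescale √(n (π z)) √(nd (π z))) s where
  scale := hs
  G := fun _ _ => rfl
  frob := by
    obtain ⟨a, b, ha, hb, h⟩ := hA.eventually_frob
    refine IsBigO.of_bound b ?_
    filter_upwards [hπ.eventually h, hπ.eventually hA.eventually_pos] with z hz hpos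
    have h1 : (0 : ℝ) < n (π z) := by exact_mod_cast hpos.1
    have h2 : (0 : ℝ) < nd (π z) := by exact_mod_cast hpos.2
    rw [Task.rescale_X, frob_smul, Real.norm_of_nonneg (mul_nonneg (sq_nonneg _) (frob_nonneg _)),
      inv_pow, mul_pow, Real.sq_sqrt h1.le, Real.sq_sqrt h2.le, inv_mul_le_iff₀ (by positivity)]
    simpa [mul_comm] using hz.2
  rate := fun j => (hη j).comp_tendsto hπ
  res := by
    refine IsBigO.trans (IsBigO.of_bound 1 ?_) (hA.res.comp_tendsto hπ)
    filter_upwards [hπ.eventually hA.eventually_pos] with z hpos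
    rw [Task.rescale_initialResidual _ (mul_ne_zero (sqrt_ne_zero hpos.1) (sqrt_ne_zero hpos.2))]
    simp
  U₂ := fun q => (hA.norm q).1.comp_tendsto hπ
  lin_U₁ := by
    refine fun p => norm_isBigO_one (C := C) ?_
    filter_upwards [h₁, hπ.eventually hA.eventually_pos] with z hz hpos
    exact norm_rescale_sq_le (Task.rescale_lin_transpose _ (sqrt_ne_zero hpos.1)
      (sqrt_ne_zero hpos.2) _) (by exact_mod_cast hpos.2) (hz p) rfl
  lin_U₃ := by
    refine fun k => norm_isBigO_one (C := C) ?_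
    filter_upwards [h₃, hπ.eventually hA.eventually_pos] with z hz hpos
    exact norm_rescale_sq_le (Task.rescale_lin _ (sqrt_ne_zero hpos.1)
      (sqrt_ne_zero hpos.2) _) (by exact_mod_cast hpos.1) (hz k) rfl
  bil := by
    refine fun p k => IsBigO.trans (IsBigO.of_bound 1 ?_) (hb p k)
    filter_upwards [hπ.eventually hA.eventually_pos] with z hpos
    rw [Task.rescale_bil _ (sqrt_ne_zero hpos.1) (sqrt_ne_zero hpos.2), Task.bil_eq, one_mul]
    rfl

lemma term_rescale {r₁ r₂ r₃ n m nd : ℕ} (T : Task n m nd) (η : Fin 4 → ℝ)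
    (θ : Params r₁ r₂ r₃ n m nd) (t : ℕ) (j : TermIndex r₁ r₂ r₃) (hn : 0 < n) (hnd : 0 < nd) :
    (T.rescale (√n * √nd)).term (rescaleRates η √n √nd)
      ((T.rescale (√n * √nd)).gd (rescaleRates η √n √nd) (θ.rescale √n √nd) t) j =
      T.term η (T.gd η θ t) j := by
  have ha := sqrt_ne_zero hn
  have hb := sqrt_ne_zero hnd
  rw [T.rescale_gd ha hb]
  rcases j with ⟨p, q, k⟩ | p | q | k
  · exact T.rescale_delta₀ ha hb _ _ p q k
  · exact T.rescale_delta₁ ha hb _ _ p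
  · exact T.rescale_delta₂ ha hb _ _ q
  · exact T.rescale_delta₃ ha hb _ _ k

end Admissible

end Family

/-- Small-ball bound for polynomials of the initial values. -/
lemma exists_measureReal_lt_le {ι : Type*} {l : Filter ι} {n nd : ι → ℕ} {r₁ r₃ : ℕ} (D : ℕ)
    {F : ∀ i, Init r₁ r₃ (n i) (nd i) → ℝ} (hF : ∀ i, IsPoly D (F i)) {a p ε : ℝ} (ha : 0 < a)
    (hp : 0 < p) (hε : 0 < ε)
    (h : ∀ᶠ i in l, p ≤ (initLaw r₁ r₃ (n i) (nd i)).real {ω | a ≤ |F i ω|}) :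
    ∃ c : ℝ, 0 < c ∧ ∀ᶠ i in l, (initLaw r₁ r₃ (n i) (nd i)).real {ω | |F i ω| < c} ≤ ε := by
  obtain ⟨c, hc, H⟩ := exists_smallBall D ha hp hε
  refine ⟨c, hc, h.mono fun i hi => ?_⟩
  exact H _ (fun φ => integral_dual_eq_zero_of_neg (measurePreserving_neg_initLaw _ _ _ _) φ)
    (F i) (hF i).poly (hF i).cont.measurable hi

/-- The limit along the models and a small parameter `τ`, restricted to the events `Q τ`. -/
abbrev smallScale {ι : Type*} {n nd : ι → ℕ} {r₁ r₃ : ℕ} (l : Filter ι)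
    (Q : ℝ → ∀ i, Set (Init r₁ r₃ (n i) (nd i))) : Filter (ℝ × Σ i, Init r₁ r₃ (n i) (nd i)) :=
  (𝓝[>] (0 : ℝ) ×ˢ comap Sigma.fst l) ⊓
    𝓟 {z : ℝ × Σ i, Init r₁ r₃ (n i) (nd i) | z.2.2 ∈ Q z.1 z.2.1}

lemma tendsto_smallScale {ι : Type*} {n nd : ι → ℕ} {r₁ r₃ : ℕ} (l : Filter ι)
    (Q : ℝ → ∀ i, Set (Init r₁ r₃ (n i) (nd i))) :
    Tendsto (fun z : ℝ × Σ i, Init r₁ r₃ (n i) (nd i) => z.2.1) (smallScale l Q) l :=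
  (tendsto_comap.comp tendsto_snd).mono_left inf_le_left

/-- An asymptotic lower bound on events of positive probability, with a small parameter,
gives a lower bound with positive probability. -/
lemma exists_le_measureReal_of_isBigO {ι : Type*} {l : Filter ι} {n nd : ι → ℕ} {r₁ r₃ : ℕ}
    (F : ∀ i, Init r₁ r₃ (n i) (nd i) → ℝ) (Q : ℝ → ∀ i, Set (Init r₁ r₃ (n i) (nd i)))
    (hQ : ∀ τ : ℝ, 0 < τ → τ ≤ 1 → ∃ π : ℝ, 0 < π ∧
      ∀ᶠ i in l, π ≤ (initLaw r₁ r₃ (n i) (nd i)).real (Q τ i)) {g : ℝ → ℝ}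
    (hg : ∀ τ, 0 < τ → 0 < g τ)
    (hF : (fun z : ℝ × Σ i, Init r₁ r₃ (n i) (nd i) => g z.1)
      =O[smallScale l Q]
      fun z => F z.2.1 z.2.2) :
    ∃ a π : ℝ, 0 < a ∧ 0 < π ∧
      ∀ᶠ i in l, π ≤ (initLaw r₁ r₃ (n i) (nd i)).real {ω | a ≤ |F i ω|} := by
  obtain ⟨K, hK, h⟩ := hF.exists_pos
  have h1 := eventually_inf_principal.1 h.bound
  have h2 : ∀ᶠ τ in 𝓝[>] (0 : ℝ), 0 < τ ∧ τ ≤ 1 := by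
    filter_upwards [self_mem_nhdsWithin, nhdsWithin_le_nhds (eventually_le_nhds one_pos)]
      with τ h1 h2
    exact ⟨h1, h2⟩
  -- Currying the product filter fixes one small τ first and lets the models grow afterwards. The
  -- constant K is already uniform over the initializations in the event.
  obtain ⟨τ, h3, hτ, hτ1⟩ := (h1.curry.and h2).exists
  obtain ⟨π, hπ, h4⟩ := hQ τ hτ hτ1
  refine ⟨K⁻¹ * g τ, π, mul_pos (inv_pos.2 hK) (hg τ hτ), hπ, ?_⟩
  filter_upwards [h4, eventually_comap.1 h3] with i hi hi'
  refine hi.trans (measureReal_mono fun ω hω => ?_)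
  have := hi' ⟨i, ω⟩ rfl hω
  rw [Real.norm_eq_abs, Real.norm_eq_abs, abs_of_pos (hg τ hτ)] at this
  rwa [Set.mem_ofPred_eq, inv_mul_le_iff₀ hK]

variable {r₁ r₂ r₃ : ℕ} {ι : Type*} {l : Filter ι} {n m nd : ι → ℕ}
  {T : ∀ i, Task (n i) (m i) (nd i)} {U₂ : ∀ i, Fin r₂ → EuclideanSpace ℝ (Fin (m i))}
  {η : ι → Fin 4 → ℝ}

namespace Admissible

/-- With high probability all first-order terms are bounded. -/
lemma exists_norm_term_le (hA : Admissible l T U₂) (r₁ r₃ : ℕ)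
    (hη : ∀ j, (fun i => rescaleRates (η i) √(n i) √(nd i) j) =O[l] (1 : ι → ℝ))
    (t : ℕ) {ε : ℝ} (hε : 0 < ε) :
    ∃ C : ℝ, ∀ᶠ i in l, 1 - ε ≤ (initLaw r₁ r₃ (n i) (nd i)).real
      {ω | ∀ j, ‖(T i).term (η i) ((T i).gd (η i) (initParams (U₂ i) ω) t) j‖ ≤ C} := by
  obtain ⟨a, K, ha, hK, hX⟩ := hA.eventually_frob
  obtain ⟨C₀, hC₀, H⟩ := exists_init_bound r₁ r₃ hK hε
  set S : Set (Σ i, Init r₁ r₃ (n i) (nd i)) := {z |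
    (∀ p, ‖lin (T z.1).Xᵀ (z.2.1 p)‖ ^ 2 ≤ C₀ * nd z.1) ∧
    (∀ k, ‖lin (T z.1).X (z.2.2 k)‖ ^ 2 ≤ C₀ * n z.1) ∧
    ∀ p k, ⟪z.2.1 p, lin (T z.1).X (z.2.2 k)⟫_ℝ ^ 2 ≤ C₀} with hS
  -- Points of this filter are pairs of a model and an initialization in the typical event, so a
  -- big-O along it is a bound uniform over that event.
  set L : Filter (Σ i, Init r₁ r₃ (n i) (nd i)) := comap Sigma.fst l ⊓ 𝓟 S with hL
  have hLS : ∀ᶠ z in L, z ∈ S := eventually_inf_principal.2 (.of_forall fun _ h => h)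
  have hπ : Tendsto (fun z : Σ i, Init r₁ r₃ (n i) (nd i) => z.1) L l :=
    tendsto_comap.mono_left inf_le_left
  have hR := hA.regular (s := 1) hη hπ (fun z => z.2) (C := C₀) (hLS.mono fun _ h => h.1)
    (hLS.mono fun _ h => h.2.1) (isBigO_refl _ _) (fun p k => by
      refine IsBigO.of_bound √C₀ (hLS.mono fun z hz => ?_)
      simpa using Real.abs_le_sqrt (hz.2.2 p k))
  have hN := hR.near t
  have hsum : (fun z : Σ i, Init r₁ r₃ (n i) (nd i) => ∑ j, ‖((T z.1).rescale
      (√(n z.1) * √(nd z.1))).term (rescaleRates (η z.1) √(n z.1) √(nd z.1))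
      (((T z.1).rescale (√(n z.1) * √(nd z.1))).gd (rescaleRates (η z.1) √(n z.1) √(nd z.1))
        ((initParams (U₂ z.1) z.2).rescale √(n z.1) √(nd z.1)) t) j‖) =O[L] fun _ => (1 : ℝ) := by
    refine IsBigO.fun_sum fun j _ => ?_
    rcases j with ⟨p, q, k⟩ | p | q | k
    · exact hN.delta₀ hR p q k
    · exact hN.delta₁ hR p
    · exact hN.delta₂ hR q
    · exact hN.delta₃ hR k
  obtain ⟨C, hC⟩ := hsum.bound
  refine ⟨C, ?_⟩
  filter_upwards [hX, hA.eventually_pos, eventually_comap.1 (eventually_inf_principal.1 hC)]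
    with i hXi hpos hi
  refine (H hpos.1 hpos.2 (T i).X hXi.2).trans (measureReal_mono fun ω hω j => ?_)
  have h1 := hi ⟨i, ω⟩ rfl hω
  simp only [term_rescale _ _ _ _ _ hpos.1 hpos.2, norm_one, mul_one,
    Real.norm_of_nonneg (Finset.sum_nonneg fun _ _ => norm_nonneg _)] at h1
  exact (Finset.single_le_sum (f := fun j => ‖(T i).term (η i)
    ((T i).gd (η i) (initParams (U₂ i) ω) t) j‖) (fun _ _ => norm_nonneg _)
    (Finset.mem_univ j)).trans h1

/-- The limit of small pairing along the models and the initial values in the events `Q`. -/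
lemma excited (hA : Admissible l T U₂) (hη : TunedRates l n nd η) {p : Fin r₁} {k : Fin r₃}
    {c C : ℝ} (hc : 0 < c) (Q : ℝ → ∀ i, Set (Init r₁ r₃ (n i) (nd i)))
    (hQ : ∀ τ i ω, ω ∈ Q τ i → NearlySingle (T i).X p k c C τ ω.1 ω.2) :
    Excited (smallScale l Q)
      (fun z => (T z.2.1).rescale (√(n z.2.1) * √(nd z.2.1)))
      (fun z => rescaleRates (η z.2.1) √(n z.2.1) √(nd z.2.1))
      (fun z => (initParams (U₂ z.2.1) z.2.2).rescale √(n z.2.1) √(nd z.2.1))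
      (fun z => z.1) p k := by
  set L : Filter (ℝ × Σ i, Init r₁ r₃ (n i) (nd i)) := smallScale l Q with hL
  have hLS : ∀ᶠ z in L, NearlySingle (T z.2.1).X p k c C z.1 z.2.2.1 z.2.2.2 :=
    eventually_inf_principal.2 (.of_forall fun z h => hQ _ _ _ h)
  have hπ : Tendsto (fun z : ℝ × Σ i, Init r₁ r₃ (n i) (nd i) => z.2.1) L l :=
    tendsto_smallScale l Q
  have hτ : Tendsto (fun z : ℝ × Σ i, Init r₁ r₃ (n i) (nd i) => z.1) L (𝓝[>] 0) :=
    tendsto_fst.mono_left inf_le_left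
  have hτ0 : Tendsto (fun z : ℝ × Σ i, Init r₁ r₃ (n i) (nd i) => z.1) L (𝓝 0) :=
    hτ.mono_right nhdsWithin_le_nhds
  have hτpos : ∀ᶠ z in L, 0 < z.1 := hτ.eventually self_mem_nhdsWithin
  have hs : (fun z : ℝ × Σ i, Init r₁ r₃ (n i) (nd i) => z.1) =O[L] 1 :=
    hτ0.isBigO_one ℝ
  have hrate := hη.rescale_isTheta hA.tendsto_n hA.tendsto_nd
  have hoff : ∀ p' k', (p', k') ≠ (p, k) →
      (fun z : ℝ × Σ i, Init r₁ r₃ (n i) (nd i) =>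
        ⟪z.2.2.1 p', lin (T z.2.1).X (z.2.2.2 k')⟫_ℝ) =O[L] fun z => z.1 * z.1 := by
    intro p' k' h
    refine IsBigO.of_bound 1 (hLS.mono fun z hz => ?_)
    rw [one_mul, ← sq, Real.norm_eq_abs, Real.norm_of_nonneg (sq_nonneg _)]
    exact hz.off p' k' h
  have hlow : ∀ᶠ z in L, 0 ≤ c * z.1 ∧ c * z.1 ≤ ⟪z.2.2.1 p, lin (T z.2.1).X (z.2.2.2 k)⟫_ℝ := by
    filter_upwards [hLS, hτpos] with z hz hz'
    exact ⟨by positivity, hz.lower⟩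
  have hbil : ∀ᶠ z in L, ∀ p k, ((T z.2.1).rescale (√(n z.2.1) * √(nd z.2.1))).bil
      (((initParams (U₂ z.2.1) z.2.2).rescale √(n z.2.1) √(nd z.2.1)).U₁ p)
      (((initParams (U₂ z.2.1) z.2.2).rescale √(n z.2.1) √(nd z.2.1)).U₃ k) =
      ⟪z.2.2.1 p, lin (T z.2.1).X (z.2.2.2 k)⟫_ℝ := by
    filter_upwards [hπ.eventually hA.eventually_pos] with z hpos p k
    rw [Task.rescale_bil _ (sqrt_ne_zero hpos.1) (sqrt_ne_zero hpos.2), Task.bil_eq]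
    rfl
  have hR := hA.regular (s := fun z => z.1) (fun j => (hrate j).1) hπ (fun z => z.2.2) (C := C)
    (hLS.mono fun z h => h.norm_left) (hLS.mono fun z h => h.norm_right) hs (fun p' k' => by
      by_cases h : (p', k') = (p, k)
      · obtain ⟨rfl, rfl⟩ := Prod.mk.inj h
        refine IsBigO.of_bound C ?_
        filter_upwards [hLS, hτpos, hlow] with z hz hz' hz2
        rw [Real.norm_of_nonneg (hz2.1.trans hz2.2), Real.norm_of_nonneg hz'.le]
        exact hz.upper
      · exact (hoff p' k' h).trans (isBigO_mul_one (isBigO_refl _ _) hs))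
  refine { toRegular := hR, tendsto := hτ0, rate_nonneg := ?_, one_le_rate := ?_,
           one_le_pairing := ?_, bil_nonneg := ?_, le_bil := ?_, off := ?_ }
  · intro z j
    have := fun j => (hη.pos z.2.1 j).le
    fin_cases j
    · exact this 0
    · exact mul_nonneg (sq_nonneg _) (this 1)
    · exact this 2
    · exact mul_nonneg (sq_nonneg _) (this 3)
  · exact fun j => (hrate j).2.comp_tendsto hπ
  · intro q
    refine IsBigO.trans ((hA.inner q).2.comp_tendsto hπ) (IsBigO.of_bound 1 ?_)
    filter_upwards [hπ.eventually hA.eventually_pos] with z hpos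
    rw [Task.pairing, Task.rescale_initialResidual _
      (mul_ne_zero (sqrt_ne_zero hpos.1) (sqrt_ne_zero hpos.2)), one_mul, real_inner_comm]
    rfl
  · filter_upwards [hbil, hlow] with z hz hz2
    rw [hz]
    exact hz2.1.trans hz2.2
  · refine IsBigO.of_bound c⁻¹ ?_
    filter_upwards [hbil, hlow, hτpos] with z hz hz2 hz3
    rw [hz, Real.norm_of_nonneg hz3.le, Real.norm_of_nonneg (hz2.1.trans hz2.2),
      le_inv_mul_iff₀ hc]
    exact hz2.2
  · intro p' k' h
    refine (hoff p' k' h).congr' ?_ .rfl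
    filter_upwards [hbil] with z hz
    rw [hz]

end Admissible

/-! ### Efficiency for the tuned rates -/

variable {r₁ r₂ r₃ : ℕ} {ι : Type*} {l : Filter ι} {n m nd : ι → ℕ}
  {T : ∀ i, Task (n i) (m i) (nd i)} {U₂ : ∀ i, Fin r₂ → EuclideanSpace ℝ (Fin (m i))}
  {η : ι → Fin 4 → ℝ}

lemma one_isBigO_norm_sq {κ : Type*} {L : Filter κ} {E : κ → Type*}
    [∀ z, NormedAddCommGroup (E z)] [∀ z, NormedSpace ℝ (E z)] {x y : ∀ z, E z} {a : κ → ℝ}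
    {c : ℝ} (hc : 0 < c) (h : ∀ᶠ z in L, 0 < a z ∧ √(a z) • x z = y z ∧ c * a z ≤ ‖y z‖ ^ 2) :
    (1 : κ → ℝ) =O[L] fun z => ‖x z‖ ^ 2 := by
  refine IsBigO.of_bound c⁻¹ ?_
  filter_upwards [h] with z ⟨ha, hxy, hz⟩
  rw [← hxy, norm_smul, mul_pow, Real.norm_of_nonneg (Real.sqrt_nonneg _), Real.sq_sqrt ha.le,
    mul_comm] at hz
  rw [Pi.one_apply, norm_one, le_inv_mul_iff₀ hc, mul_one, Real.norm_of_nonneg (sq_nonneg _)]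
  exact le_of_mul_le_mul_left hz ha

namespace Admissible

/-- Transfer of asymptotic lower bounds from the rescaled models. -/
lemma isBigO_inner_term (hA : Admissible l T U₂) {t : ℕ} {j : TermIndex r₁ r₂ r₃} {g : ℝ → ℝ}
    {Q : ℝ → ∀ i, Set (Init r₁ r₃ (n i) (nd i))}
    (h : (fun z => g z.1) =O[smallScale l Q] fun z =>
      ⟪((T z.2.1).rescale (√(n z.2.1) * √(nd z.2.1))).term
        (rescaleRates (η z.2.1) √(n z.2.1) √(nd z.2.1))
        (((T z.2.1).rescale (√(n z.2.1) * √(nd z.2.1))).gd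
          (rescaleRates (η z.2.1) √(n z.2.1) √(nd z.2.1))
          ((initParams (U₂ z.2.1) z.2.2).rescale √(n z.2.1) √(nd z.2.1)) t) j,
        ((T z.2.1).rescale (√(n z.2.1) * √(nd z.2.1))).initialResidual⟫_ℝ) :
    (fun z => g z.1) =O[smallScale l Q] fun z =>
      ⟪(T z.2.1).term (η z.2.1) ((T z.2.1).gd (η z.2.1) (initParams (U₂ z.2.1) z.2.2) t) j,
        (T z.2.1).initialResidual⟫_ℝ := by
  refine h.congr' .rfl ?_
  filter_upwards [(tendsto_smallScale l _).eventually hA.eventually_pos] with z hpos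
  rw [term_rescale _ _ _ _ _ hpos.1 hpos.2,
    Task.rescale_initialResidual _ (mul_ne_zero (sqrt_ne_zero hpos.1) (sqrt_ne_zero hpos.2))]

/-- With positive probability the component of each first-order term along the initial residual
is bounded below. -/
lemma exists_le_inner_term (hA : Admissible l T U₂) (hη : TunedRates l n nd η) (hr₁ : 0 < r₁)
    (hr₂ : 0 < r₂) (hr₃ : 0 < r₃) (t : ℕ) (j : TermIndex r₁ r₂ r₃) :
    ∃ a π : ℝ, 0 < a ∧ 0 < π ∧ ∀ᶠ i in l, π ≤ (initLaw r₁ r₃ (n i) (nd i)).real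
      {ω | a ≤ |⟪(T i).term (η i) ((T i).gd (η i) (initParams (U₂ i) ω) (t + 1)) j,
        (T i).initialResidual⟫_ℝ|} := by
  obtain ⟨κ, K, hκ, hK, hX⟩ := hA.eventually_frob
  obtain ⟨c, C, hc, -, H⟩ := exists_nearlySingle_right r₁ r₃ hκ hK
  obtain ⟨c', C', hc', -, H'⟩ := exists_nearlySingle_left r₁ r₃ hκ hK
  have hright : ∀ p k τ, 0 < τ → τ ≤ 1 → ∃ π : ℝ, 0 < π ∧ ∀ᶠ i in l,
      π ≤ (initLaw r₁ r₃ (n i) (nd i)).real {ω | NearlySingle (T i).X p k c C τ ω.1 ω.2 ∧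
        c * n i ≤ ‖lin (T i).X (ω.2 k)‖ ^ 2} := by
    intro p k τ hτ hτ1
    obtain ⟨π, hπ, H⟩ := H τ hτ hτ1
    refine ⟨π, hπ, ?_⟩
    filter_upwards [hX, hA.eventually_pos] with i hi hpos
    exact H hpos.1 hpos.2 _ hi.1 hi.2 p k
  have hleft : ∀ p k τ, 0 < τ → τ ≤ 1 → ∃ π : ℝ, 0 < π ∧ ∀ᶠ i in l,
      π ≤ (initLaw r₁ r₃ (n i) (nd i)).real {ω | NearlySingle (T i).X p k c' C' τ ω.1 ω.2 ∧
        c' * nd i ≤ ‖lin (T i).Xᵀ (ω.1 p)‖ ^ 2} := by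
    intro p k τ hτ hτ1
    obtain ⟨π, hπ, H'⟩ := H' τ hτ hτ1
    refine ⟨π, hπ, ?_⟩
    filter_upwards [hX, hA.eventually_pos] with i hi hpos
    exact H' hpos.1 hpos.2 _ hi.1 hi.2 p k
  have hER := fun p k => hA.excited hη hc (fun τ i => {ω : Init r₁ r₃ (n i) (nd i) |
    NearlySingle (T i).X p k c C τ ω.1 ω.2 ∧ c * n i ≤ ‖lin (T i).X (ω.2 k)‖ ^ 2})
    (fun _ _ _ h => h.1)
  have hEL := fun p k => hA.excited hη hc' (fun τ i => {ω : Init r₁ r₃ (n i) (nd i) |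
    NearlySingle (T i).X p k c' C' τ ω.1 ω.2 ∧ c' * nd i ≤ ‖lin (T i).Xᵀ (ω.1 p)‖ ^ 2})
    (fun _ _ _ h => h.1)
  have hsq : ∀ τ : ℝ, 0 < τ → 0 < τ * τ := fun τ hτ => mul_pos hτ hτ
  rcases j with ⟨p, q, k⟩ | p | q | k
  · exact exists_le_measureReal_of_isBigO _ _ (hright p k) hsq
      (hA.isBigO_inner_term (g := fun τ => τ * τ)
        ((hER p k).le_delta₀ (t + 1) q))
  -- The term depends on `p` only, so any column of `U₃` may carry the dominant pairing; positivity
  -- of the ranks provides one.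
  · refine exists_le_measureReal_of_isBigO _ _ (hright p ⟨0, hr₃⟩) hsq
      (hA.isBigO_inner_term (g := fun τ => τ * τ)
        ((hER p ⟨0, hr₃⟩).le_delta₁ t ⟨0, hr₂⟩ (one_isBigO_norm_sq
          (y := fun z => lin (T z.2.1).X (z.2.2.2 ⟨0, hr₃⟩)) (a := fun z => n z.2.1) hc ?_)))
    filter_upwards [(tendsto_smallScale l _).eventually hA.eventually_pos,
      eventually_inf_principal.2 (.of_forall fun _ h => h)] with z hpos hz
    exact ⟨by exact_mod_cast hpos.1, Task.rescale_lin _ (sqrt_ne_zero hpos.1)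
      (sqrt_ne_zero hpos.2) _, hz.2⟩
  · exact exists_le_measureReal_of_isBigO _ _ (hright ⟨0, hr₁⟩ ⟨0, hr₃⟩)
      (fun τ hτ => mul_pos (hsq τ hτ) (hsq τ hτ))
      (hA.isBigO_inner_term (g := fun τ => τ * τ * (τ * τ))
        ((hER ⟨0, hr₁⟩ ⟨0, hr₃⟩).le_delta₂ t q))
  · refine exists_le_measureReal_of_isBigO _ _ (hleft ⟨0, hr₁⟩ k) hsq
      (hA.isBigO_inner_term (g := fun τ => τ * τ)
        ((hEL ⟨0, hr₁⟩ k).le_delta₃ t ⟨0, hr₂⟩ (one_isBigO_norm_sq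
          (y := fun z => lin (T z.2.1).Xᵀ (z.2.2.1 ⟨0, hr₁⟩)) (a := fun z => nd z.2.1) hc' ?_)))
    filter_upwards [(tendsto_smallScale l _).eventually hA.eventually_pos,
      eventually_inf_principal.2 (.of_forall fun _ h => h)] with z hpos hz
    exact ⟨by exact_mod_cast hpos.2, Task.rescale_lin_transpose _ (sqrt_ne_zero hpos.1)
      (sqrt_ne_zero hpos.2) _, hz.2⟩

/-- With high probability all first-order terms are bounded below. -/
lemma exists_le_norm_term (hA : Admissible l T U₂) (hη : TunedRates l n nd η) (hr₁ : 0 < r₁)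
    (hr₂ : 0 < r₂) (hr₃ : 0 < r₃) (t : ℕ) {ε : ℝ} (hε : 0 < ε) :
    ∃ c : ℝ, 0 < c ∧ ∀ᶠ i in l, (initLaw r₁ r₃ (n i) (nd i)).real
      {ω | ∃ j, ‖(T i).term (η i) ((T i).gd (η i) (initParams (U₂ i) ω) (t + 1)) j‖ < c} ≤ ε := by
  have hcard : (0 : ℝ) < Fintype.card (TermIndex r₁ r₂ r₃) := by
    have : Nonempty (TermIndex r₁ r₂ r₃) := ⟨.inr (.inl ⟨0, hr₁⟩)⟩
    exact_mod_cast Fintype.card_pos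
  have h1 : ∀ j : TermIndex r₁ r₂ r₃, ∃ c : ℝ, 0 < c ∧ ∀ᶠ i in l,
      (initLaw r₁ r₃ (n i) (nd i)).real {ω | |⟪(T i).term (η i)
        ((T i).gd (η i) (initParams (U₂ i) ω) (t + 1)) j, (T i).initialResidual⟫_ℝ| < c} ≤
        ε / Fintype.card (TermIndex r₁ r₂ r₃) := by
    intro j
    obtain ⟨a, π, ha, hπ, h⟩ := hA.exists_le_inner_term hη hr₁ hr₂ hr₃ t j
    -- The degree is independent of the model; the summand 0 is the degree of the constant initial
    -- residual.
    exact exists_measureReal_lt_le (10 * 7 ^ (t + 1) + 0) (fun i =>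
      (vecPoly_term (T i) (η i) (U₂ i) (t + 1) j).inner (.const _)) ha hπ (by positivity) h
  choose c hc h1 using h1
  obtain ⟨K, hK, hv⟩ := hA.res.exists_pos
  obtain ⟨j₀, hj₀⟩ := @Finite.exists_min (TermIndex r₁ r₂ r₃) ℝ _ ⟨.inr (.inl ⟨0, hr₁⟩)⟩ _ c
  -- By Cauchy–Schwarz a component along a vector of norm at most K is at most K times the norm of
  -- the term.
  refine ⟨c j₀ / K, div_pos (hc j₀) hK, ?_⟩
  filter_upwards [hv.bound, eventually_all.2 h1] with i hi hi1
  rw [norm_norm, norm_one, mul_one] at hi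
  calc _ ≤ (initLaw r₁ r₃ (n i) (nd i)).real (⋃ j, {ω | |⟪(T i).term (η i)
        ((T i).gd (η i) (initParams (U₂ i) ω) (t + 1)) j, (T i).initialResidual⟫_ℝ| < c j}) := by
        refine measureReal_mono fun ω ⟨j, hj⟩ => Set.mem_iUnion.2 ⟨j, ?_⟩
        refine lt_of_le_of_lt (abs_real_inner_le_norm _ _) (lt_of_le_of_lt
          (mul_le_mul_of_nonneg_left hi (norm_nonneg _)) ?_)
        rw [lt_div_iff₀ hK] at hj
        exact hj.trans_le (hj₀ j)
    _ ≤ ∑ j, ε / Fintype.card (TermIndex r₁ r₂ r₃) :=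
        (measureReal_iUnion_fintype_le _).trans (Finset.sum_le_sum fun j _ => hi1 j)
    _ = ε := by
        rw [Finset.sum_const, Finset.card_univ, nsmul_eq_mul]
        field_simp

theorem isEfficient (hA : Admissible l T U₂) (hη : TunedRates l n nd η) (hr₁ : 0 < r₁)
    (hr₂ : 0 < r₂) (hr₃ : 0 < r₃) : IsEfficient r₁ r₃ l T η U₂ := by
  intro t ht ε hε
  -- Step t' + 2 starts after t' + 1 updates, so the core has already left zero.
  obtain ⟨t, rfl⟩ : ∃ t', t = t' + 2 := ⟨t - 2, by omega⟩
  obtain ⟨C, hC⟩ := hA.exists_norm_term_le r₁ r₃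
    (fun j => (hη.rescale_isTheta hA.tendsto_n hA.tendsto_nd j).1) (t + 1) (half_pos hε)
  obtain ⟨c, hc, hc'⟩ := hA.exists_le_norm_term hη hr₁ hr₂ hr₃ t (half_pos hε)
  refine ⟨c, max c C, hc, le_max_left _ _, ?_⟩
  filter_upwards [hC, hc'] with i hi hi'
  rw [probWithin]
  have hsub : {ω | ∀ j, ‖(T i).term (η i) ((T i).gd (η i) (initParams (U₂ i) ω) (t + 1)) j‖ ≤ C} ⊆
      {ω : Init r₁ r₃ (n i) (nd i) | (T i).TermsWithin (η i)
        ((T i).gd (η i) (initParams (U₂ i) ω) (t + 2 - 1)) c (max c C)} ∪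
      {ω | ∃ j, ‖(T i).term (η i) ((T i).gd (η i) (initParams (U₂ i) ω) (t + 1)) j‖ < c} := by
    intro ω hω
    by_cases h : ∃ j, ‖(T i).term (η i) ((T i).gd (η i) (initParams (U₂ i) ω) (t + 1)) j‖ < c
    · exact .inr h
    · push Not at h
      exact .inl ((Task.termsWithin_iff _ _ _ _ _).2 fun j =>
        ⟨h j, (hω j).trans (le_max_right _ _)⟩)
  have := (measureReal_mono (μ := initLaw r₁ r₃ (n i) (nd i)) hsub).trans
    (measureReal_union_le _ _)
  linarith

end Admissible

/-! ### Rates of equal order: closed forms at the second step and inefficiency -/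

section FirstStep

variable {r₁ r₂ r₃ n m nd : ℕ} (T : Task n m nd) (η : Fin 4 → ℝ)
  (U₂ : Fin r₂ → EuclideanSpace ℝ (Fin m)) (ω : Init r₁ r₃ n nd)

/-- The sum of the squared initial pairings `u₁ᵀ X u₃`. -/
def Task.energy {r₁ r₃ n m nd : ℕ} (T : Task n m nd) (ω : Init r₁ r₃ n nd) : ℝ :=
  ∑ p, ∑ k, T.bil (ω.1 p) (ω.2 k) ^ 2

/-- The combination of the columns of `U₂` with their pairings with the initial residual. -/
def Task.direction (T : Task n m nd) (U₂ : Fin r₂ → EuclideanSpace ℝ (Fin m)) :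
    EuclideanSpace ℝ (Fin m) :=
  ∑ q, ⟪T.initialResidual, U₂ q⟫_ℝ • U₂ q

/-- The combination of the columns of `U₃` with their initial pairings with a column of `U₁`. -/
def Task.mixture {r₁ r₃ n m nd : ℕ} (T : Task n m nd) (ω : Init r₁ r₃ n nd) (p : Fin r₁) :
    EuclideanSpace ℝ (Fin nd) :=
  ∑ k, T.bil (ω.1 p) (ω.2 k) • ω.2 k

lemma Task.energy_nonneg : 0 ≤ T.energy ω :=
  Finset.sum_nonneg fun _ _ => Finset.sum_nonneg fun _ _ => sq_nonneg _

lemma Task.coef_initParams (q : Fin r₂) : T.coef (initParams U₂ ω) q = 0 := by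
  simp [Task.coef, initParams]

lemma Task.contr_initParams (p : Fin r₁) (k : Fin r₃) : T.contr (initParams U₂ ω) p k = 0 := by
  simp [Task.contr, initParams]

lemma Task.residual_initParams : T.residual (initParams U₂ ω) = T.initialResidual := by
  rw [Task.residual_eq, Task.adapter_eq_sum_coef]
  simp [Task.coef_initParams]

lemma Task.gdStep_initParams_G (p : Fin r₁) (q : Fin r₂) (k : Fin r₃) :
    (T.gdStep η (initParams U₂ ω)).G (p, q, k) =
      -(η 0 * (⟪T.initialResidual, U₂ q⟫_ℝ * T.bil (ω.1 p) (ω.2 k))) := by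
  rw [Task.gdStep_G, Task.residual_initParams]
  simp [initParams]

lemma Task.gdStep_initParams_U₁ (p : Fin r₁) : (T.gdStep η (initParams U₂ ω)).U₁ p = ω.1 p := by
  rw [Task.gdStep_U₁]
  simp only [Task.contr_initParams, zero_smul, Finset.sum_const_zero, smul_zero, sub_zero]
  rfl

lemma Task.gdStep_initParams_U₂ (q : Fin r₂) : (T.gdStep η (initParams U₂ ω)).U₂ q = U₂ q := by
  rw [Task.gdStep_U₂]
  simp only [Task.coef_initParams, zero_smul, smul_zero, sub_zero]
  rfl

lemma Task.gdStep_initParams_U₃ (k : Fin r₃) : (T.gdStep η (initParams U₂ ω)).U₃ k = ω.2 k := by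
  rw [Task.gdStep_U₃]
  simp only [Task.contr_initParams, zero_smul, Finset.sum_const_zero, smul_zero, sub_zero]
  rfl

lemma Task.coef_gdStep_initParams (q : Fin r₂) :
    T.coef (T.gdStep η (initParams U₂ ω)) q =
      -(η 0 * ⟪T.initialResidual, U₂ q⟫_ℝ * T.energy ω) := by
  simp only [Task.coef, Task.energy, Task.gdStep_initParams_G, Task.gdStep_initParams_U₁,
    Task.gdStep_initParams_U₃, Finset.mul_sum, ← Finset.sum_neg_distrib]
  refine Finset.sum_congr rfl fun p _ => Finset.sum_congr rfl fun k _ => ?_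
  ring

lemma Task.residual_gdStep_initParams :
    T.residual (T.gdStep η (initParams U₂ ω)) =
      T.initialResidual - (η 0 * T.energy ω) • T.direction U₂ := by
  rw [Task.residual_eq, Task.adapter_eq_sum_coef, sub_eq_add_neg, Task.direction, Finset.smul_sum,
    ← Finset.sum_neg_distrib]
  congr 1
  refine Finset.sum_congr rfl fun q _ => ?_
  rw [Task.coef_gdStep_initParams, Task.gdStep_initParams_U₂, smul_smul, ← neg_smul]
  congr 1
  ring

lemma Task.inner_direction (v : EuclideanSpace ℝ (Fin m)) :
    ⟪v, T.direction U₂⟫_ℝ = ∑ q, ⟪T.initialResidual, U₂ q⟫_ℝ * ⟪v, U₂ q⟫_ℝ := by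
  simp [Task.direction, inner_sum, inner_smul_right]

lemma Task.contr_gdStep_initParams (p : Fin r₁) (k : Fin r₃) :
    T.contr (T.gdStep η (initParams U₂ ω)) p k = -(η 0 *
      ⟪T.residual (T.gdStep η (initParams U₂ ω)), T.direction U₂⟫_ℝ) * T.bil (ω.1 p) (ω.2 k) := by
  rw [Task.inner_direction, Task.contr, Finset.mul_sum, ← Finset.sum_neg_distrib, Finset.sum_mul]
  refine Finset.sum_congr rfl fun q _ => ?_
  rw [Task.gdStep_initParams_G, Task.gdStep_initParams_U₂]
  ring

lemma Task.delta₂_gdStep_initParams (q : Fin r₂) :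
    T.delta₂ η (T.gdStep η (initParams U₂ ω)) q =
      (-(η 2 * (η 0 * ⟪T.initialResidual, U₂ q⟫_ℝ * T.energy ω) ^ 2)) •
        (T.initialResidual - (η 0 * T.energy ω) • T.direction U₂) := by
  rw [Task.delta₂_eq, Task.coef_gdStep_initParams, neg_sq, Task.residual_gdStep_initParams]

/-- After the first step the core is the product of the pairings with the residual, indexed by q,
and the pairings of columns, indexed by p and k. This separation collapses the sums over q onto
`direction` and those over k onto `mixture`. -/
lemma Task.delta₁_gdStep_initParams (p : Fin r₁) :
    T.delta₁ η (T.gdStep η (initParams U₂ ω)) p =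
      (-(η 1 * η 0 ^ 2 * (⟪T.initialResidual, T.direction U₂⟫_ℝ -
        η 0 * T.energy ω * ‖T.direction U₂‖ ^ 2) *
        ‖lin T.X (T.mixture ω p)‖ ^ 2)) • T.direction U₂ := by
  have h1 : ∑ k', T.contr (T.gdStep η (initParams U₂ ω)) p k' •
      lin T.X ((T.gdStep η (initParams U₂ ω)).U₃ k') =
      (-(η 0 * ⟪T.residual (T.gdStep η (initParams U₂ ω)), T.direction U₂⟫_ℝ)) •
        lin T.X (T.mixture ω p) := by
    simp only [Task.contr_gdStep_initParams, Task.gdStep_initParams_U₃, Task.mixture, map_sum,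
      map_smul, Finset.smul_sum, smul_smul]
  have h0 : ‖lin T.X (T.mixture ω p)‖ ^ 2 =
      ∑ k, T.bil (ω.1 p) (ω.2 k) * ⟪lin T.X (T.mixture ω p), lin T.X (ω.2 k)⟫_ℝ := by
    have : lin T.X (T.mixture ω p) = ∑ k, T.bil (ω.1 p) (ω.2 k) • lin T.X (ω.2 k) := by
      simp only [Task.mixture, map_sum, map_smul]
    rw [← real_inner_self_eq_norm_sq]
    nth_rewrite 2 [this]
    simp only [inner_sum, inner_smul_right]
  have h2 : ∀ (a : ℝ) q, ∑ k, (T.gdStep η (initParams U₂ ω)).G (p, q, k) *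
      ⟪a • lin T.X (T.mixture ω p), lin T.X ((T.gdStep η (initParams U₂ ω)).U₃ k)⟫_ℝ =
      a * (-(η 0 * ⟪T.initialResidual, U₂ q⟫_ℝ) * ‖lin T.X (T.mixture ω p)‖ ^ 2) := by
    intro a q
    rw [h0, Finset.mul_sum, Finset.mul_sum]
    refine Finset.sum_congr rfl fun k _ => ?_
    rw [Task.gdStep_initParams_G, Task.gdStep_initParams_U₃, inner_smul_left, conj_trivial]
    ring
  have h3 : ⟪T.residual (T.gdStep η (initParams U₂ ω)), T.direction U₂⟫_ℝ =
      ⟪T.initialResidual, T.direction U₂⟫_ℝ - η 0 * T.energy ω * ‖T.direction U₂‖ ^ 2 := by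
    rw [Task.residual_gdStep_initParams, inner_sub_left, inner_smul_left,
      real_inner_self_eq_norm_sq]
    rfl
  rw [Task.delta₁_eq, h1]
  simp only [h2, h3, Task.gdStep_initParams_U₂]
  generalize ⟪T.initialResidual, T.direction U₂⟫_ℝ - η 0 * T.energy ω * ‖T.direction U₂‖ ^ 2 = a
  rw [Task.direction, Finset.smul_sum, Finset.smul_sum]
  refine Finset.sum_congr rfl fun q _ => ?_
  rw [smul_smul, smul_smul]
  congr 1
  ring

end FirstStep

section NearlySingle

variable {r₁ r₃ n m nd : ℕ} {T : Task n m nd} {ω : Init r₁ r₃ n nd} {p : Fin r₁} {k : Fin r₃}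
  {c C τ : ℝ}

lemma NearlySingle.le_energy (h : NearlySingle T.X p k c C τ ω.1 ω.2) (hc : 0 < c) (hτ : 0 < τ) :
    (c * τ) ^ 2 ≤ T.energy ω := by
  calc (c * τ) ^ 2 ≤ T.bil (ω.1 p) (ω.2 k) ^ 2 := by
        rw [Task.bil_eq]
        exact pow_le_pow_left₀ (by positivity) h.lower 2
    _ ≤ ∑ k, T.bil (ω.1 p) (ω.2 k) ^ 2 := Finset.single_le_sum
        (f := fun k => T.bil (ω.1 p) (ω.2 k) ^ 2) (fun _ _ => sq_nonneg _) (Finset.mem_univ k)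
    _ ≤ _ := Finset.single_le_sum (f := fun p => ∑ k, T.bil (ω.1 p) (ω.2 k) ^ 2)
        (fun _ _ => Finset.sum_nonneg fun _ _ => sq_nonneg _) (Finset.mem_univ p)

lemma NearlySingle.energy_le (h : NearlySingle T.X p k c C τ ω.1 ω.2) (hc : 0 < c)
    (hτ : 0 < τ) (hτ1 : τ ≤ 1) : T.energy ω ≤ r₁ * r₃ * (C ^ 2 + 1) * τ ^ 2 := by
  have h1 : ∀ p' k', T.bil (ω.1 p') (ω.2 k') ^ 2 ≤ (C ^ 2 + 1) * τ ^ 2 := by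
    intro p' k'
    rw [Task.bil_eq]
    by_cases hpk : (p', k') = (p, k)
    · obtain ⟨rfl, rfl⟩ := Prod.mk.inj hpk
      have h2 := pow_le_pow_left₀ ((mul_pos hc hτ).le.trans h.lower) h.upper 2
      nlinarith [sq_nonneg τ]
    · have h2 := h.off p' k' hpk
      rw [← sq_abs]
      have h3 : τ ^ 2 ≤ τ := by nlinarith
      have h4 := pow_le_pow_left₀ (abs_nonneg _) (h2.trans h3) 2
      nlinarith [sq_nonneg (C * τ)]
  calc T.energy ω ≤ ∑ _p : Fin r₁, ∑ _k : Fin r₃, (C ^ 2 + 1) * τ ^ 2 :=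
        Finset.sum_le_sum fun p _ => Finset.sum_le_sum fun k _ => h1 p k
    _ = _ := by simp; ring

/-- The dominant summand has image of norm at least c τ √(c n), and each of the others at most τ²
√(C n). For small τ the difference is a positive multiple of √n. -/
lemma NearlySingle.le_norm_mixture (h : NearlySingle T.X p k c C τ ω.1 ω.2) (hc : 0 < c)
    (hτ : 0 < τ) (hk : c * n ≤ ‖lin T.X (ω.2 k)‖ ^ 2) :
    (c * √c * τ - r₃ * √C * τ ^ 2) * √n ≤ ‖lin T.X (T.mixture ω p)‖ := by
  have h1 : √(c * n) ≤ ‖lin T.X (ω.2 k)‖ := Real.sqrt_le_iff.2 ⟨norm_nonneg _, hk⟩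
  have h2 : ∀ k', ‖lin T.X (ω.2 k')‖ ≤ √(C * n) := fun k' =>
    Real.le_sqrt_of_sq_le (h.norm_right k')
  have hC : 0 ≤ C ∨ n = 0 := by
    rcases Nat.eq_zero_or_pos n with h0 | h0
    · exact .inr h0
    · have := (sq_nonneg _).trans (h.norm_right k)
      have h0' : (0 : ℝ) < n := by exact_mod_cast h0
      exact .inl (nonneg_of_mul_nonneg_left this h0')
  have h3 : √(C * n) = √C * √n := by
    rcases hC with hC | rfl
    · exact Real.sqrt_mul hC _
    · simp
  have h4 : T.bil (ω.1 p) (ω.2 k) • lin T.X (ω.2 k) = lin T.X (T.mixture ω p) -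
      ∑ k' ∈ Finset.univ.erase k, T.bil (ω.1 p) (ω.2 k') • lin T.X (ω.2 k') := by
    rw [Task.mixture, map_sum, ← Finset.add_sum_erase _ _ (Finset.mem_univ k)]
    simp
  have h5 : ‖∑ k' ∈ Finset.univ.erase k, T.bil (ω.1 p) (ω.2 k') • lin T.X (ω.2 k')‖ ≤
      r₃ * (τ ^ 2 * (√C * √n)) := by
    calc _ ≤ ∑ k' ∈ Finset.univ.erase k, τ ^ 2 * (√C * √n) := by
          refine (norm_sum_le _ _).trans (Finset.sum_le_sum fun k' hk' => ?_)
          rw [norm_smul, Task.bil_eq, ← h3]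
          refine mul_le_mul (h.off p k' ?_) (h2 k') (norm_nonneg _) (sq_nonneg _)
          intro he
          exact Finset.ne_of_mem_erase hk' (Prod.mk.inj he).2
      _ ≤ ∑ _k' : Fin r₃, τ ^ 2 * (√C * √n) :=
          Finset.sum_le_univ_sum_of_nonneg fun _ => by positivity
      _ = _ := by simp
  have h6 : c * τ * (√c * √n) ≤ ‖T.bil (ω.1 p) (ω.2 k) • lin T.X (ω.2 k)‖ := by
    rw [norm_smul, Task.bil_eq, ← Real.sqrt_mul hc.le]
    exact mul_le_mul (h.lower.trans (le_abs_self _)) h1 (Real.sqrt_nonneg _) (norm_nonneg _)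
  rw [h4] at h6
  have h7 := h6.trans (norm_sub_le _ _)
  nlinarith

end NearlySingle

variable {r₁ r₂ r₃ : ℕ} {ι : Type*} {l : Filter ι} {n m nd : ι → ℕ}
  {T : ∀ i, Task (n i) (m i) (nd i)} {U₂ : ∀ i, Fin r₂ → EuclideanSpace ℝ (Fin (m i))}

lemma isPoly_bil {n m nd : ℕ} (T : Task n m nd) (p : Fin r₁) (k : Fin r₃) :
    IsPoly 2 (fun ω : Init r₁ r₃ n nd => T.bil (ω.1 p) (ω.2 k)) :=
  (paramsPoly_initParams (r₁ := r₁) (r₃ := r₃) (n := n) (nd := nd)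
    (fun _ : Fin 0 => (0 : EuclideanSpace ℝ (Fin m)))).bil T p k

lemma isPoly_energy {n m nd : ℕ} (T : Task n m nd) :
    IsPoly 4 (fun ω : Init r₁ r₃ n nd => T.energy ω) :=
  .sum _ fun p _ => .sum _ fun k _ => (isPoly_bil T p k).pow 2

lemma isPoly_norm_sq_mixture {n m nd : ℕ} (T : Task n m nd) (p : Fin r₁) :
    IsPoly 6 (fun ω : Init r₁ r₃ n nd => ‖lin T.X (T.mixture ω p)‖ ^ 2) := by
  have h : VecPoly 3 (fun ω : Init r₁ r₃ n nd => lin T.X (T.mixture ω p)) :=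
    .lin _ (.sum _ fun k _ => .smul (isPoly_bil T p k)
      ((paramsPoly_initParams (r₁ := r₁) (r₃ := r₃) (n := n) (nd := nd)
        (fun _ : Fin 0 => (0 : EuclideanSpace ℝ (Fin m)))).U₃ k))
  simpa only [real_inner_self_eq_norm_sq] using h.inner h

namespace Admissible

/-- The energy does not concentrate near any deterministic value. -/
lemma exists_energy_sub_lt_le (hA : Admissible l T U₂) (hr₁ : 0 < r₁) (hr₃ : 0 < r₃)
    (x : ι → ℝ) {ε : ℝ} (hε : 0 < ε) :
    ∃ c : ℝ, 0 < c ∧ ∀ᶠ i in l, (initLaw r₁ r₃ (n i) (nd i)).real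
      {ω | |(T i).energy ω - x i| < c} ≤ ε := by
  obtain ⟨κ, K, hκ, hK, hX⟩ := hA.eventually_frob
  obtain ⟨c, C, hc, hC, H⟩ := exists_nearlySingle_right r₁ r₃ hκ hK
  obtain ⟨τ, hτ, hτ1, hτ2⟩ : ∃ τ : ℝ, 0 < τ ∧ τ ≤ 1 ∧
      r₁ * r₃ * (C ^ 2 + 1) * τ ^ 2 ≤ c ^ 2 / 2 := by
    have ht : Tendsto (fun τ : ℝ => r₁ * r₃ * (C ^ 2 + 1) * τ ^ 2) (𝓝[>] 0) (𝓝 0) := by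
      have : Continuous fun τ : ℝ => r₁ * r₃ * (C ^ 2 + 1) * τ ^ 2 := by fun_prop
      simpa using (this.tendsto 0).mono_left nhdsWithin_le_nhds
    have h1 := ht.eventually (eventually_le_nhds (show (0 : ℝ) < c ^ 2 / 2 by positivity))
    obtain ⟨τ, h1, h2, h3⟩ := (h1.and (Eventually.and self_mem_nhdsWithin
      (nhdsWithin_le_nhds (eventually_le_nhds (one_pos : (0 : ℝ) < 1))))).exists
    exact ⟨τ, h2, h3, h1⟩
  obtain ⟨π₁, hπ₁, H₁⟩ := H τ hτ hτ1
  obtain ⟨π₂, hπ₂, H₂⟩ := H 1 one_pos le_rfl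
  refine exists_measureReal_lt_le 4 (F := fun i ω => (T i).energy ω - x i)
    (fun i => (isPoly_energy (T i)).sub (.const _)) (a := c ^ 2 / 4) (p := min π₁ π₂)
    (by positivity) (lt_min hπ₁ hπ₂) hε ?_
  filter_upwards [hX, hA.eventually_pos] with i hi hpos
  -- The energy is at least c² on the event with τ = 1 and at most c²/2 on the event with small τ,
  -- so on one of the two it is at distance at least c²/4 from `x i`.
  rcases le_total (x i) (3 * c ^ 2 / 4) with hx | hx
  · refine (min_le_right _ _).trans ((H₂ hpos.1 hpos.2 (T i).X hi.1 hi.2 ⟨0, hr₁⟩ ⟨0, hr₃⟩).trans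
      (measureReal_mono fun ω hω => ?_))
    have h1 := hω.1.le_energy hc one_pos
    have h2 : c ^ 2 / 4 ≤ (T i).energy ω - x i := by linarith
    exact h2.trans (le_abs_self _)
  · refine (min_le_left _ _).trans ((H₁ hpos.1 hpos.2 (T i).X hi.1 hi.2 ⟨0, hr₁⟩ ⟨0, hr₃⟩).trans
      (measureReal_mono fun ω hω => ?_))
    have h1 := hω.1.energy_le hc hτ hτ1
    have h2 : c ^ 2 / 4 ≤ -((T i).energy ω - x i) := by linarith
    exact h2.trans (neg_le_abs _)

/-- After division by n this squared norm is a polynomial of degree 6 that is bounded below on a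
`NearlySingle` event, so the small-ball bound applies. -/
lemma exists_mixture_lt_le (hA : Admissible l T U₂) (hr₃ : 0 < r₃) (p : Fin r₁) {ε : ℝ}
    (hε : 0 < ε) :
    ∃ c : ℝ, 0 < c ∧ ∀ᶠ i in l, (initLaw r₁ r₃ (n i) (nd i)).real
      {ω | ‖lin (T i).X ((T i).mixture ω p)‖ ^ 2 < c * n i} ≤ ε := by
  obtain ⟨κ, K, hκ, hK, hX⟩ := hA.eventually_frob
  obtain ⟨c, C, hc, hC, H⟩ := exists_nearlySingle_right r₁ r₃ hκ hK
  obtain ⟨τ, hτ, hτ1, hτ2⟩ : ∃ τ : ℝ, 0 < τ ∧ τ ≤ 1 ∧ 0 < c * √c * τ - r₃ * √C * τ ^ 2 := by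
    have ht : Tendsto (fun τ : ℝ => c * √c - r₃ * √C * τ) (𝓝[>] 0) (𝓝 (c * √c)) := by
      have : Continuous fun τ : ℝ => c * √c - r₃ * √C * τ := by fun_prop
      simpa using (this.tendsto 0).mono_left nhdsWithin_le_nhds
    have h1 := ht.eventually (eventually_gt_nhds (show 0 < c * √c by positivity))
    obtain ⟨τ, h1, h2, h3⟩ := (h1.and (Eventually.and self_mem_nhdsWithin
      (nhdsWithin_le_nhds (eventually_le_nhds (one_pos : (0 : ℝ) < 1))))).exists
    have := mul_pos h1 h2
    exact ⟨τ, h2, h3, by linarith⟩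
  obtain ⟨π, hπ, H⟩ := H τ hτ hτ1
  set b := c * √c * τ - r₃ * √C * τ ^ 2 with hb
  obtain ⟨c', hc', h⟩ := exists_measureReal_lt_le (l := l) 6 (ε := ε)
    (F := fun i (ω : Init r₁ r₃ (n i) (nd i)) =>
      ((n i : ℝ))⁻¹ * ‖lin (T i).X ((T i).mixture ω p)‖ ^ 2)
    (fun i => (isPoly_norm_sq_mixture (T i) p).const_mul _) (a := b ^ 2) (p := π) (by positivity)
    hπ hε (by
      filter_upwards [hX, hA.eventually_pos] with i hi hpos
      refine (H hpos.1 hpos.2 (T i).X hi.1 hi.2 p ⟨0, hr₃⟩).trans (measureReal_mono fun ω hω => ?_)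
      have h0 : (0 : ℝ) < n i := by exact_mod_cast hpos.1
      have h1 := pow_le_pow_left₀ (by positivity) (hω.1.le_norm_mixture hc hτ hω.2) 2
      rw [mul_pow, Real.sq_sqrt h0.le] at h1
      rw [Set.mem_ofPred_eq, abs_of_nonneg (by positivity), le_inv_mul_iff₀ h0, mul_comm]
      exact h1)
  refine ⟨c', hc', ?_⟩
  filter_upwards [h, hA.eventually_pos] with i hi hpos
  refine (measureReal_mono fun ω hω => ?_).trans hi
  have h0 : (0 : ℝ) < n i := by exact_mod_cast hpos.1
  rw [Set.mem_ofPred_eq, abs_of_nonneg (by positivity), inv_mul_lt_iff₀ h0, mul_comm]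
  exact hω

end Admissible

section Deterministic

variable {r₁ r₂ r₃ n m nd : ℕ} (T : Task n m nd) {η : Fin 4 → ℝ}
  (U₂ : Fin r₂ → EuclideanSpace ℝ (Fin m)) (ω : Init r₁ r₃ n nd)

lemma Task.norm_direction_le {V M : ℝ} (hV : ‖T.initialResidual‖ ≤ V) (hM : ∀ q, ‖U₂ q‖ ≤ M) :
    ‖T.direction U₂‖ ≤ r₂ * (V * M * M) := by
  calc ‖T.direction U₂‖ ≤ ∑ _q : Fin r₂, V * M * M := by
        refine (norm_sum_le _ _).trans (Finset.sum_le_sum fun q _ => ?_)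
        rw [norm_smul]
        have hV0 := (norm_nonneg _).trans hV
        have hM0 := (norm_nonneg _).trans (hM q)
        exact mul_le_mul ((abs_real_inner_le_norm _ _).trans
          (mul_le_mul hV (hM q) (norm_nonneg _) hV0)) (hM q) (norm_nonneg _) (by positivity)
    _ = _ := by simp

lemma Task.le_inner_direction {a₀ : ℝ} (ha₀ : 0 ≤ a₀) (q : Fin r₂)
    (h : a₀ ≤ |⟪T.initialResidual, U₂ q⟫_ℝ|) :
    a₀ ^ 2 ≤ ⟪T.initialResidual, T.direction U₂⟫_ℝ := by
  rw [Task.inner_direction]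
  calc a₀ ^ 2 ≤ ⟪T.initialResidual, U₂ q⟫_ℝ * ⟪T.initialResidual, U₂ q⟫_ℝ := by
        rw [← sq, ← sq_abs ⟪_, _⟫_ℝ]
        exact pow_le_pow_left₀ ha₀ h 2
    _ ≤ _ := Finset.single_le_sum
        (f := fun q => ⟪T.initialResidual, U₂ q⟫_ℝ * ⟪T.initialResidual, U₂ q⟫_ℝ)
        (fun _ _ => mul_self_nonneg _) (Finset.mem_univ q)

/-- If a term of the second kind is bounded below after the first step, then so is the rate of
the core. -/
lemma Task.le_rate_of_le_delta₂ (hη : ∀ j, 0 < η j) {c K V M W S : ℝ} (hK : 0 < K)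
    (hV : 0 < V) (hM : 0 < M) (hW : 0 < W) (hS : 0 < S) (hηK : η 2 ≤ K * η 0)
    (hv : ‖T.initialResidual‖ ≤ V) (hw : ‖T.direction U₂‖ ≤ W) (q : Fin r₂) (hq : ‖U₂ q‖ ≤ M)
    (hE : T.energy ω ≤ S) (hδ : c ≤ ‖T.delta₂ η (T.gdStep η (initParams U₂ ω)) q‖) :
    min 1 (c / (K * (V * M * S) ^ 2 * (V + S * W))) ≤ η 0 := by
  -- Only rates η 0 ≤ 1 need an argument: there the remaining factors of the term are bounded, and
  -- the term is at most a constant times η 2 ≤ K η 0.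
  rcases le_total 1 (η 0) with h1 | h1
  · exact (min_le_left _ _).trans h1
  refine (min_le_right _ _).trans ?_
  have h0 := hη 0
  have hE0 := T.energy_nonneg ω
  rw [Task.delta₂_gdStep_initParams, norm_smul, norm_neg, Real.norm_of_nonneg
    (mul_nonneg (hη 2).le (sq_nonneg _))] at hδ
  have ha : |⟪T.initialResidual, U₂ q⟫_ℝ| ≤ V * M :=
    (abs_real_inner_le_norm _ _).trans (mul_le_mul hv hq (norm_nonneg _) hV.le)
  have h2 : (η 0 * ⟪T.initialResidual, U₂ q⟫_ℝ * T.energy ω) ^ 2 ≤ (V * M * S) ^ 2 := by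
    rw [← sq_abs, abs_mul, abs_mul, abs_of_pos h0, abs_of_nonneg hE0]
    refine pow_le_pow_left₀ (by positivity) ?_ 2
    refine mul_le_mul ?_ hE hE0 (by positivity)
    calc η 0 * |⟪T.initialResidual, U₂ q⟫_ℝ| ≤ 1 * (V * M) :=
          mul_le_mul h1 ha (abs_nonneg _) zero_le_one
      _ = V * M := one_mul _
  have h3 : ‖T.initialResidual - (η 0 * T.energy ω) • T.direction U₂‖ ≤ V + S * W := by
    refine (norm_sub_le _ _).trans (add_le_add hv ?_)
    rw [norm_smul, Real.norm_of_nonneg (by positivity)]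
    refine mul_le_mul ?_ hw (norm_nonneg _) hS.le
    calc η 0 * T.energy ω ≤ 1 * S := mul_le_mul h1 hE hE0 zero_le_one
      _ = S := one_mul _
  rw [div_le_iff₀ (by positivity)]
  calc c ≤ (K * η 0 * (V * M * S) ^ 2) * (V + S * W) :=
        hδ.trans (mul_le_mul (mul_le_mul hηK h2 (sq_nonneg _) (by positivity)) h3 (norm_nonneg _)
          (by positivity))
    _ = _ := by ring

/-- The only factor that can cancel, ⟨v₀, w⟩ - η₀ E ‖w‖², vanishes at exactly one value of the
energy E, which does not depend on the random columns. Away from it the term grows at least linearly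
in n. -/
lemma Task.le_norm_delta₁ (hη : ∀ j, 0 < η j) {K h w₀ c₁ c₂ : ℝ} (hK : 0 < K) (hh : 0 < h)
    (hw₀ : 0 < w₀) (hc₁ : 0 < c₁) (hc₂ : 0 < c₂) (hη₀ : h ≤ η 0) (hηK : η 0 ≤ K * η 1)
    (hw : w₀ ≤ ‖T.direction U₂‖) (p : Fin r₁)
    (hE : c₁ ≤ |T.energy ω - ⟪T.initialResidual, T.direction U₂⟫_ℝ /
      (η 0 * ‖T.direction U₂‖ ^ 2)|)
    (hY : c₂ * n ≤ ‖lin T.X (T.mixture ω p)‖ ^ 2) :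
    h / K * h ^ 2 * (h * w₀ ^ 2 * c₁) * (c₂ * n) * w₀ ≤
      ‖T.delta₁ η (T.gdStep η (initParams U₂ ω)) p‖ := by
  have h0 := hη 0
  have h1 := hη 1
  have hwpos : 0 < ‖T.direction U₂‖ := hw₀.trans_le hw
  have e1 : ⟪T.initialResidual, T.direction U₂⟫_ℝ - η 0 * T.energy ω * ‖T.direction U₂‖ ^ 2 =
      -(η 0 * ‖T.direction U₂‖ ^ 2 * (T.energy ω - ⟪T.initialResidual, T.direction U₂⟫_ℝ /
      (η 0 * ‖T.direction U₂‖ ^ 2))) := by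
    field_simp
    ring
  rw [Task.delta₁_gdStep_initParams, e1, norm_smul, Real.norm_eq_abs, abs_neg, abs_mul,
    abs_mul (η 1 * η 0 ^ 2), abs_neg, abs_mul (η 0 * ‖T.direction U₂‖ ^ 2),
    abs_of_pos (show 0 < η 0 * ‖T.direction U₂‖ ^ 2 by positivity),
    abs_of_nonneg (sq_nonneg ‖lin T.X _‖), abs_of_pos (show 0 < η 1 * η 0 ^ 2 by positivity)]
  have h2 : h / K ≤ η 1 := by
    rw [div_le_iff₀ hK, mul_comm]
    exact hη₀.trans hηK
  gcongr

end Deterministic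

variable {r₁ r₂ r₃ : ℕ} {ι : Type*} {l : Filter ι} {n m nd : ι → ℕ}
  {T : ∀ i, Task (n i) (m i) (nd i)} {U₂ : ∀ i, Fin r₂ → EuclideanSpace ℝ (Fin (m i))}
  {η : ι → Fin 4 → ℝ}

namespace Admissible

lemma exists_energy_le (hA : Admissible l T U₂) (r₁ r₃ : ℕ) {ε : ℝ} (hε : 0 < ε) :
    ∃ S : ℝ, 0 < S ∧ ∀ᶠ i in l, 1 - ε ≤
      (initLaw r₁ r₃ (n i) (nd i)).real {ω | (T i).energy ω ≤ S} := by
  obtain ⟨κ, K, hκ, hK, hX⟩ := hA.eventually_frob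
  obtain ⟨C, hC, H⟩ := exists_init_bound r₁ r₃ hK hε
  refine ⟨r₁ * r₃ * C + 1, by positivity, ?_⟩
  filter_upwards [hX, hA.eventually_pos] with i hi hpos
  refine (H hpos.1 hpos.2 (T i).X hi.2).trans (measureReal_mono fun ω hω => ?_)
  have : (T i).energy ω ≤ ∑ _p : Fin r₁, ∑ _k : Fin r₃, C :=
    Finset.sum_le_sum fun p _ => Finset.sum_le_sum fun k _ => by
      rw [Task.bil_eq]
      exact hω.2.2 p k
  simp only [Finset.sum_const, Finset.card_univ, Fintype.card_fin, nsmul_eq_mul] at this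
  show (T i).energy ω ≤ _
  linarith

/-- With rates of the same order, the terms of the second step are not of order one. -/
theorem tendsto_probWithin_two (hA : Admissible l T U₂) (hr₁ : 0 < r₁) (hr₂ : 0 < r₂)
    (hr₃ : 0 < r₃) (hη : ∀ i j, 0 < η i j) (hηη : ∀ j j', (fun i => η i j) =O[l] fun i => η i j')
    {c : ℝ} (C : ℝ) (hc : 0 < c) :
    Tendsto (fun i => probWithin r₁ r₃ (T i) (η i) (U₂ i) 2 c C) l (𝓝 0) := by
  have hrate : ∀ j j', ∃ K : ℝ, 0 < K ∧ ∀ᶠ i in l, η i j ≤ K * η i j' := by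
    intro j j'
    obtain ⟨K, hK, h⟩ := (hηη j j').exists_pos
    refine ⟨K, hK, h.bound.mono fun i hi => ?_⟩
    rwa [Real.norm_of_nonneg (hη i j).le, Real.norm_of_nonneg (hη i j').le] at hi
  obtain ⟨K, hK, hηK⟩ := hrate 2 0
  obtain ⟨K', hK', hηK'⟩ := hrate 0 1
  obtain ⟨V, hV, hv⟩ := hA.res.exists_pos
  obtain ⟨M, hM, hnorm⟩ : ∃ M : ℝ, 0 < M ∧ ∀ᶠ i in l, ∀ q, ‖U₂ i q‖ ≤ M := by
    have h := IsBigO.fun_sum (s := Finset.univ) fun q _ => (hA.norm q).1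
    obtain ⟨M, hM, h⟩ := h.exists_pos
    refine ⟨M, hM, h.bound.mono fun i hi q => ?_⟩
    rw [norm_one, mul_one, Real.norm_of_nonneg (Finset.sum_nonneg fun _ _ => norm_nonneg _)] at hi
    exact (Finset.single_le_sum (f := fun q => ‖U₂ i q‖) (fun _ _ => norm_nonneg _)
      (Finset.mem_univ q)).trans hi
  obtain ⟨a, ha, hpair⟩ := (hA.inner ⟨0, hr₂⟩).2.exists_pos
  set W := r₂ * (V * M * M) with hW
  have hWpos : 0 < W := by
    have : (0 : ℝ) < r₂ := by exact_mod_cast hr₂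
    positivity
  -- One pairing of order one gives a⁻² ≤ ⟨v₀, w⟩ ≤ V ‖w‖, which bounds the direction w below.
  set w₀ := a⁻¹ ^ 2 / V with hw₀
  have hw₀pos : 0 < w₀ := by positivity
  have hdet : ∀ᶠ i in l, ‖(T i).initialResidual‖ ≤ V ∧ ‖(T i).direction (U₂ i)‖ ≤ W ∧
      w₀ ≤ ‖(T i).direction (U₂ i)‖ := by
    filter_upwards [hv.bound, hnorm, hpair.bound] with i h1 h2 h3
    rw [norm_norm, norm_one, mul_one] at h1
    refine ⟨h1, (T i).norm_direction_le (U₂ i) h1 h2, ?_⟩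
    rw [norm_one, Real.norm_eq_abs, real_inner_comm, ← inv_mul_le_iff₀ ha, mul_one] at h3
    have h4 := (T i).le_inner_direction (U₂ i) (inv_pos.2 ha).le ⟨0, hr₂⟩ h3
    rw [hw₀, div_le_iff₀ hV, mul_comm]
    exact h4.trans ((real_inner_le_norm _ _).trans
      (mul_le_mul_of_nonneg_right h1 (norm_nonneg _)))
  rw [tendsto_order]
  refine ⟨fun b hb => .of_forall fun i => hb.trans_le measureReal_nonneg, fun b hb => ?_⟩
  -- Three exceptional events are discarded: large energy, energy near the cancelling value, and
  -- small image of the mixture.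
  obtain ⟨ε, hε, hεb⟩ : ∃ ε : ℝ, 0 < ε ∧ 3 * ε < b := ⟨b / 4, by positivity, by linarith⟩
  obtain ⟨S, hS, hE⟩ := hA.exists_energy_le r₁ r₃ hε
  obtain ⟨c₁, hc₁, h₁⟩ := hA.exists_energy_sub_lt_le hr₁ hr₃ (fun i =>
    ⟪(T i).initialResidual, (T i).direction (U₂ i)⟫_ℝ /
      (η i 0 * ‖(T i).direction (U₂ i)‖ ^ 2)) hε
  obtain ⟨c₂, hc₂, h₂⟩ := hA.exists_mixture_lt_le (r₁ := r₁) hr₃ ⟨0, hr₁⟩ hε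
  set h := min 1 (c / (K * (V * M * S) ^ 2 * (V + S * W))) with hh
  have hpos : 0 < h := lt_min one_pos (by positivity)
  have hlarge : ∀ᶠ i in l, C < h / K' * h ^ 2 * (h * w₀ ^ 2 * c₁) * (c₂ * n i) * w₀ := by
    have : Tendsto (fun i => h / K' * h ^ 2 * (h * w₀ ^ 2 * c₁) * (c₂ * n i) * w₀) l atTop :=
      Tendsto.atTop_mul_const hw₀pos (Tendsto.const_mul_atTop (by positivity)
        (Tendsto.const_mul_atTop hc₂ (tendsto_natCast_atTop_atTop.comp hA.tendsto_n)))
    exact this.eventually_gt_atTop C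
  filter_upwards [hdet, hnorm, hηK, hηK', hE, h₁, h₂, hlarge] with i hdi hni hKi hKi' hEi h₁i h₂i hli
  refine lt_of_le_of_lt ?_ hεb
  have hE' : (initLaw r₁ r₃ (n i) (nd i)).real {ω | (T i).energy ω ≤ S}ᶜ ≤ ε := by
    have hm : MeasurableSet {ω : Init r₁ r₃ (n i) (nd i) | (T i).energy ω ≤ S} :=
      (isPoly_energy (T i)).cont.measurable measurableSet_Iic
    rw [measureReal_compl hm, probReal_univ]
    linarith
  have hsub : {ω : Init r₁ r₃ (n i) (nd i) | (T i).TermsWithin (η i)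
      ((T i).gd (η i) (initParams (U₂ i) ω) (2 - 1)) c C} ⊆
      ({ω | (T i).energy ω ≤ S}ᶜ ∪ {ω | |(T i).energy ω -
        ⟪(T i).initialResidual, (T i).direction (U₂ i)⟫_ℝ /
        (η i 0 * ‖(T i).direction (U₂ i)‖ ^ 2)| < c₁}) ∪
      {ω | ‖lin (T i).X ((T i).mixture ω ⟨0, hr₁⟩)‖ ^ 2 < c₂ * n i} := by
    intro ω hω
    by_contra hcon
    simp only [Set.mem_union, Set.mem_compl_iff, Set.mem_ofPred_eq, not_or, not_not, not_lt] at hcon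
    obtain ⟨⟨hc1, hc2⟩, hc3⟩ := hcon
    have hgd : (T i).gd (η i) (initParams (U₂ i) ω) (2 - 1) =
      (T i).gdStep (η i) (initParams (U₂ i) ω) := rfl
    rw [Set.mem_ofPred_eq, hgd] at hω
    have h3 := (T i).le_rate_of_le_delta₂ (U₂ i) ω (hη i) hK hV hM hWpos hS hKi hdi.1 hdi.2.1
      ⟨0, hr₂⟩ (hni _) hc1 (hω.2.2.1 ⟨0, hr₂⟩).1
    have h4 := (T i).le_norm_delta₁ (U₂ i) ω (hη i) hK' hpos hw₀pos hc₁ hc₂ h3 hKi' hdi.2.2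
      ⟨0, hr₁⟩ hc2 hc3
    linarith [(hω.2.1 ⟨0, hr₁⟩).2]
  calc _ ≤ _ := measureReal_mono hsub
    _ ≤ _ := (measureReal_union_le _ _).trans (add_le_add_left (measureReal_union_le _ _) _)
    _ ≤ 3 * ε := by linarith

end Admissible

/-- Training is not efficient if for some step the probabilities tend to zero. -/
lemma not_isEfficient_of_tendsto [l.NeBot] {t : ℕ} (ht : 2 ≤ t)
    (h : ∀ c C : ℝ, 0 < c → Tendsto (fun i => probWithin r₁ r₃ (T i) (η i) (U₂ i) t c C) l (𝓝 0)) :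
    ¬ IsEfficient r₁ r₃ l T η U₂ := by
  intro hE
  obtain ⟨c, C, hc, -, hP⟩ := hE t ht (1 / 2) (by norm_num)
  have h1 := (h c C hc).eventually (eventually_lt_nhds (show (0 : ℝ) < 1 / 2 by norm_num))
  obtain ⟨i, hi, hi'⟩ := (hP.and h1).exists
  linarith

end LoTRA

end

theorem theorem2 {r₁ r₂ r₃ : ℕ} (hr₁ : 0 < r₁) (hr₂ : 0 < r₂) (hr₃ : 0 < r₃)
    -- a family of models, with size `(n i, m i, nd i)`, in the regime `n → ∞`, `nd → ∞`
    {ι : Type*} (l : Filter ι) [l.NeBot] (n m nd : ι → ℕ)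
    (hn : Tendsto n l atTop) (hnd : Tendsto nd l atTop)
    (T : ∀ i, LoTRA.Task (n i) (m i) (nd i))
    (U₂ : ∀ i, Fin r₂ → EuclideanSpace ℝ (Fin (m i)))
    -- the entries of `X` are of order one in mean square, and the initial residual is bounded
    (hX : (fun i => (T i).frobSq) =Θ[l] fun i => (n i : ℝ) * (nd i : ℝ))
    (hv : (fun i => ‖(T i).initialResidual‖) =O[l] fun _ => (1 : ℝ))
    -- the initialization of `U₂`
    (hU : ∀ q, (fun i => ‖U₂ i q‖) =Θ[l] fun _ => (1 : ℝ))
    (hUv : ∀ q, (fun i => ⟪U₂ i q, (T i).initialResidual⟫_ℝ) =Θ[l] fun _ => (1 : ℝ)) :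
    -- learning rates of the same order: not efficient
    (∀ η : ι → Fin 4 → ℝ, (∀ i j, 0 < η i j) →
      (∀ j j', (fun i => η i j) =Θ[l] fun i => η i j') →
      ¬ LoTRA.IsEfficient r₁ r₃ l T η U₂ ∧
      ∃ t : ℕ, 2 ≤ t ∧ ∀ c C : ℝ, 0 < c →
        Tendsto (fun i => LoTRA.probWithin r₁ r₃ (T i) (η i) (U₂ i) t c C) l (𝓝 0)) ∧
    -- the given learning rates: efficient
    (∀ η : ι → Fin 4 → ℝ, (∀ i j, 0 < η i j) →
      ((fun i => η i 0) =Θ[l] fun _ => (1 : ℝ)) →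
      ((fun i => η i 1) =Θ[l] fun i => ((n i : ℝ))⁻¹) →
      ((fun i => η i 2) =Θ[l] fun _ => (1 : ℝ)) →
      ((fun i => η i 3) =Θ[l] fun i => ((nd i : ℝ))⁻¹) →
      LoTRA.IsEfficient r₁ r₃ l T η U₂) := by
  have hA : LoTRA.Admissible l T U₂ := ⟨hn, hnd, hX, hv, hU, hUv⟩
  refine ⟨fun η hη hηη => ?_, fun η hη h₀ h₁ h₂ h₃ =>
    hA.isEfficient ⟨hη, h₀, h₁, h₂, h₃⟩ hr₁ hr₂ hr₃⟩
  have h : ∀ c C : ℝ, 0 < c →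
      Tendsto (fun i => LoTRA.probWithin r₁ r₃ (T i) (η i) (U₂ i) 2 c C) l (𝓝 0) :=
    fun c C hc => hA.tendsto_probWithin_two hr₁ hr₂ hr₃ hη (fun j j' => (hηη j j').1) C hc
  exact ⟨LoTRA.not_isEfficient_of_tendsto le_rfl h, 2, le_rfl, h⟩
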